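/- **Setting (chain).** Let $X$ be an $n\times p$ real matrix with rows $x_i^T$, $y\in\{0,1\}^n$, $v\in\mathbb R^p$, and let $Q$ be a $p\times p$ symmetric matrix that is positive definite or zero. Put $\Sigma=X^TX+Q$, let $\Phi$ be the standard normal distribution function, and let $\Pi$ be the probability measure on $\mathbb R^p$ with density proportional to $$\prod_{i=1}^n\Phi(x_i^T\beta)^{y_i}\bigl(1-\Phi(x_i^T\beta)\bigr)^{1-y_i}\exp\bigl[-\tfrac12(\beta-v)^TQ(\beta-v)\bigr],$$ which is called proper if this function is integrable. The Albert–Chib chain, with transition kernel $K$, moves from $\beta$ to $\tilde\beta$ as follows: draw independent $Z_1,\dots,Z_n$, where $Z_i$ has the law $N(x_i^T\beta,1)$ truncated to $(0,\infty)$ if $y_i=1$ and to $(-\infty,0)$ if $y_i=0$; then draw $\tilde\beta\sim N(\Sigma^{-1}(X^TZ+Qv),\Sigma^{-1})$. For a distance $D$ between probability measures, the convergence rate $\rho_*\in[0,1]$ is the infimum of those $\rho<1$ for which there is $M:\mathbb R^p\to[0,\infty)$ with $D(K^m_\beta,\Pi)\le M(\beta)\rho^m$ for all $m\ge0$ and $\beta\in\mathbb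 R^p$, where $K^m_\beta$ is the law of the chain after $m$ steps from $\beta$ (and $\rho_*=1$ if there is no such $\rho$). Write $\rho_*(\psi)$ for the rate when $D$ is the Wasserstein distance $W_\psi(\mu,\nu)=\inf\int\psi\,d\upsilon$ (infimum over couplings $\upsilon$ of $\mu$ and $\nu$) with $\psi(\beta,\beta')=\{(\beta-\beta')^T\Sigma(\beta-\beta')\}^{1/2}$, and $\rho_*^{\mathrm{TV}}$ for the rate when $D$ is the total variation distance. **Setting (data).** Let $G:\mathbb R\to(0,1)$ be measurable, and $\bar G=\min(G,1-G)$. For every $p\ge1$ let there be given $\beta_*=\beta_{*,p}\in\mathbb R^p$, prior parameters $Q=Q_p$ (positive definite or zero) and $v=v_p$, and, on some probability space with probability $\tilde{\mathbb P}$ and expectation $\tilde{\mathbb E}$, iid random vectors $x_1,x_2,\dots$ in $\mathbb R^p$ and binary $y_1,y_2,\dots$ which, given $(x_i)_{i\ge1}$, are independent with $y_i\sim\mathrm{Bernoulli}(G(x_i^T\beta_*))$. For each $n$, consider the chain for the data $(x_i,y_i)_{i\le n}$ and the prior parameters $Q_p,v_p$. Assume: * (B1) for each $p$, $0<\lambda_{\min}(\tilde{\mathbb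 E}x_1x_1^T)\le\lambda_{\max}(\tilde{\mathbb E}x_1x_1^T)<\infty$; * (B2) for each $p$, $\tilde{\mathbb E}\|x_1\|_2^4<\infty$; * (B3) for each $p$, $\lim_{\delta\to0^+}\sup_{\alpha\in\mathbb R^p\setminus\{0\}}\tilde{\mathbb P}(|x_1^T\alpha|\le\delta\|x_1\|_2\|\alpha\|_2)=0$; * (B4) there is a constant $\ell>0$, not depending on $p$, such that for each $p$, $\lambda_{\min}\bigl[(\tilde{\mathbb E}x_1x_1^T)^{-1/2}\,\tilde{\mathbb E}\bigl(x_1x_1^T\bar G(x_1^T\beta_*)\bigr)\,(\tilde{\mathbb E}x_1x_1^T)^{-1/2}\bigr]>\ell$. **Conclusion.** There is a constant $\rho<1$, independent of $p$, such that for each $p\ge1$, almost surely: for all large $n$ the matrix $\Sigma$ is positive definite and the posterior $\Pi$ is proper (so that the chain and its rates are well defined), and $$\limsup_{n\to\infty}\rho_*(\psi)\le\rho\qquad\text{and}\qquad\limsup_{n\to\infty}\rho_*^{\mathrm{TV}}\le\rho.$$ -/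

import Mathlib

open MeasureTheory ProbabilityTheory Filter Topology
open scoped ENNReal NNReal Matrix

noncomputable section

namespace ProbitChain

/-! ### Distances between measures and convergence rates -/

/-- `γ` is a coupling of `μ` and `ν`. -/
def IsCoupling {S : Type*} [MeasurableSpace S] (μ ν : Measure S) (γ : Measure (S × S)) : Prop :=
  γ.map Prod.fst = μ ∧ γ.map Prod.snd = ν

/-- The Wasserstein distance induced by the cost `ψ`: the infimum, over all couplings, of the
expected cost. -/
def wasserstein {S : Type*} [MeasurableSpace S] (ψ : S → S → ℝ) (μ ν : Measure S) : ℝ≥0∞ :=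
  ⨅ (γ : Measure (S × S)) (_ : IsCoupling μ ν γ), ∫⁻ z, ENNReal.ofReal (ψ z.1 z.2) ∂γ

/-- The total variation distance: the supremum of the discrepancy over measurable sets. -/
def tvDistance {S : Type*} [MeasurableSpace S] (μ ν : Measure S) : ℝ≥0∞ :=
  ⨆ (A : Set S) (_ : MeasurableSet A), ENNReal.ofReal |μ.real A - ν.real A|

/-- `D (K^m (x, ·), π) ≤ M x * ρ ^ m` for all `m ≥ 0` and all `x`, for some finite function `M`.
Here `K ^ m` is the `m`-step transition kernel. -/
def GeometricBound {S : Type*} [MeasurableSpace S] (D : Measure S → Measure S → ℝ≥0∞)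
    (K : Kernel S S) (π : Measure S) (ρ : ℝ) : Prop :=
  ∃ M : S → ℝ≥0, ∀ (m : ℕ) (s : S), D ((K ^ m) s) π ≤ (M s : ℝ≥0∞) * ENNReal.ofReal ρ ^ m

/-- The convergence rate `ρ_* ∈ [0, 1]`: the infimum of the `ρ` for which the geometric bound holds.
The rate is `1` when the chain does not converge geometrically. -/
def convergenceRate {S : Type*} [MeasurableSpace S] (D : Measure S → Measure S → ℝ≥0∞)
    (K : Kernel S S) (π : Measure S) : ℝ :=
  sInf (insert 1 {ρ : ℝ | 0 ≤ ρ ∧ ρ < 1 ∧ GeometricBound D K π ρ})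

theorem convergenceRate_mem_Icc {S : Type*} [MeasurableSpace S]
    (D : Measure S → Measure S → ℝ≥0∞) (K : Kernel S S) (π : Measure S) :
    convergenceRate D K π ∈ Set.Icc (0 : ℝ) 1 := by
  have hnn : ∀ ρ ∈ insert 1 {ρ : ℝ | 0 ≤ ρ ∧ ρ < 1 ∧ GeometricBound D K π ρ}, (0 : ℝ) ≤ ρ := by
    rintro ρ (rfl | h)
    · exact zero_le_one
    · exact h.1
  exact ⟨Real.sInf_nonneg hnn, csInf_le ⟨0, hnn⟩ (Set.mem_insert _ _)⟩

/-! ### The Bayesian probit model and the Albert–Chib chain -/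

/-- The standard normal distribution function. -/
def stdNormalCdf (t : ℝ) : ℝ := cdf (gaussianReal 0 1) t

section Chain

variable {n p : ℕ}

/-- `Σ = XᵀX + Q`. -/
def precision (X : Matrix (Fin n) (Fin p) ℝ) (Q : Matrix (Fin p) (Fin p) ℝ) :
    Matrix (Fin p) (Fin p) ℝ :=
  Xᵀ * X + Q

/-- The distance `ψ` induced by the norm `‖β‖ = (βᵀ Σ β)^{1/2}`. -/
def sigmaDist (S : Matrix (Fin p) (Fin p) ℝ) (β β' : EuclideanSpace ℝ (Fin p)) : ℝ :=
  √(WithLp.ofLp (β - β') ⬝ᵥ S *ᵥ WithLp.ofLp (β - β'))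

/-- The unnormalized posterior density
`∏ᵢ Φ(xᵢᵀβ)^{yᵢ} (1 - Φ(xᵢᵀβ))^{1 - yᵢ} exp(-(β - v)ᵀ Q (β - v) / 2)`. -/
def posteriorWeight (X : Matrix (Fin n) (Fin p) ℝ) (y : Fin n → Bool)
    (Q : Matrix (Fin p) (Fin p) ℝ) (v β : EuclideanSpace ℝ (Fin p)) : ℝ :=
  (∏ i, if y i then stdNormalCdf ((X *ᵥ WithLp.ofLp β) i)
    else 1 - stdNormalCdf ((X *ᵥ WithLp.ofLp β) i)) *
  Real.exp (-(1 / 2) * (WithLp.ofLp (β - v) ⬝ᵥ Q *ᵥ WithLp.ofLp (β - v)))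

/-- The unnormalized posterior measure. -/
def unnormalizedPosterior (X : Matrix (Fin n) (Fin p) ℝ) (y : Fin n → Bool)
    (Q : Matrix (Fin p) (Fin p) ℝ) (v : EuclideanSpace ℝ (Fin p)) :
    Measure (EuclideanSpace ℝ (Fin p)) :=
  volume.withDensity fun β => ENNReal.ofReal (posteriorWeight X y Q v β)

/-- The posterior is proper. -/
def PosteriorProper (X : Matrix (Fin n) (Fin p) ℝ) (y : Fin n → Bool)
    (Q : Matrix (Fin p) (Fin p) ℝ) (v : EuclideanSpace ℝ (Fin p)) : Prop :=
  unnormalizedPosterior X y Q v Set.univ < ∞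

/-- The posterior distribution `Π` (the zero measure when the posterior is improper). -/
def posterior (X : Matrix (Fin n) (Fin p) ℝ) (y : Fin n → Bool)
    (Q : Matrix (Fin p) (Fin p) ℝ) (v : EuclideanSpace ℝ (Fin p)) :
    Measure (EuclideanSpace ℝ (Fin p)) :=
  (unnormalizedPosterior X y Q v Set.univ)⁻¹ • unnormalizedPosterior X y Q v

/-- The half line to which the latent variable with response `a` is truncated. -/
def halfLine (a : Bool) : Set ℝ := if a then Set.Ioi 0 else Set.Iio 0

theorem measurableSet_halfLine (a : Bool) : MeasurableSet (halfLine a) := by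
  cases a
  · simp [halfLine]
  · simp [halfLine]

theorem gaussianReal_halfLine_ne_zero (μ : ℝ) (a : Bool) :
    gaussianReal μ 1 (halfLine a) ≠ 0 := by
  intro h
  have h0 := gaussianReal_absolutelyContinuous' μ one_ne_zero h
  cases a <;> simp [halfLine] at h0

/-- The truncated normal distribution `TN(μ, 1; a)`. -/
def truncatedNormal (μ : ℝ) (a : Bool) : Measure ℝ := cond (gaussianReal μ 1) (halfLine a)

instance isProbabilityMeasure_truncatedNormal (μ : ℝ) (a : Bool) :
    IsProbabilityMeasure (truncatedNormal μ a) :=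
  cond_isProbabilityMeasure (gaussianReal_halfLine_ne_zero μ a)

theorem measurable_truncatedNormal (a : Bool) : Measurable fun μ => truncatedNormal μ a := by
  refine Measure.measurable_of_measurable_coe _ fun s hs => ?_
  have hg : Measurable fun μ : ℝ => gaussianReal μ 1 :=
    measurable_gaussianReal.comp (measurable_id.prodMk measurable_const)
  simp only [truncatedNormal, cond_apply (measurableSet_halfLine a)]
  exact ((Measure.measurable_coe (measurableSet_halfLine a)).comp hg).inv.mul
    ((Measure.measurable_coe ((measurableSet_halfLine a).inter hs)).comp hg)

/-- First step of the algorithm: given `β`, the `Zᵢ ∼ TN(xᵢᵀβ, 1; yᵢ)` are independent. -/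
def latentKernel (X : Matrix (Fin n) (Fin p) ℝ) (y : Fin n → Bool) :
    Kernel (EuclideanSpace ℝ (Fin p)) (Fin n → ℝ) where
  toFun β := Measure.pi fun i => truncatedNormal ((X *ᵥ WithLp.ofLp β) i) (y i)
  measurable' := by
    refine Measurable.measure_of_isPiSystem_of_isProbabilityMeasure generateFrom_pi.symm
      isPiSystem_pi ?_
    rintro _ ⟨t, ht, rfl⟩
    simp only [Measure.pi_pi]
    refine Finset.measurable_prod _ fun i _ => ?_
    have ht' : MeasurableSet (t i) := ht i (Set.mem_univ i)
    refine (Measure.measurable_coe ht').comp ((measurable_truncatedNormal (y i)).comp ?_)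
    have hc : Continuous fun β : EuclideanSpace ℝ (Fin p) => (X *ᵥ WithLp.ofLp β) i := by
      simp only [Matrix.mulVec, dotProduct]
      fun_prop
    exact hc.measurable

/-- The conditional mean `Σ⁻¹ (Xᵀ z + Q v)` of the second step. -/
def coefficientMean (X : Matrix (Fin n) (Fin p) ℝ) (Q : Matrix (Fin p) (Fin p) ℝ)
    (v : EuclideanSpace ℝ (Fin p)) (z : Fin n → ℝ) : EuclideanSpace ℝ (Fin p) :=
  WithLp.toLp 2 ((precision X Q)⁻¹ *ᵥ (Xᵀ *ᵥ z + Q *ᵥ WithLp.ofLp v))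

theorem continuous_coefficientMean (X : Matrix (Fin n) (Fin p) ℝ) (Q : Matrix (Fin p) (Fin p) ℝ)
    (v : EuclideanSpace ℝ (Fin p)) : Continuous (coefficientMean X Q v) := by
  unfold coefficientMean
  fun_prop

section

open scoped MatrixOrder

/-- Second step of the algorithm: given `z`, the next state is drawn from
`N(Σ⁻¹ (Xᵀ z + Q v), Σ⁻¹)`. -/
def coefficientKernel (X : Matrix (Fin n) (Fin p) ℝ) (Q : Matrix (Fin p) (Fin p) ℝ)
    (v : EuclideanSpace ℝ (Fin p)) : Kernel (Fin n → ℝ) (EuclideanSpace ℝ (Fin p)) where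
  toFun z := multivariateGaussian (coefficientMean X Q v z) (precision X Q)⁻¹
  measurable' := by
    have hm := (continuous_coefficientMean X Q v).measurable
    refine Measure.measurable_of_measurable_coe _ fun s hs => ?_
    have hf : Measurable fun w : (Fin n → ℝ) × EuclideanSpace ℝ (Fin p) =>
        coefficientMean X Q v w.1 +
          Matrix.toEuclideanCLM (𝕜 := ℝ) (CFC.sqrt (precision X Q)⁻¹) w.2 := by
      fun_prop
    have key := measurable_measure_prodMk_left
      (ν := stdGaussian (EuclideanSpace ℝ (Fin p))) (hf hs)
    convert key using 2 with z
    rw [multivariateGaussian, Measure.map_apply (by fun_prop) hs]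
    rfl

end

/-- The Markov transition kernel of the Albert–Chib chain. -/
def acKernel (X : Matrix (Fin n) (Fin p) ℝ) (y : Fin n → Bool) (Q : Matrix (Fin p) (Fin p) ℝ)
    (v : EuclideanSpace ℝ (Fin p)) :
    Kernel (EuclideanSpace ℝ (Fin p)) (EuclideanSpace ℝ (Fin p)) :=
  coefficientKernel X Q v ∘ₖ latentKernel X y

/-- The rate `ρ_*(ψ)` of the Albert–Chib chain with respect to the Wasserstein distance. -/
def rateWasserstein (X : Matrix (Fin n) (Fin p) ℝ) (y : Fin n → Bool)
    (Q : Matrix (Fin p) (Fin p) ℝ) (v : EuclideanSpace ℝ (Fin p)) : ℝ :=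
  convergenceRate (wasserstein (sigmaDist (precision X Q))) (acKernel X y Q v) (posterior X y Q v)

/-- The rate of the Albert–Chib chain with respect to total variation. -/
def rateTV (X : Matrix (Fin n) (Fin p) ℝ) (y : Fin n → Bool)
    (Q : Matrix (Fin p) (Fin p) ℝ) (v : EuclideanSpace ℝ (Fin p)) : ℝ :=
  convergenceRate tvDistance (acKernel X y Q v) (posterior X y Q v)

/-- The design matrix whose `i`th row is `xᵢᵀ`. -/
def designMatrix (x : ℕ → EuclideanSpace ℝ (Fin p)) (n : ℕ) : Matrix (Fin n) (Fin p) ℝ :=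
  Matrix.of fun i j => x i j

end Chain

/-! ### The random data sets -/

section Data

variable {p : ℕ} {Ω : Type*} [MeasurableSpace Ω]

/-- The probability that a Bernoulli variable with success probability `q` takes the value `a`. -/
def bernoulliWeight (q : ℝ) (a : Bool) : ℝ := if a then q else 1 - q

/-- The data mechanism: the `xᵢ` are iid and, given the whole sequence `(xᵢ)`, the `yᵢ` are
independent with `yᵢ ∼ Bernoulli(G(xᵢᵀβ_*))`. -/
structure IsDataMechanism (P : Measure Ω) (G : ℝ → ℝ) (βstar : EuclideanSpace ℝ (Fin p))
    (x : ℕ → Ω → EuclideanSpace ℝ (Fin p)) (y : ℕ → Ω → Bool) : Prop where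
  measurable_x : ∀ i, Measurable (x i)
  measurable_y : ∀ i, Measurable (y i)
  indep_x : iIndepFun x P
  identDistrib_x : ∀ i, IdentDistrib (x i) (x 0) P P
  cond_y : ∀ (s : Finset ℕ) (a : ℕ → Bool),
    P⟦{ω | ∀ i ∈ s, y i ω = a i} | MeasurableSpace.comap (fun ω i => x i ω) MeasurableSpace.pi⟧
      =ᵐ[P] fun ω => ∏ i ∈ s, bernoulliWeight (G (inner ℝ (x i ω) βstar)) (a i)

/-- The smallest eigenvalue of a Hermitian matrix. -/
def lambdaMin (A : Matrix (Fin p) (Fin p) ℝ) : ℝ := sInf (spectrum ℝ A)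

section

open scoped MatrixOrder

/-- `A^{-1/2}` for a positive definite matrix `A`. -/
def invSqrt (A : Matrix (Fin p) (Fin p) ℝ) : Matrix (Fin p) (Fin p) ℝ := (CFC.sqrt A)⁻¹

end

/-- The matrix `E[ξ ξᵀ w(ξ)]` of weighted second moments of a random vector `ξ`. -/
def momentMatrix (P : Measure Ω) (ξ : Ω → EuclideanSpace ℝ (Fin p))
    (w : EuclideanSpace ℝ (Fin p) → ℝ) : Matrix (Fin p) (Fin p) ℝ :=
  Matrix.of fun j k => ∫ ω, ξ ω j * ξ ω k * w (ξ ω) ∂P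

/-- `Ḡ = G ∧ (1 - G)`. -/
def barG (G : ℝ → ℝ) (t : ℝ) : ℝ := min (G t) (1 - G t)

/-- The second moments are finite, that is, `λ_max(E ξξᵀ) < ∞`, and `λ_min(E ξξᵀ) > 0`. -/
def CondB1 (P : Measure Ω) (ξ : Ω → EuclideanSpace ℝ (Fin p)) : Prop :=
  Integrable (fun ω => ‖ξ ω‖ ^ 2) P ∧ 0 < lambdaMin (momentMatrix P ξ fun _ => 1)

/-- `E ‖ξ‖⁴ < ∞`. -/
def CondB2 (P : Measure Ω) (ξ : Ω → EuclideanSpace ℝ (Fin p)) : Prop :=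
  Integrable (fun ω => ‖ξ ω‖ ^ 4) P

/-- `sup_{α ≠ 0} P(|ξᵀα| ≤ δ ‖ξ‖ ‖α‖) → 0` as `δ → 0+`. -/
def CondB3 (P : Measure Ω) (ξ : Ω → EuclideanSpace ℝ (Fin p)) : Prop :=
  Tendsto (fun δ : ℝ => ⨆ (α : EuclideanSpace ℝ (Fin p)) (_ : α ≠ 0),
    P {ω | |inner ℝ (ξ ω) α| ≤ δ * ‖ξ ω‖ * ‖α‖}) (𝓝[>] 0) (𝓝 0)

/-- `λ_min[(E ξξᵀ)^{-1/2} (E ξξᵀ Ḡ(ξᵀβ_*)) (E ξξᵀ)^{-1/2}] > ℓ`. -/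
def CondB4 (P : Measure Ω) (G : ℝ → ℝ) (βstar : EuclideanSpace ℝ (Fin p))
    (ξ : Ω → EuclideanSpace ℝ (Fin p)) (ℓ : ℝ) : Prop :=
  ℓ < lambdaMin (invSqrt (momentMatrix P ξ fun _ => 1) *
    momentMatrix P ξ (fun u => barG G (inner ℝ u βstar)) *
    invSqrt (momentMatrix P ξ fun _ => 1))

end Data

end ProbitChain

end

/-! One step of the chain is written as a random map of the current state, driven by noise whose law
does not depend on the state: independent uniform variables, turned into truncated normals by
inverting their distribution functions, and a standard Gaussian vector. Two copies driven by the
same noise approach each other in mean Σ-distance by a fixed factor, and this factor bounds both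
convergence rates.

The contraction has three ingredients. The Gaussian noise cancels between the two copies, and the
conditional mean, as a map from latent vectors with the Euclidean norm to coefficients with the
Σ-norm, increases no distance (`sq_sigmaDist_coefficientMean_le`). Log-concavity of Φ makes each
coupled latent variable nondecreasing and 1-Lipschitz in its location (`latentMap_sub_mem_Icc`); its
squared increment is therefore at most the increment times the change of location, so that second
moments are controlled by increments of the truncated mean. The derivative of that mean is at most 1
everywhere, and at most 3/4 when the location lies on the wrong side of the truncation point
(`latentSlope_le`). If, at every state and in every direction, wrong-side observations carry a
fraction c of XᵀX (`WrongSideBound`), integration along the segment between the two states gives the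
factor 1 - c/4 for squared distances, hence √(1 - c/4) for distances.

Wrong-side observations also force Gaussian decay of the posterior weight (`posteriorWeight_le`),
which gives propriety and a finite expected Σ-distance to the posterior. The posterior is invariant
because the chain is a two-block data augmentation (`bind_comp_eq_of_jointDensity`). Iterating the
coupling against a stationary copy gives the Wasserstein rate. For total variation one further step
is used: the step ends with a Gaussian draw, which is Lipschitz in total variation as a function of
its mean, so a small coupling cost becomes a small total variation distance at the same geometric
rate (`rates_le_of_wrongSideBound`).

It remains to find c, independent of p, for random data
(`IsDataMechanism.ae_eventually_wrongSideBound`). Given x, and away from a thin slab around the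
hyperplane orthogonal to a direction, the response is the wrong one for that direction with
conditional probability at least Ḡ. By (B4) the expected wrong-side quadratic form is then at least
ℓ times the full one, up to the contribution of the slab, which (B2) and (B3) make uniformly small.
A relative margin in the wrong-side event lets a finite net of the unit sphere serve all directions,
and the strong law for the finitely many matrix entries at each net point transfers the bound to
large samples. -/

noncomputable section

namespace ProbitChain

/-! ### The standard normal distribution function -/

/-- The standard normal density. -/
def stdNormalPdf (t : ℝ) : ℝ := gaussianPDFReal 0 1 t

theorem stdNormalPdf_eq (t : ℝ) : stdNormalPdf t = (√(2 * Real.pi))⁻¹ * Real.exp (-t ^ 2 / 2) := by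
  simp [stdNormalPdf, gaussianPDFReal]

theorem stdNormalPdf_pos (t : ℝ) : 0 < stdNormalPdf t :=
  gaussianPDFReal_pos 0 1 t one_ne_zero

theorem gaussianPDFReal_eq_stdNormalPdf (μ z : ℝ) :
    gaussianPDFReal μ 1 z = stdNormalPdf (z - μ) := by
  simp [stdNormalPdf, gaussianPDFReal]

theorem stdNormalPdf_neg (t : ℝ) : stdNormalPdf (-t) = stdNormalPdf t := by
  simp [stdNormalPdf_eq]

theorem hasDerivAt_stdNormalPdf (t : ℝ) : HasDerivAt stdNormalPdf (-t * stdNormalPdf t) t := by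
  have h : HasDerivAt (fun t : ℝ => (√(2 * Real.pi))⁻¹ * Real.exp (-t ^ 2 / 2))
      ((√(2 * Real.pi))⁻¹ * (Real.exp (-t ^ 2 / 2) * (-(2 * t) / 2))) t := by
    have := ((((hasDerivAt_pow 2 t).neg).div_const 2).exp).const_mul (√(2 * Real.pi))⁻¹
    simpa using this
  rw [funext stdNormalPdf_eq]
  convert h using 1
  ring

theorem continuous_stdNormalPdf : Continuous stdNormalPdf :=
  continuous_iff_continuousAt.2 fun t => (hasDerivAt_stdNormalPdf t).continuousAt

theorem integrable_stdNormalPdf : Integrable stdNormalPdf := integrable_gaussianPDFReal 0 1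

theorem stdNormalCdf_eq_integral (t : ℝ) : stdNormalCdf t = ∫ x in Set.Iic t, stdNormalPdf x := by
  rw [stdNormalCdf, cdf_eq_real, measureReal_def, gaussianReal_apply_eq_integral 0 one_ne_zero,
    ENNReal.toReal_ofReal (integral_nonneg fun x => gaussianPDFReal_nonneg _ _ _)]
  rfl

theorem hasDerivAt_stdNormalCdf (t : ℝ) : HasDerivAt stdNormalCdf (stdNormalPdf t) t := by
  have h : stdNormalCdf = fun t => stdNormalCdf 0 + ∫ x in (0 : ℝ)..t, stdNormalPdf x := by
    ext t
    rw [stdNormalCdf_eq_integral, stdNormalCdf_eq_integral, ← intervalIntegral.integral_Iic_sub_Iic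
      integrable_stdNormalPdf.integrableOn integrable_stdNormalPdf.integrableOn]
    ring
  rw [h]
  exact (intervalIntegral.integral_hasDerivAt_right
    integrable_stdNormalPdf.intervalIntegrable
    (continuous_stdNormalPdf.stronglyMeasurableAtFilter _ _)
    continuous_stdNormalPdf.continuousAt).const_add _

theorem continuous_stdNormalCdf : Continuous stdNormalCdf :=
  continuous_iff_continuousAt.2 fun t => (hasDerivAt_stdNormalCdf t).continuousAt

theorem strictMono_stdNormalCdf : StrictMono stdNormalCdf :=
  strictMono_of_hasDerivAt_pos hasDerivAt_stdNormalCdf stdNormalPdf_pos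

theorem stdNormalCdf_pos (t : ℝ) : 0 < stdNormalCdf t :=
  (cdf_nonneg _ (t - 1)).trans_lt (strictMono_stdNormalCdf (sub_one_lt t))

theorem stdNormalCdf_lt_one (t : ℝ) : stdNormalCdf t < 1 :=
  (strictMono_stdNormalCdf (lt_add_one t)).trans_le (cdf_le_one _ _)

theorem tendsto_stdNormalCdf_atBot : Tendsto stdNormalCdf atBot (𝓝 0) := tendsto_cdf_atBot _

theorem tendsto_stdNormalCdf_atTop : Tendsto stdNormalCdf atTop (𝓝 1) := tendsto_cdf_atTop _

theorem tendsto_stdNormalPdf_atBot : Tendsto stdNormalPdf atBot (𝓝 0) := by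
  have h : Tendsto (fun t : ℝ => (√(2 * Real.pi))⁻¹ * Real.exp (-t ^ 2 / 2)) atBot
      (𝓝 ((√(2 * Real.pi))⁻¹ * 0)) := by
    refine (Real.tendsto_exp_atBot.comp ?_).const_mul _
    have : Tendsto (fun t : ℝ => -(t ^ 2 / 2)) atBot atBot :=
      by
        have h1 := (tendsto_pow_atTop (α := ℝ) two_ne_zero).comp tendsto_abs_atBot_atTop
        have h2 := tendsto_neg_atTop_atBot.comp (h1.atTop_div_const two_pos)
        simpa [Function.comp_def] using h2
    simpa [neg_div] using this
  simpa [funext stdNormalPdf_eq] using h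

theorem gaussianReal_real_Ioi (μ t : ℝ) :
    (gaussianReal μ 1).real (Set.Ioi t) = stdNormalCdf (μ - t) := by
  have h : gaussianReal μ 1 = (gaussianReal 0 1).map (fun x => μ - x) := by
    rw [gaussianReal_map_const_sub]; simp
  have hae : (Set.Iio (μ - t) : Set ℝ) =ᵐ[gaussianReal 0 1] Set.Iic (μ - t) := by
    have := nullSingletonClass_gaussianReal (μ := 0) (v := 1) one_ne_zero
    exact Iio_ae_eq_Iic
  rw [stdNormalCdf, cdf_eq_real, h, map_measureReal_apply (by fun_prop) measurableSet_Ioi,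
    ← measureReal_congr hae]
  congr 1
  ext x
  simp only [Set.mem_preimage, Set.mem_Ioi, Set.mem_Iio]
  constructor <;> intro h <;> linarith

theorem stdNormalCdf_neg (t : ℝ) : stdNormalCdf (-t) = 1 - stdNormalCdf t := by
  have h := gaussianReal_real_Ioi 0 t
  rw [zero_sub] at h
  rw [← h, ← Set.compl_Iic, probReal_compl_eq_one_sub measurableSet_Iic, stdNormalCdf, cdf_eq_real]

theorem stdNormalCdf_zero : stdNormalCdf 0 = 1 / 2 := by
  have := stdNormalCdf_neg 0
  rw [neg_zero] at this
  linarith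

/-! ### The inverse Mills ratio -/

/-- The ratio `φ / Φ`. -/
def millsRatio (t : ℝ) : ℝ := stdNormalPdf t / stdNormalCdf t

theorem millsRatio_pos (t : ℝ) : 0 < millsRatio t :=
  div_pos (stdNormalPdf_pos t) (stdNormalCdf_pos t)

theorem hasDerivAt_millsRatio (t : ℝ) :
    HasDerivAt millsRatio (-(millsRatio t * (t + millsRatio t))) t := by
  have h := (hasDerivAt_stdNormalPdf t).div (hasDerivAt_stdNormalCdf t) (stdNormalCdf_pos t).ne'
  refine h.congr_deriv ?_
  have := (stdNormalCdf_pos t).ne'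
  simp only [millsRatio]
  field_simp
  ring

/-- A function that tends to `0` at `-∞` and has nonpositive derivative on `(-∞, 0]` is nonpositive
there. -/
theorem nonpos_of_tendsto_atBot_of_hasDerivAt_nonpos {f f' : ℝ → ℝ} (hf : Tendsto f atBot (𝓝 0))
    (hd : ∀ t ≤ 0, HasDerivAt f (f' t) t) (hn : ∀ t ≤ 0, f' t ≤ 0) {t : ℝ} (ht : t ≤ 0) :
    f t ≤ 0 := by
  have hanti : AntitoneOn f (Set.Iic 0) := by
    refine antitoneOn_of_deriv_nonpos (convex_Iic 0)
      (fun x hx => (hd x hx).continuousAt.continuousWithinAt)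
      (fun x hx =>
        (hd x (interior_subset (s := Set.Iic 0) hx)).differentiableAt.differentiableWithinAt)
      fun x hx => ?_
    have hx' : x ≤ 0 := interior_subset (s := Set.Iic 0) hx
    rw [(hd x hx').deriv]
    exact hn x hx'
  refine ge_of_tendsto hf ?_
  filter_upwards [eventually_le_atBot t] with s hs
  exact hanti (hs.trans ht) ht hs

/-- Write g for the left side. Then Φ - φ/g tends to 0 at -∞ and has nonpositive derivative on (-∞,
0], hence is nonpositive there. The correction 1/(2 - t) to the classical bound -t is what keeps the
product in `millsRatio_mul_ge` away from 0. -/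
theorem millsRatio_ge {t : ℝ} (ht : t ≤ 0) : -t + 1 / (2 - t) ≤ millsRatio t := by
  have hg : ∀ s ≤ (0 : ℝ), 0 < -s + 1 / (2 - s) := fun s hs => by
    have : 0 < 1 / (2 - s) := by apply one_div_pos.2; linarith
    linarith
  have hd : ∀ s ≤ (0 : ℝ), HasDerivAt (fun s => -s + 1 / (2 - s)) (-1 + 1 / (2 - s) ^ 2) s := by
    intro s hs
    have h2 : (2 - s) ≠ 0 := by linarith
    have := (hasDerivAt_neg s).add (((hasDerivAt_id s).const_sub 2).fun_inv h2)
    simp only [one_div]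
    refine this.congr_deriv ?_
    simp
  have key := nonpos_of_tendsto_atBot_of_hasDerivAt_nonpos
    (f := fun s => stdNormalCdf s - stdNormalPdf s / (-s + 1 / (2 - s)))
    (f' := fun s => stdNormalPdf s - ((-s * stdNormalPdf s) * (-s + 1 / (2 - s)) -
      stdNormalPdf s * (-1 + 1 / (2 - s) ^ 2)) / (-s + 1 / (2 - s)) ^ 2) ?_
    (fun s hs => (hasDerivAt_stdNormalCdf s).sub
      ((hasDerivAt_stdNormalPdf s).div (hd s hs) (hg s hs).ne')) ?_ ht
  · rw [millsRatio, le_div_iff₀ (stdNormalCdf_pos t), mul_comm, ← le_div_iff₀ (hg t ht)]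
    linarith
  · have h1 : Tendsto (fun s : ℝ => stdNormalPdf s / (-s + 1 / (2 - s))) atBot (𝓝 0) := by
      refine squeeze_zero' ?_ ?_ tendsto_stdNormalPdf_atBot
      · filter_upwards [eventually_le_atBot 0] with s hs
        exact (div_pos (stdNormalPdf_pos s) (hg s hs)).le
      · filter_upwards [eventually_le_atBot (-1)] with s hs
        refine div_le_self (stdNormalPdf_pos s).le ?_
        have : 0 < 1 / (2 - s) := by apply one_div_pos.2; linarith
        linarith
    simpa using tendsto_stdNormalCdf_atBot.sub h1
  -- With u = 1/(2 - s) and (2 - s)u = 1, the sign condition is g² ≤ -s g + 1 - u², which reduces to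
  -- u² ≤ u.
  · intro s hs
    have hgs := hg s hs
    have hu : 0 < 1 / (2 - s) := by apply one_div_pos.2; linarith
    have hu' : (2 - s) * (1 / (2 - s)) = 1 := by
      rw [mul_one_div_cancel]; linarith
    have he : 1 / (2 - s) ^ 2 = (1 / (2 - s)) ^ 2 := by rw [div_pow, one_pow]
    rw [he]
    generalize 1 / (2 - s) = u at *
    rw [sub_nonpos, le_div_iff₀ (by positivity)]
    have hs1 : u ^ 2 * 2 ≤ 1 := by nlinarith
    have : (-s + u) ^ 2 ≤ -s * (-s + u) - (-1 + u ^ 2) := by nlinarith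
    nlinarith [stdNormalPdf_pos s]

/-- The product is one minus the derivative of the truncated mean, so this is the quantitative
source of contraction. With u = 1/(2 - t) ≤ 1/2, the bound of `millsRatio_ge` makes it at least (-t
+ u)u = (1 - u)². -/
theorem millsRatio_mul_ge {t : ℝ} (ht : t ≤ 0) :
    1 / 4 ≤ millsRatio t * (t + millsRatio t) := by
  have h := millsRatio_ge ht
  have hu : 0 < 1 / (2 - t) := by apply one_div_pos.2; linarith
  have hu' : (2 - t) * (1 / (2 - t)) = 1 := by
    rw [mul_one_div_cancel]; linarith
  generalize 1 / (2 - t) = u at *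
  have h1 : (-t + u) * u ≤ millsRatio t * (t + millsRatio t) :=
    mul_le_mul h (by linarith) hu.le (millsRatio_pos t).le
  have h2 : (-t + u) * u = (1 - u) ^ 2 := by nlinarith
  have h3 : u ≤ 1 / 2 := by nlinarith
  nlinarith

theorem millsRatio_mul_nonneg (t : ℝ) : 0 ≤ millsRatio t * (t + millsRatio t) := by
  rcases le_total t 0 with ht | ht
  · linarith [millsRatio_mul_ge ht]
  · have := millsRatio_pos t
    positivity

theorem antitone_millsRatio : Antitone millsRatio :=
  antitone_of_hasDerivAt_nonpos hasDerivAt_millsRatio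
    fun t => neg_nonpos.2 (millsRatio_mul_nonneg t)

/-- A consequence of the log-concavity of `Φ`. -/
theorem stdNormalCdf_mul_le {s t δ : ℝ} (hst : s ≤ t) (hδ : 0 ≤ δ) :
    stdNormalCdf s * stdNormalCdf (t + δ) ≤ stdNormalCdf (s + δ) * stdNormalCdf t := by
  have hd : ∀ u, HasDerivAt (fun u => stdNormalCdf (u + δ) / stdNormalCdf u)
      ((stdNormalPdf (u + δ) * stdNormalCdf u - stdNormalCdf (u + δ) * stdNormalPdf u) /
        stdNormalCdf u ^ 2) u := fun u =>
    ((hasDerivAt_stdNormalCdf (u + δ)).comp_add_const u δ).div (hasDerivAt_stdNormalCdf u)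
      (stdNormalCdf_pos u).ne'
  -- The logarithmic derivative of this quotient is the Mills ratio at u + δ minus that at u.
  have hanti : Antitone fun u => stdNormalCdf (u + δ) / stdNormalCdf u := by
    refine antitone_of_hasDerivAt_nonpos hd fun u => ?_
    have h1 : millsRatio (u + δ) ≤ millsRatio u := antitone_millsRatio (by linarith)
    rw [millsRatio, millsRatio, div_le_div_iff₀ (stdNormalCdf_pos _) (stdNormalCdf_pos _)] at h1
    refine div_nonpos_of_nonpos_of_nonneg ?_ (sq_nonneg _)
    linarith
  have := hanti hst
  simp only at this
  rw [div_le_div_iff₀ (stdNormalCdf_pos _) (stdNormalCdf_pos _)] at this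
  linarith

/-- The Gaussian tail bound. -/
theorem stdNormalCdf_le_exp {t : ℝ} (ht : t ≤ 0) : stdNormalCdf t ≤ Real.exp (-t ^ 2 / 2) := by

  -- Monotonicity compares with the value of φ/Φ at 0, which is 2φ(0) since Φ(0) = 1/2; the
  -- constants in φ(t) and φ(0) then cancel.
  have hm : 2 * stdNormalPdf 0 ≤ millsRatio t := by
    have := antitone_millsRatio ht
    rw [millsRatio, stdNormalCdf_zero] at this
    linarith
  rw [millsRatio, le_div_iff₀ (stdNormalCdf_pos t)] at hm
  rw [stdNormalPdf_eq, stdNormalPdf_eq] at hm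
  have hc : 0 < (√(2 * Real.pi))⁻¹ := by positivity
  have he : Real.exp (-(0 : ℝ) ^ 2 / 2) = 1 := by simp
  rw [he] at hm
  have : 2 * stdNormalCdf t ≤ Real.exp (-t ^ 2 / 2) := by
    refine le_of_mul_le_mul_left ?_ hc
    linarith
  linarith [stdNormalCdf_pos t]

/-! ### The quantile coupling of truncated normal distributions -/

/-- The standard normal quantile function. -/
def normalQuantile (u : ℝ) : ℝ := sInf {t | u ≤ stdNormalCdf t}

theorem normalQuantile_stdNormalCdf (t : ℝ) : normalQuantile (stdNormalCdf t) = t := by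
  have : {s | stdNormalCdf t ≤ stdNormalCdf s} = Set.Ici t := by
    ext s
    exact strictMono_stdNormalCdf.le_iff_le
  rw [normalQuantile, this, csInf_Ici]

theorem stdNormalCdf_normalQuantile {u : ℝ} (hu : u ∈ Set.Ioo (0 : ℝ) 1) :
    stdNormalCdf (normalQuantile u) = u := by
  obtain ⟨t, rfl⟩ := mem_range_of_exists_le_of_exists_ge continuous_stdNormalCdf
    ((tendsto_stdNormalCdf_atBot.eventually (eventually_le_nhds hu.1)).exists)
    ((tendsto_stdNormalCdf_atTop.eventually (eventually_ge_nhds hu.2)).exists)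
  rw [normalQuantile_stdNormalCdf]

theorem normalQuantile_le_iff {u : ℝ} (hu : u ∈ Set.Ioo (0 : ℝ) 1) (t : ℝ) :
    normalQuantile u ≤ t ↔ u ≤ stdNormalCdf t := by
  rw [← strictMono_stdNormalCdf.le_iff_le, stdNormalCdf_normalQuantile hu]

/-- Outside (0, 1) the defining set is the whole line or empty, and real `sInf` has the default
value 0 on both. This serves measurability on all of ℝ. -/
theorem normalQuantile_of_notMem {u : ℝ} (hu : u ∉ Set.Ioo (0 : ℝ) 1) : normalQuantile u = 0 := by
  rw [Set.mem_Ioo, not_and_or, not_lt, not_lt] at hu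
  rcases hu with hu | hu
  · have : {t | u ≤ stdNormalCdf t} = Set.univ :=
      Set.eq_univ_of_forall fun t => hu.trans (stdNormalCdf_pos t).le
    rw [normalQuantile, this, Real.sInf_univ]
  · have : {t | u ≤ stdNormalCdf t} = ∅ :=
      Set.eq_empty_of_forall_notMem fun t ht => ((stdNormalCdf_lt_one t).trans_le hu).not_ge ht
    rw [normalQuantile, this, Real.sInf_empty]

theorem measurable_normalQuantile : Measurable normalQuantile := by
  refine measurable_of_Iic fun t => ?_
  have : normalQuantile ⁻¹' Set.Iic t =
      (Set.Ioo 0 1 ∩ Set.Iic (stdNormalCdf t)) ∪ ((Set.Ioo 0 1)ᶜ ∩ {_u | 0 ≤ t}) := by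
    ext u
    by_cases hu : u ∈ Set.Ioo (0 : ℝ) 1
    · simp only [Set.mem_preimage, Set.mem_Iic, normalQuantile_le_iff hu]
      simp [Set.mem_inter_iff, hu.1, hu.2]
    · simp only [Set.mem_preimage, Set.mem_Iic, normalQuantile_of_notMem hu]
      simp [hu]
  rw [this]
  exact (measurableSet_Ioo.inter measurableSet_Iic).union
    (measurableSet_Ioo.compl.inter (MeasurableSet.const _))

/-- The uniform distribution on `(0, 1)`. -/
def unifLaw : Measure ℝ := volume.restrict (Set.Ioo 0 1)

instance isProbabilityMeasure_unifLaw : IsProbabilityMeasure unifLaw :=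
  ⟨by simp [unifLaw]⟩

theorem ae_unifLaw : ∀ᵐ u ∂unifLaw, u ∈ Set.Ioo (0 : ℝ) 1 := ae_restrict_mem measurableSet_Ioo

/-- A variable with law `TN(μ, 1; (0, ∞))` as a function of a uniform variable. -/
def positiveLatent (μ u : ℝ) : ℝ := μ - normalQuantile (u * stdNormalCdf μ)

/-- A variable with law `TN(μ, 1; a)` as a function of a uniform variable. -/
def latentMap (a : Bool) (μ u : ℝ) : ℝ := if a then positiveLatent μ u else -positiveLatent (-μ) u

theorem measurable_positiveLatent : Measurable fun w : ℝ × ℝ => positiveLatent w.1 w.2 :=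
  measurable_fst.sub (measurable_normalQuantile.comp
    (measurable_snd.mul (continuous_stdNormalCdf.measurable.comp measurable_fst)))

theorem measurable_latentMap (a : Bool) : Measurable fun w : ℝ × ℝ => latentMap a w.1 w.2 := by
  cases a
  · simp only [latentMap, Bool.false_eq_true, if_false]
    exact (measurable_positiveLatent.comp (measurable_fst.neg.prodMk measurable_snd)).neg
  · simpa [latentMap] using measurable_positiveLatent

theorem mul_stdNormalCdf_mem_Ioo {u : ℝ} (hu : u ∈ Set.Ioo (0 : ℝ) 1) (μ : ℝ) :
    u * stdNormalCdf μ ∈ Set.Ioo (0 : ℝ) 1 :=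
  ⟨mul_pos hu.1 (stdNormalCdf_pos μ),
    mul_lt_one_of_nonneg_of_lt_one_left hu.1.le hu.2 (stdNormalCdf_lt_one μ).le⟩

theorem le_positiveLatent_iff {u : ℝ} (hu : u ∈ Set.Ioo (0 : ℝ) 1) (μ z : ℝ) :
    z ≤ positiveLatent μ u ↔ u * stdNormalCdf μ ≤ stdNormalCdf (μ - z) := by
  rw [positiveLatent, le_sub_comm, normalQuantile_le_iff (mul_stdNormalCdf_mem_Ioo hu μ)]

/-- The upper tail of the truncated law at z > 0 is Φ(μ - z)/Φ(μ), and the event that the mapped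
variable is at least z is exactly that the uniform variable is at most this ratio. The tail is
inverted, rather than the distribution function, because it makes no use of 1 - Φ. -/
theorem map_positiveLatent (μ : ℝ) : unifLaw.map (positiveLatent μ) = truncatedNormal μ true := by
  have hm : Measurable (positiveLatent μ) :=
    measurable_positiveLatent.comp measurable_prodMk_left
  have := Measure.isProbabilityMeasure_map (μ := unifLaw) hm.aemeasurable
  have hI : gaussianReal μ 1 (Set.Ioi 0) = ENNReal.ofReal (stdNormalCdf μ) := by
    rw [← ofReal_measureReal, gaussianReal_real_Ioi, sub_zero]
  refine Measure.ext_of_Ici _ _ fun z => ?_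
  rw [Measure.map_apply hm measurableSet_Ici, truncatedNormal,
    cond_apply (measurableSet_halfLine true), unifLaw,
    Measure.restrict_apply (hm measurableSet_Ici)]
  simp only [halfLine, if_true]
  rcases le_or_gt z 0 with hz | hz
  · have h1 : positiveLatent μ ⁻¹' Set.Ici z ∩ Set.Ioo 0 1 = Set.Ioo 0 1 := by
      refine Set.inter_eq_right.2 fun u hu => (le_positiveLatent_iff hu μ z).2 ?_
      calc u * stdNormalCdf μ ≤ stdNormalCdf μ :=
            mul_le_of_le_one_left (stdNormalCdf_pos μ).le hu.2.le
        _ ≤ _ := strictMono_stdNormalCdf.monotone (by linarith)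
    have h2 : Set.Ioi (0 : ℝ) ∩ Set.Ici z = Set.Ioi 0 :=
      Set.inter_eq_left.2 fun x hx => hz.trans (le_of_lt hx)
    rw [h1, h2, hI, ENNReal.inv_mul_cancel]
    · simp
    · simpa using stdNormalCdf_pos μ
    · simp
  · set r := stdNormalCdf (μ - z) / stdNormalCdf μ with hr
    have hr1 : r < 1 := (div_lt_one (stdNormalCdf_pos μ)).2 (strictMono_stdNormalCdf (by linarith))
    have h1 : positiveLatent μ ⁻¹' Set.Ici z ∩ Set.Ioo 0 1 = Set.Ioc 0 r := by
      ext u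
      simp only [Set.mem_inter_iff, Set.mem_preimage, Set.mem_Ici]
      constructor
      · rintro ⟨h, hu⟩
        exact ⟨hu.1, (le_div_iff₀ (stdNormalCdf_pos μ)).2 ((le_positiveLatent_iff hu μ z).1 h)⟩
      · rintro ⟨hu, h⟩
        have hu' : u ∈ Set.Ioo (0 : ℝ) 1 := ⟨hu, h.trans_lt hr1⟩
        exact ⟨(le_positiveLatent_iff hu' μ z).2 ((le_div_iff₀ (stdNormalCdf_pos μ)).1 h), hu'⟩
    have h2 : Set.Ioi (0 : ℝ) ∩ Set.Ici z = Set.Ici z :=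
      Set.inter_eq_right.2 fun x hx => hz.trans_le hx
    have hae : (Set.Ioi z : Set ℝ) =ᵐ[gaussianReal μ 1] Set.Ici z := by
      have := nullSingletonClass_gaussianReal (μ := μ) (v := 1) one_ne_zero
      exact Ioi_ae_eq_Ici
    rw [h1, h2, hI, ← measure_congr hae, ← ofReal_measureReal (μ := gaussianReal μ 1),
      gaussianReal_real_Ioi,
      ← ENNReal.ofReal_inv_of_pos (stdNormalCdf_pos μ), ← ENNReal.ofReal_mul
      (inv_nonneg.2 (stdNormalCdf_pos μ).le), Real.volume_Ioc, sub_zero, hr, div_eq_inv_mul]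

theorem map_neg_truncatedNormal (μ : ℝ) :
    (truncatedNormal (-μ) true).map (fun z => -z) = truncatedNormal μ false := by
  have hg : gaussianReal μ 1 = (gaussianReal (-μ) 1).map (fun x => -x) := by
    rw [gaussianReal_map_neg, neg_neg]
  ext s hs
  rw [Measure.map_apply measurable_neg hs, truncatedNormal, truncatedNormal,
    cond_apply (measurableSet_halfLine _), cond_apply (measurableSet_halfLine _), hg,
    Measure.map_apply measurable_neg (measurableSet_halfLine _),
    Measure.map_apply measurable_neg ((measurableSet_halfLine _).inter hs)]
  simp [halfLine]

theorem map_latentMap (a : Bool) (μ : ℝ) : unifLaw.map (latentMap a μ) = truncatedNormal μ a := by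
  cases a
  · have h : latentMap false μ = (fun z => -z) ∘ positiveLatent (-μ) := by
      ext u; simp [latentMap]
    have hm : Measurable (positiveLatent (-μ)) :=
      measurable_positiveLatent.comp measurable_prodMk_left
    rw [h, ← Measure.map_map (measurable_neg (G := ℝ)) hm, map_positiveLatent,
      map_neg_truncatedNormal]
  · have h : latentMap true μ = positiveLatent μ := by
      ext u; simp [latentMap]
    rw [h, map_positiveLatent]

/-- The upper bound is monotonicity of the quantile function. The lower bound is where log-concavity
enters: with t the quantile of uΦ(μ), one has t ≤ μ, and `stdNormalCdf_mul_le` with shift ν - μ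
gives uΦ(ν) ≤ Φ(t + ν - μ). -/
theorem positiveLatent_sub_mem_Icc {u : ℝ} (hu : u ∈ Set.Ioo (0 : ℝ) 1) {μ ν : ℝ} (h : μ ≤ ν) :
    positiveLatent ν u - positiveLatent μ u ∈ Set.Icc 0 (ν - μ) := by
  have hμ := mul_stdNormalCdf_mem_Ioo hu μ
  have hν := mul_stdNormalCdf_mem_Ioo hu ν
  constructor
  · rw [sub_nonneg, le_positiveLatent_iff hu, positiveLatent]
    set t := normalQuantile (u * stdNormalCdf μ) with ht
    have htu : stdNormalCdf t = u * stdNormalCdf μ := stdNormalCdf_normalQuantile hμ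
    have htμ : t ≤ μ := by
      rw [ht, normalQuantile_le_iff hμ]
      exact mul_le_of_le_one_left (stdNormalCdf_pos μ).le hu.2.le
    have := stdNormalCdf_mul_le htμ (sub_nonneg.2 h)
    rw [htu, add_sub_cancel] at this
    have h3 : u * stdNormalCdf ν ≤ stdNormalCdf (t + (ν - μ)) := by
      refine le_of_mul_le_mul_right ?_ (stdNormalCdf_pos μ)
      linarith
    convert h3 using 2
    ring
  · have : normalQuantile (u * stdNormalCdf μ) ≤ normalQuantile (u * stdNormalCdf ν) := by
      rw [normalQuantile_le_iff hμ, stdNormalCdf_normalQuantile hν]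
      exact mul_le_mul_of_nonneg_left (strictMono_stdNormalCdf.monotone h) hu.1.le
    simp only [positiveLatent]
    linarith

theorem latentMap_sub_mem_Icc (a : Bool) {u : ℝ} (hu : u ∈ Set.Ioo (0 : ℝ) 1) {μ ν : ℝ}
    (h : μ ≤ ν) : latentMap a ν u - latentMap a μ u ∈ Set.Icc 0 (ν - μ) := by
  cases a
  · have := positiveLatent_sub_mem_Icc hu (neg_le_neg h)
    simp only [latentMap, Set.mem_Icc] at this ⊢
    constructor <;> simp only [Bool.false_eq_true, if_false] <;> linarith [this.1, this.2]
  · simpa [latentMap] using positiveLatent_sub_mem_Icc hu h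

/-! ### Means of truncated normal distributions -/

/-- The mean of `TN(μ, 1; a)`. -/
def latentMean (a : Bool) (μ : ℝ) : ℝ := if a then μ + millsRatio μ else μ - millsRatio (-μ)

theorem integrable_id_truncatedNormal (μ : ℝ) (a : Bool) :
    Integrable (fun z => z) (truncatedNormal μ a) := by
  rw [truncatedNormal, ProbabilityTheory.cond]
  refine Integrable.smul_measure ?_ (ENNReal.inv_ne_top.2 (gaussianReal_halfLine_ne_zero μ a))
  exact (IsGaussian.integrable_id (μ := gaussianReal μ 1)).restrict

theorem integrable_latentMap (a : Bool) (μ : ℝ) : Integrable (latentMap a μ) unifLaw := by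
  have hm : Measurable (latentMap a μ) := (measurable_latentMap a).comp measurable_prodMk_left
  have := integrable_id_truncatedNormal μ a
  rw [← map_latentMap] at this
  exact this.comp_measurable hm

/-- The function -φ(z - μ) is an antiderivative of (z - μ)φ(z - μ), so the centred integral over (0,
∞) is φ(μ), to be divided by the mass Φ(μ). -/
theorem integral_id_truncatedNormal_true (μ : ℝ) :
    ∫ z, z ∂truncatedNormal μ true = μ + millsRatio μ := by
  have hd : ∀ z ∈ Set.Ici (0 : ℝ), HasDerivAt (fun z => -stdNormalPdf (z - μ))
      ((z - μ) * stdNormalPdf (z - μ)) z := fun z _ => by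
    have := ((hasDerivAt_stdNormalPdf (z - μ)).comp_sub_const z μ).neg
    refine this.congr_deriv ?_
    ring
  have hint : Integrable (fun z => z * stdNormalPdf (z - μ)) := by
    have h := IsGaussian.integrable_id (μ := gaussianReal μ 1)
    rw [gaussianReal_of_var_ne_zero μ one_ne_zero, integrable_withDensity_iff
      (measurable_gaussianPDF μ 1) (ae_of_all _ fun _ => gaussianPDF_lt_top)] at h
    refine h.congr (ae_of_all _ fun z => ?_)
    simp [toReal_gaussianPDF, gaussianPDFReal_eq_stdNormalPdf]
  have hint2 : Integrable (fun z => stdNormalPdf (z - μ)) :=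
    integrable_stdNormalPdf.comp_sub_right μ
  have hint3 : Integrable (fun z => (z - μ) * stdNormalPdf (z - μ)) := by
    refine (hint.sub (hint2.const_mul μ)).congr (ae_of_all _ fun z => ?_)
    simp [sub_mul]
  have htop : Tendsto (fun z => -stdNormalPdf (z - μ)) atTop (𝓝 0) := by
    have h : Tendsto (fun z : ℝ => μ - z) atTop atBot :=
      tendsto_atBot_add_const_left _ _ tendsto_neg_atTop_atBot
    have := (tendsto_stdNormalPdf_atBot.comp h).neg
    rw [neg_zero] at this
    refine this.congr fun z => ?_
    rw [Function.comp_apply, ← stdNormalPdf_neg, neg_sub]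
  have h1 := integral_Ioi_of_hasDerivAt_of_tendsto' hd hint3.integrableOn htop
  have h2 : ∫ z in Set.Ioi 0, stdNormalPdf (z - μ) = stdNormalCdf μ := by
    have := gaussianReal_real_Ioi μ 0
    rw [sub_zero, measureReal_def, gaussianReal_apply_eq_integral μ one_ne_zero,
      ENNReal.toReal_ofReal (integral_nonneg fun x => gaussianPDFReal_nonneg _ _ _)] at this
    simpa [gaussianPDFReal_eq_stdNormalPdf] using this
  have h3 : ∫ z in Set.Ioi 0, z * stdNormalPdf (z - μ) = stdNormalPdf μ + μ * stdNormalCdf μ := by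
    rw [← h2, ← integral_const_mul, ← sub_eq_iff_eq_add, ← integral_sub hint.integrableOn
      (hint2.const_mul μ).integrableOn]
    simp only [← sub_mul]
    rw [h1]
    simp [stdNormalPdf_neg]
  have h4 : (gaussianReal μ 1 (Set.Ioi 0)).toReal = stdNormalCdf μ := by
    have := gaussianReal_real_Ioi μ 0
    rwa [sub_zero] at this
  rw [truncatedNormal, ProbabilityTheory.cond, integral_smul_measure]
  simp only [halfLine, if_true]
  rw [gaussianReal_of_var_ne_zero μ one_ne_zero, ← gaussianReal_of_var_ne_zero μ one_ne_zero,
    ENNReal.toReal_inv, h4, gaussianReal_of_var_ne_zero μ one_ne_zero,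
    restrict_withDensity measurableSet_Ioi,
    integral_withDensity_eq_integral_toReal_smul (measurable_gaussianPDF μ 1)
      (ae_of_all _ fun _ => gaussianPDF_lt_top)]
  simp only [toReal_gaussianPDF, gaussianPDFReal_eq_stdNormalPdf, smul_eq_mul]
  simp only [mul_comm (stdNormalPdf _)]
  rw [h3, millsRatio]
  have := (stdNormalCdf_pos μ).ne'
  field_simp
  ring

theorem integral_latentMap (a : Bool) (μ : ℝ) : ∫ u, latentMap a μ u ∂unifLaw = latentMean a μ := by
  have hp : ∀ μ, ∫ u, positiveLatent μ u ∂unifLaw = μ + millsRatio μ := fun μ => by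
    have hm : Measurable (positiveLatent μ) := measurable_positiveLatent.comp measurable_prodMk_left
    rw [← integral_id_truncatedNormal_true, ← map_positiveLatent,
      integral_map hm.aemeasurable (by fun_prop)]
  cases a
  · simp only [latentMap, latentMean, Bool.false_eq_true, if_false]
    rw [integral_neg, hp]
    ring
  · simp only [latentMap, latentMean, if_true]
    exact hp μ

/-- The derivative of the mean of `TN(μ, 1; a)` in `μ`. -/
def latentSlope (a : Bool) (μ : ℝ) : ℝ :=
  1 - if a then millsRatio μ * (μ + millsRatio μ) else millsRatio (-μ) * (-μ + millsRatio (-μ))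

theorem hasDerivAt_latentMean (a : Bool) (μ : ℝ) :
    HasDerivAt (latentMean a) (latentSlope a μ) μ := by
  cases a
  · have h := (hasDerivAt_id μ).sub ((hasDerivAt_millsRatio (-μ)).comp μ (hasDerivAt_neg μ))
    have he : latentMean false = id - millsRatio ∘ Neg.neg := by
      ext x; simp [latentMean]
    rw [he]
    refine h.congr_deriv ?_
    simp [latentSlope]
  · have h := (hasDerivAt_id μ).add (hasDerivAt_millsRatio μ)
    have he : latentMean true = id + millsRatio := by
      ext x; simp [latentMean]
    rw [he]
    refine h.congr_deriv ?_
    simp [latentSlope]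
    ring

/-- The indicator of the means `t` that lie on the wrong side of the truncation point. -/
def wrongSide (a : Bool) (t : ℝ) : ℝ := if (if a then t ≤ 0 else 0 ≤ t) then 1 else 0

/-- A gain of 1/4 on the wrong side comes from `millsRatio_mul_ge`; elsewhere only nonnegativity of
the product is available, because the slope tends to 1 far inside the half line. -/
theorem latentSlope_le (a : Bool) (t : ℝ) : latentSlope a t ≤ 1 - wrongSide a t / 4 := by
  cases a
  · simp only [latentSlope, wrongSide, Bool.false_eq_true, if_false]
    split_ifs with h
    · linarith [millsRatio_mul_ge (neg_nonpos.2 h)]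
    · linarith [millsRatio_mul_nonneg (-t)]
  · simp only [latentSlope, wrongSide, if_true]
    split_ifs with h
    · linarith [millsRatio_mul_ge h]
    · linarith [millsRatio_mul_nonneg t]

/-- The increment has the sign of ν - μ and no larger size. The right side is linear in the
increment, so its expectation involves only truncated means. -/
theorem sq_latentMap_sub_le (a : Bool) {u : ℝ} (hu : u ∈ Set.Ioo (0 : ℝ) 1) (μ ν : ℝ) :
    (latentMap a ν u - latentMap a μ u) ^ 2 ≤ (ν - μ) * (latentMap a ν u - latentMap a μ u) := by
  rcases le_total μ ν with h | h
  · have := latentMap_sub_mem_Icc a hu h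
    nlinarith [this.1, this.2]
  · have := latentMap_sub_mem_Icc a hu h
    nlinarith [this.1, this.2]

/-! ### A random mapping representation of the Albert–Chib chain -/

section RandomMap

variable {n p : ℕ}

/-- The latent vector as a function of independent uniform variables. -/
def latentVector (X : Matrix (Fin n) (Fin p) ℝ) (y : Fin n → Bool) (β : EuclideanSpace ℝ (Fin p))
    (u : Fin n → ℝ) : Fin n → ℝ :=
  fun i => latentMap (y i) ((X *ᵥ WithLp.ofLp β) i) (u i)

/-- The law of `n` independent uniform variables. -/
def unifVec (n : ℕ) : Measure (Fin n → ℝ) := Measure.pi fun _ => unifLaw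

instance isProbabilityMeasure_unifVec : IsProbabilityMeasure (unifVec n) := by
  unfold unifVec; infer_instance

theorem continuous_mulVec_apply (X : Matrix (Fin n) (Fin p) ℝ) (i : Fin n) :
    Continuous fun β : EuclideanSpace ℝ (Fin p) => (X *ᵥ WithLp.ofLp β) i := by
  simp only [Matrix.mulVec, dotProduct]
  fun_prop

theorem measurable_latentVector (X : Matrix (Fin n) (Fin p) ℝ) (y : Fin n → Bool) :
    Measurable fun w : EuclideanSpace ℝ (Fin p) × (Fin n → ℝ) => latentVector X y w.1 w.2 :=
  measurable_pi_lambda _ fun i => (measurable_latentMap (y i)).comp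
    (((continuous_mulVec_apply X i).measurable.comp measurable_fst).prodMk
      ((measurable_pi_apply i).comp measurable_snd))

theorem map_latentVector (X : Matrix (Fin n) (Fin p) ℝ) (y : Fin n → Bool)
    (β : EuclideanSpace ℝ (Fin p)) :
    (unifVec n).map (latentVector X y β) = latentKernel X y β := by
  have hm : ∀ i, Measurable (latentMap (y i) ((X *ᵥ WithLp.ofLp β) i)) := fun i =>
    (measurable_latentMap (y i)).comp measurable_prodMk_left
  have : ∀ i, SigmaFinite (unifLaw.map (latentMap (y i) ((X *ᵥ WithLp.ofLp β) i))) := fun i => by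
    rw [map_latentMap]; infer_instance
  have h := Measure.pi_map_pi (μ := fun _ : Fin n => unifLaw)
    (f := fun i => latentMap (y i) ((X *ᵥ WithLp.ofLp β) i)) fun i => (hm i).aemeasurable
  simp only [map_latentMap] at h
  exact h

open scoped MatrixOrder in
/-- The square root of the conditional covariance matrix `S⁻¹`. -/
def covSqrt (S : Matrix (Fin p) (Fin p) ℝ) :
    EuclideanSpace ℝ (Fin p) →L[ℝ] EuclideanSpace ℝ (Fin p) :=
  Matrix.toEuclideanCLM (𝕜 := ℝ) (CFC.sqrt S⁻¹)

/-- The law of the noise that drives one step of the chain. -/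
def noiseLaw (n p : ℕ) : Measure ((Fin n → ℝ) × EuclideanSpace ℝ (Fin p)) :=
  (unifVec n).prod (stdGaussian (EuclideanSpace ℝ (Fin p)))

instance isProbabilityMeasure_noiseLaw : IsProbabilityMeasure (noiseLaw n p) := by
  unfold noiseLaw; infer_instance

/-- One step of the chain as a function of the current state and the noise. -/
def randomMap (X : Matrix (Fin n) (Fin p) ℝ) (y : Fin n → Bool) (Q : Matrix (Fin p) (Fin p) ℝ)
    (v β : EuclideanSpace ℝ (Fin p)) (w : (Fin n → ℝ) × EuclideanSpace ℝ (Fin p)) :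
    EuclideanSpace ℝ (Fin p) :=
  coefficientMean X Q v (latentVector X y β w.1) + covSqrt (precision X Q) w.2

variable (X : Matrix (Fin n) (Fin p) ℝ) (y : Fin n → Bool) (Q : Matrix (Fin p) (Fin p) ℝ)
  (v : EuclideanSpace ℝ (Fin p))

theorem measurable_randomMap :
    Measurable fun w : EuclideanSpace ℝ (Fin p) × (Fin n → ℝ) × EuclideanSpace ℝ (Fin p) =>
      randomMap X y Q v w.1 w.2 := by
  refine Measurable.add ?_ ((covSqrt _).continuous.measurable.comp
    (measurable_snd.comp measurable_snd))
  exact (continuous_coefficientMean X Q v).measurable.comp ((measurable_latentVector X y).comp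
    (measurable_fst.prodMk (measurable_fst.comp measurable_snd)))

theorem _root_.Measurable.randomMap {α : Type*} [MeasurableSpace α]
    {f : α → EuclideanSpace ℝ (Fin p)} {g : α → (Fin n → ℝ) × EuclideanSpace ℝ (Fin p)}
    (hf : Measurable f) (hg : Measurable g) :
    Measurable fun a => randomMap X y Q v (f a) (g a) := by
  have h : Measurable ((fun w : EuclideanSpace ℝ (Fin p) × (Fin n → ℝ) × EuclideanSpace ℝ (Fin p) =>
      ProbitChain.randomMap X y Q v w.1 w.2) ∘ fun a => (f a, g a)) :=
    (measurable_randomMap X y Q v).comp (hf.prodMk hg)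
  exact h

theorem coefficientKernel_apply (z : Fin n → ℝ) :
    coefficientKernel X Q v z = (stdGaussian (EuclideanSpace ℝ (Fin p))).map
      fun e => coefficientMean X Q v z + covSqrt (precision X Q) e := rfl

instance isMarkovKernel_latentKernel : IsMarkovKernel (latentKernel X y) :=
  ⟨fun β => by
    change IsProbabilityMeasure
      (Measure.pi fun i => truncatedNormal ((X *ᵥ WithLp.ofLp β) i) (y i))
    infer_instance⟩

instance isMarkovKernel_coefficientKernel : IsMarkovKernel (coefficientKernel X Q v) :=
  ⟨fun z => by
    rw [coefficientKernel_apply]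
    exact Measure.isProbabilityMeasure_map (by fun_prop)⟩

instance isMarkovKernel_acKernel : IsMarkovKernel (acKernel X y Q v) := by
  unfold acKernel; infer_instance

theorem map_randomMap (β : EuclideanSpace ℝ (Fin p)) :
    (noiseLaw n p).map (randomMap X y Q v β) = acKernel X y Q v β := by
  have hm : Measurable fun w => randomMap X y Q v β w :=
    Measurable.randomMap X y Q v measurable_const measurable_id
  have hl : Measurable (latentVector X y β) :=
    (measurable_latentVector X y).comp measurable_prodMk_left
  ext s hs
  rw [Measure.map_apply hm hs, noiseLaw, Measure.prod_apply (hm hs), acKernel,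
    Kernel.comp_apply' _ _ _ hs, ← map_latentVector, lintegral_map (Kernel.measurable_coe _ hs) hl]
  refine lintegral_congr fun u => ?_
  rw [coefficientKernel_apply, Measure.map_apply (by fun_prop) hs]
  rfl

theorem map_prod_randomMap (μ : Measure (EuclideanSpace ℝ (Fin p))) [SFinite μ] :
    (μ.prod (noiseLaw n p)).map (fun w => randomMap X y Q v w.1 w.2) =
      μ.bind (acKernel X y Q v) := by
  ext s hs
  have hm := measurable_randomMap X y Q v
  rw [Measure.map_apply hm hs, Measure.prod_apply (hm hs), Measure.bind_apply hs
    (Kernel.aemeasurable _)]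
  refine lintegral_congr fun β => ?_
  have hb : Measurable fun w => randomMap X y Q v β w :=
    Measurable.randomMap X y Q v measurable_const measurable_id
  rw [← map_randomMap, Measure.map_apply hb hs]
  rfl

/-! ### Contraction of the random mapping -/

/-- In every direction, at every state, a fraction at least `c` of the quadratic form `XᵀX` comes
from observations whose latent mean lies on the wrong side of the truncation point. -/
def WrongSideBound (c : ℝ) : Prop :=
  ∀ b a : Fin p → ℝ, c * ∑ i, (X *ᵥ a) i ^ 2 ≤ ∑ i, (X *ᵥ a) i ^ 2 * wrongSide (y i) ((X *ᵥ b) i)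

variable {X y Q v}

theorem dotProduct_precision_mulVec (w : Fin p → ℝ) :
    w ⬝ᵥ precision X Q *ᵥ w = ∑ i, (X *ᵥ w) i ^ 2 + w ⬝ᵥ Q *ᵥ w := by
  rw [precision, Matrix.add_mulVec, dotProduct_add, ← Matrix.mulVec_mulVec,
    Matrix.dotProduct_mulVec, Matrix.vecMul_transpose]
  simp [dotProduct, sq]

theorem dotProduct_mulVec_nonneg' (hQ : Q.PosSemidef) (w : Fin p → ℝ) : 0 ≤ w ⬝ᵥ Q *ᵥ w := by
  simpa using hQ.dotProduct_mulVec_nonneg w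

theorem sum_sq_mulVec_le (hQ : Q.PosSemidef) (w : Fin p → ℝ) :
    ∑ i, (X *ᵥ w) i ^ 2 ≤ w ⬝ᵥ precision X Q *ᵥ w := by
  rw [dotProduct_precision_mulVec]
  linarith [dotProduct_mulVec_nonneg' hQ w]

theorem ofLp_coefficientMean_sub (z z' : Fin n → ℝ) :
    WithLp.ofLp (coefficientMean X Q v z - coefficientMean X Q v z') =
      (precision X Q)⁻¹ *ᵥ (Xᵀ *ᵥ (z - z')) := by
  simp only [coefficientMean, WithLp.ofLp_sub, ← Matrix.mulVec_sub]
  congr 1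
  rw [Matrix.mulVec_sub]
  abel

theorem sq_sigmaDist (hS : (precision X Q).PosSemidef) (β β' : EuclideanSpace ℝ (Fin p)) :
    sigmaDist (precision X Q) β β' ^ 2 =
      WithLp.ofLp (β - β') ⬝ᵥ precision X Q *ᵥ WithLp.ofLp (β - β') :=
  Real.sq_sqrt (dotProduct_mulVec_nonneg' hS _)

theorem sigmaDist_nonneg (S : Matrix (Fin p) (Fin p) ℝ) (β β' : EuclideanSpace ℝ (Fin p)) :
    0 ≤ sigmaDist S β β' := Real.sqrt_nonneg _

theorem continuous_sigmaDist (S : Matrix (Fin p) (Fin p) ℝ) :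
    Continuous fun w : EuclideanSpace ℝ (Fin p) × EuclideanSpace ℝ (Fin p) =>
      sigmaDist S w.1 w.2 := by
  simp only [sigmaDist, Matrix.mulVec, dotProduct]
  fun_prop

/-- The second step of the chain, with common noise, is a contraction from the Euclidean norm. -/
theorem sq_sigmaDist_coefficientMean_le (hS : (precision X Q).PosDef) (hQ : Q.PosSemidef)
    (z z' : Fin n → ℝ) (e : EuclideanSpace ℝ (Fin p)) :
    sigmaDist (precision X Q) (coefficientMean X Q v z + e) (coefficientMean X Q v z' + e) ^ 2 ≤
      ∑ i, (z i - z' i) ^ 2 := by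
  rw [sq_sigmaDist hS.posSemidef, add_sub_add_right_eq_sub, ofLp_coefficientMean_sub]
  set w := (precision X Q)⁻¹ *ᵥ (Xᵀ *ᵥ (z - z')) with hw
  -- Since Σw = Xᵀ(z - z'), the squared Σ-norm of w is the pairing of Xw with z - z'. The inequality
  -- ab ≤ (a² + b²)/2 and |Xw|² ≤ wᵀΣw then let half of the left side be absorbed.
  have h1 : w ⬝ᵥ precision X Q *ᵥ w = ∑ i, (X *ᵥ w) i * (z i - z' i) := by
    have h2 : precision X Q *ᵥ w = Xᵀ *ᵥ (z - z') := by
      rw [hw, Matrix.mulVec_mulVec, Matrix.mul_nonsing_inv _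
        ((Matrix.isUnit_iff_isUnit_det _).1 hS.isUnit), Matrix.one_mulVec]
    rw [h2, Matrix.dotProduct_mulVec, Matrix.vecMul_transpose]
    simp [dotProduct]
  have h3 := sum_sq_mulVec_le (X := X) hQ w
  have h4 : ∑ i, (X *ᵥ w) i * (z i - z' i) ≤
      ∑ i, ((X *ᵥ w) i ^ 2 + (z i - z' i) ^ 2) / 2 :=
    Finset.sum_le_sum fun i _ => by nlinarith [sq_nonneg ((X *ᵥ w) i - (z i - z' i))]
  rw [← Finset.sum_div, Finset.sum_add_distrib] at h4
  linarith

/-- Mean value inequality along the segment from b to b + d. The wrong-side bound is needed at every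
intermediate point, which is why `WrongSideBound` quantifies over all states. -/
theorem sum_latentMean_sub_le {c : ℝ} (h : WrongSideBound X y c) (b d : Fin p → ℝ) :
    ∑ i, (X *ᵥ d) i * (latentMean (y i) ((X *ᵥ (b + d)) i) - latentMean (y i) ((X *ᵥ b) i)) ≤
      (1 - c / 4) * ∑ i, (X *ᵥ d) i ^ 2 := by
  set H : ℝ → ℝ := fun t => ∑ i, (X *ᵥ d) i * latentMean (y i) ((X *ᵥ b) i + t * (X *ᵥ d) i)
    with hH
  have hd : ∀ t, HasDerivAt H (∑ i, (X *ᵥ d) i * (latentSlope (y i)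
      ((X *ᵥ b) i + t * (X *ᵥ d) i) * (X *ᵥ d) i)) t := by
    intro t
    refine HasDerivAt.fun_sum fun i _ => HasDerivAt.const_mul _ ?_
    refine (hasDerivAt_latentMean (y i) _).comp t ?_
    simpa using ((hasDerivAt_id t).mul_const ((X *ᵥ d) i)).const_add ((X *ᵥ b) i)
  have hle : ∀ t, deriv H t ≤ (1 - c / 4) * ∑ i, (X *ᵥ d) i ^ 2 := by
    intro t
    rw [(hd t).deriv]
    have h1 := h (b + t • d) d
    have h2 : ∀ i, (X *ᵥ d) i * (latentSlope (y i) ((X *ᵥ b) i + t * (X *ᵥ d) i) * (X *ᵥ d) i) ≤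
        (X *ᵥ d) i ^ 2 - (X *ᵥ d) i ^ 2 * wrongSide (y i) ((X *ᵥ (b + t • d)) i) / 4 := by
      intro i
      have h3 := latentSlope_le (y i) ((X *ᵥ b) i + t * (X *ᵥ d) i)
      have h4 : (X *ᵥ (b + t • d)) i = (X *ᵥ b) i + t * (X *ᵥ d) i := by
        simp [Matrix.mulVec_add, Matrix.mulVec_smul]
      rw [h4]
      nlinarith [mul_le_mul_of_nonneg_left h3 (sq_nonneg ((X *ᵥ d) i))]
    refine (Finset.sum_le_sum fun i _ => h2 i).trans ?_
    rw [Finset.sum_sub_distrib, ← Finset.sum_div]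
    linarith
  have key := image_sub_le_mul_sub_of_deriv_le (f := H) (fun t => (hd t).differentiableAt) hle
    (zero_le_one' ℝ)
  have e1 : H 1 - H 0 = ∑ i, (X *ᵥ d) i *
      (latentMean (y i) ((X *ᵥ (b + d)) i) - latentMean (y i) ((X *ᵥ b) i)) := by
    simp only [hH, ← Finset.sum_sub_distrib]
    refine Finset.sum_congr rfl fun i _ => ?_
    simp [Matrix.mulVec_add, mul_sub]
  rw [← e1]
  linarith

/-- Coordinatewise, `sq_latentMap_sub_le` replaces the squared increment by an expression with
expectation (ν - μ) times the change of truncated mean; `sum_latentMean_sub_le` bounds the sum. -/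
theorem integral_sum_sq_latentVector_le {c : ℝ} (h : WrongSideBound X y c)
    (β β' : EuclideanSpace ℝ (Fin p)) :
    Integrable (fun u => ∑ i, (latentVector X y β' u i - latentVector X y β u i) ^ 2) (unifVec n) ∧
    ∫ u, ∑ i, (latentVector X y β' u i - latentVector X y β u i) ^ 2 ∂unifVec n ≤
      (1 - c / 4) * ∑ i, (X *ᵥ WithLp.ofLp (β' - β)) i ^ 2 := by
  set μ := X *ᵥ WithLp.ofLp β with hμ
  set ν := X *ᵥ WithLp.ofLp β' with hν
  have hd : X *ᵥ WithLp.ofLp (β' - β) = ν - μ := by rw [WithLp.ofLp_sub, Matrix.mulVec_sub]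
  have hmeas : ∀ i, Measurable fun u => latentMap (y i) (ν i) u - latentMap (y i) (μ i) u :=
    fun i => ((measurable_latentMap (y i)).comp measurable_prodMk_left).sub
      ((measurable_latentMap (y i)).comp measurable_prodMk_left)
  have hi : ∀ i, Integrable
      (fun u => (ν i - μ i) * (latentMap (y i) (ν i) u - latentMap (y i) (μ i) u)) unifLaw :=
    fun i => ((integrable_latentMap _ _).sub (integrable_latentMap _ _)).const_mul _
  have hsq : ∀ i, Integrable
      (fun u => (latentMap (y i) (ν i) u - latentMap (y i) (μ i) u) ^ 2) unifLaw := by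
    intro i
    refine (hi i).mono ((hmeas i).pow_const 2).aestronglyMeasurable ?_
    filter_upwards [ae_unifLaw] with u hu
    rw [Real.norm_of_nonneg (sq_nonneg _)]
    exact (sq_latentMap_sub_le _ hu _ _).trans (le_abs_self _)
  have hev : ∀ i, MeasurePreserving (Function.eval i) (unifVec n) unifLaw :=
    fun i => measurePreserving_eval (fun _ : Fin n => unifLaw) i
  have hsq' : ∀ i, Integrable
      (fun u : Fin n → ℝ => (latentMap (y i) (ν i) (u i) - latentMap (y i) (μ i) (u i)) ^ 2)
      (unifVec n) := fun i => (hev i).integrable_comp_of_integrable (hsq i)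
  refine ⟨integrable_finsetSum _ fun i _ => hsq' i, ?_⟩
  change ∫ u, ∑ i, (latentMap (y i) (ν i) (u i) - latentMap (y i) (μ i) (u i)) ^ 2 ∂unifVec n ≤ _
  rw [integral_finsetSum _ fun i _ => hsq' i]
  have h1 : ∀ i, ∫ u, (latentMap (y i) (ν i) (u i) - latentMap (y i) (μ i) (u i)) ^ 2 ∂unifVec n ≤
      (ν i - μ i) * (latentMean (y i) (ν i) - latentMean (y i) (μ i)) := by
    intro i
    have h2 := (integral_comp_eval (μ := fun _ : Fin n => unifLaw) (i := i)
      (hsq i).aestronglyMeasurable)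
    rw [unifVec, h2, ← integral_latentMap, ← integral_latentMap, ← integral_sub
      (integrable_latentMap _ _) (integrable_latentMap _ _), ← integral_const_mul]
    refine integral_mono_ae (hsq i) (hi i) ?_
    filter_upwards [ae_unifLaw] with u hu
    exact sq_latentMap_sub_le _ hu _ _
  refine (Finset.sum_le_sum fun i _ => h1 i).trans ?_
  have h3 := sum_latentMean_sub_le h (WithLp.ofLp β) (WithLp.ofLp (β' - β))
  rw [hd] at h3 ⊢
  have h4 : X *ᵥ (WithLp.ofLp β + WithLp.ofLp (β' - β)) = ν := by
    rw [← WithLp.ofLp_add, add_sub_cancel]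
  rw [h4] at h3
  exact h3

/-- The expected distance after one coupled step. -/
theorem lintegral_sigmaDist_randomMap_le {c : ℝ} (h : WrongSideBound X y c) (hc : c ≤ 4)
    (hS : (precision X Q).PosDef) (hQ : Q.PosSemidef) (β β' : EuclideanSpace ℝ (Fin p)) :
    ∫⁻ w, ENNReal.ofReal (sigmaDist (precision X Q) (randomMap X y Q v β w)
      (randomMap X y Q v β' w)) ∂noiseLaw n p ≤
      ENNReal.ofReal √(1 - c / 4) * ENNReal.ofReal (sigmaDist (precision X Q) β β') := by
  obtain ⟨hint, hle⟩ := integral_sum_sq_latentVector_le h β' β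
  set g : (Fin n → ℝ) → ℝ := fun u => ∑ i, (latentVector X y β u i - latentVector X y β' u i) ^ 2
    with hg
  have hg0 : ∀ u, 0 ≤ g u := fun u => Finset.sum_nonneg fun i _ => sq_nonneg _
  have hgm : Measurable g := by
    have h1 : ∀ β i, Measurable fun u => latentVector X y β u i := fun β i =>
      (measurable_pi_apply i).comp ((measurable_latentVector X y).comp measurable_prodMk_left)
    exact Finset.measurable_sum _ fun i _ => ((h1 β i).sub (h1 β' i)).pow_const 2
  have hgs : Integrable (fun u => √(g u)) (unifVec n) := by
    refine (hint.add (integrable_const (1 : ℝ))).mono hgm.sqrt.aestronglyMeasurable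
      (ae_of_all _ fun u => ?_)
    rw [Real.norm_of_nonneg (Real.sqrt_nonneg _)]
    refine le_trans ?_ (le_abs_self _)
    rw [Real.sqrt_le_iff]
    simp only [Pi.add_apply]
    constructor <;> nlinarith [hg0 u]
  -- Nonnegativity of the variance of √g; this passes from the mean square to the mean distance.
  have hvar : (∫ u, √(g u) ∂unifVec n) ^ 2 ≤ ∫ u, g u ∂unifVec n := by
    set m := ∫ u, √(g u) ∂unifVec n with hm
    have h1 : 0 ≤ ∫ u, (g u - 2 * m * √(g u) + m ^ 2) ∂unifVec n :=
      integral_nonneg fun u => by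
        simp only [Pi.zero_apply]
        nlinarith [sq_nonneg (√(g u) - m), Real.sq_sqrt (hg0 u)]
    have h2 : Integrable (fun u => g u - 2 * m * √(g u)) (unifVec n) := hint.sub (hgs.const_mul _)
    rw [integral_add h2 (integrable_const _),
      integral_sub hint (hgs.const_mul _), integral_const_mul, ← hm] at h1
    simp only [integral_const, probReal_univ, smul_eq_mul, one_mul] at h1
    nlinarith
  have hdist := sq_sigmaDist hS.posSemidef β β'
  have hb : ∫ u, √(g u) ∂unifVec n ≤ √(1 - c / 4) * sigmaDist (precision X Q) β β' := by
    have hnn := sigmaDist_nonneg (precision X Q) β β'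
    refine abs_le_of_sq_le_sq' ?_ (by positivity) |>.2
    rw [mul_pow, Real.sq_sqrt (by linarith), hdist]
    refine (hvar.trans hle).trans ?_
    exact mul_le_mul_of_nonneg_left (sum_sq_mulVec_le hQ _) (by linarith)
  calc ∫⁻ w, ENNReal.ofReal (sigmaDist (precision X Q) (randomMap X y Q v β w)
      (randomMap X y Q v β' w)) ∂noiseLaw n p
      ≤ ∫⁻ w, ENNReal.ofReal √(g w.1) ∂noiseLaw n p := by
        refine lintegral_mono fun w => ENNReal.ofReal_le_ofReal ?_
        exact Real.le_sqrt_of_sq_le (sq_sigmaDist_coefficientMean_le hS hQ _ _ _)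
    _ = ∫⁻ u, ENNReal.ofReal √(g u) ∂unifVec n := by
        have hmp : (noiseLaw n p).map Prod.fst = unifVec n := by
          rw [noiseLaw, Measure.map_fst_prod]; simp
        rw [← hmp, lintegral_map hgm.sqrt.ennreal_ofReal measurable_fst]
    _ = ENNReal.ofReal (∫ u, √(g u) ∂unifVec n) :=
        (ofReal_integral_eq_lintegral_ofReal hgs (ae_of_all _ fun u => Real.sqrt_nonneg _)).symm
    _ ≤ ENNReal.ofReal (√(1 - c / 4) * sigmaDist (precision X Q) β β') :=
        ENNReal.ofReal_le_ofReal hb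
    _ = _ := ENNReal.ofReal_mul (Real.sqrt_nonneg _)

/-! ### Convergence in the Wasserstein distance -/

/-- The law at time `m` and an invariant law can be coupled at a geometrically decreasing cost. -/
theorem exists_coupling_pow_acKernel {c : ℝ} (h : WrongSideBound X y c) (hc : c ≤ 4)
    (hS : (precision X Q).PosDef) (hQ : Q.PosSemidef) {π : Measure (EuclideanSpace ℝ (Fin p))}
    [IsProbabilityMeasure π] (hπ : π.bind (acKernel X y Q v) = π) (m : ℕ)
    (β : EuclideanSpace ℝ (Fin p)) :
    ∃ γ, IsCoupling ((acKernel X y Q v ^ m) β) π γ ∧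
      ∫⁻ z, ENNReal.ofReal (sigmaDist (precision X Q) z.1 z.2) ∂γ ≤
        (∫⁻ b, ENNReal.ofReal (sigmaDist (precision X Q) β b) ∂π) *
          ENNReal.ofReal √(1 - c / 4) ^ m := by
  have hψ : Measurable fun w : EuclideanSpace ℝ (Fin p) × EuclideanSpace ℝ (Fin p) =>
      ENNReal.ofReal (sigmaDist (precision X Q) w.1 w.2) :=
    (continuous_sigmaDist _).measurable.ennreal_ofReal
  have hF := measurable_randomMap X y Q v
  induction m with
  | zero =>
    -- At time 0 the first law is a point mass at β, so the coupling cost is the expected distance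
    -- from β under the invariant law.
    refine ⟨π.map fun b => (β, b), ⟨?_, ?_⟩, ?_⟩
    · rw [Measure.map_map measurable_fst measurable_prodMk_left, pow_zero]
      change π.map (fun _ => β) = Kernel.id β
      rw [Measure.map_const, Kernel.id_apply]
      simp
    · rw [Measure.map_map measurable_snd measurable_prodMk_left]
      exact Measure.map_id
    · rw [lintegral_map hψ measurable_prodMk_left]
      simp
  | succ m ih =>
    obtain ⟨γ, ⟨h1, h2⟩, h3⟩ := ih
    have hγ : IsProbabilityMeasure γ := by
      constructor
      rw [← Set.preimage_univ (f := Prod.snd), ← Measure.map_apply measurable_snd .univ, h2]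
      exact measure_univ
    have hK : IsProbabilityMeasure ((acKernel X y Q v ^ m) β) := by
      rw [← h1]
      exact Measure.isProbabilityMeasure_map measurable_fst.aemeasurable
    -- Both coordinates are advanced with the same noise, independent of the current pair. The
    -- second marginal stays equal to π by invariance.
    set T : (EuclideanSpace ℝ (Fin p) × EuclideanSpace ℝ (Fin p)) ×
        ((Fin n → ℝ) × EuclideanSpace ℝ (Fin p)) →
        EuclideanSpace ℝ (Fin p) × EuclideanSpace ℝ (Fin p) :=
      fun w => (randomMap X y Q v w.1.1 w.2, randomMap X y Q v w.1.2 w.2) with hT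
    have hT1 : Measurable fun w : (EuclideanSpace ℝ (Fin p) × EuclideanSpace ℝ (Fin p)) ×
        ((Fin n → ℝ) × EuclideanSpace ℝ (Fin p)) => randomMap X y Q v w.1.1 w.2 :=
      Measurable.randomMap X y Q v (measurable_fst.comp measurable_fst) measurable_snd
    have hT2 : Measurable fun w : (EuclideanSpace ℝ (Fin p) × EuclideanSpace ℝ (Fin p)) ×
        ((Fin n → ℝ) × EuclideanSpace ℝ (Fin p)) => randomMap X y Q v w.1.2 w.2 :=
      Measurable.randomMap X y Q v (measurable_snd.comp measurable_fst) measurable_snd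
    have hTm : Measurable T := hT1.prodMk hT2
    refine ⟨(γ.prod (noiseLaw n p)).map T, ⟨?_, ?_⟩, ?_⟩
    · rw [Measure.map_map measurable_fst hTm]
      have e1 : Prod.fst ∘ T = (fun w => randomMap X y Q v w.1 w.2) ∘ Prod.map Prod.fst id := rfl
      rw [e1, ← Measure.map_map hF (measurable_fst.prodMap measurable_id),
        ← Measure.map_prod_map _ _ measurable_fst measurable_id, h1, Measure.map_id,
        map_prod_randomMap]
      ext s hs
      rw [Measure.bind_apply hs (Kernel.aemeasurable _),
        Kernel.pow_succ_apply_eq_lintegral _ _ _ hs]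
    · rw [Measure.map_map measurable_snd hTm]
      have e1 : Prod.snd ∘ T = (fun w => randomMap X y Q v w.1 w.2) ∘ Prod.map Prod.snd id := rfl
      rw [e1, ← Measure.map_map hF (measurable_snd.prodMap measurable_id),
        ← Measure.map_prod_map _ _ measurable_snd measurable_id, h2, Measure.map_id,
        map_prod_randomMap, hπ]
    · rw [lintegral_map hψ hTm, lintegral_prod
        (fun w => ENNReal.ofReal (sigmaDist (precision X Q) (T w).1 (T w).2))
        (hψ.comp hTm).aemeasurable]
      calc _ ≤ ∫⁻ b, ENNReal.ofReal √(1 - c / 4) *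
              ENNReal.ofReal (sigmaDist (precision X Q) b.1 b.2) ∂γ :=
            lintegral_mono fun b => lintegral_sigmaDist_randomMap_le h hc hS hQ b.1 b.2
        _ = ENNReal.ofReal √(1 - c / 4) *
              ∫⁻ b, ENNReal.ofReal (sigmaDist (precision X Q) b.1 b.2) ∂γ :=
            lintegral_const_mul _ hψ
        _ ≤ ENNReal.ofReal √(1 - c / 4) * _ := mul_le_mul_right h3 _
        _ = _ := by rw [pow_succ]; ring

end RandomMap

/-! ### Densities of product measures and of Gaussian measures -/

theorem pi_withDensity_ofReal {ι : Type*} [Fintype ι] {f : ι → ℝ → ℝ}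
    (hf : ∀ i, Integrable (f i)) (hf0 : ∀ i t, 0 ≤ f i t) :
    Measure.pi (fun i => volume.withDensity fun t => ENNReal.ofReal (f i t)) =
      (volume : Measure (ι → ℝ)).withDensity fun x => ENNReal.ofReal (∏ i, f i (x i)) := by
  have hfin : ∀ i, IsFiniteMeasure (volume.withDensity fun t => ENNReal.ofReal (f i t)) :=
    fun i => isFiniteMeasure_withDensity_ofReal (hf i).2
  refine Measure.pi_eq fun s hs => ?_
  have hI : ∀ i, Integrable ((s i).indicator (f i)) := fun i => (hf i).indicator (hs i)
  have hI0 : ∀ i t, 0 ≤ (s i).indicator (f i) t := fun i t =>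
    Set.indicator_nonneg (fun x _ => hf0 i x) t
  rw [withDensity_apply _ (MeasurableSet.univ_pi hs), ← lintegral_indicator
    (MeasurableSet.univ_pi hs)]
  have h1 : ∀ x : ι → ℝ, (Set.univ.pi s).indicator (fun x => ENNReal.ofReal (∏ i, f i (x i))) x =
      ENNReal.ofReal (∏ i, (s i).indicator (f i) (x i)) := by
    intro x
    by_cases hx : x ∈ Set.univ.pi s
    · rw [Set.indicator_of_mem hx]
      congr 1
      exact Finset.prod_congr rfl fun i _ => (Set.indicator_of_mem (hx i (Set.mem_univ i)) _).symm
    · rw [Set.indicator_of_notMem hx]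
      simp only [Set.mem_pi, Set.mem_univ, true_imp_iff, not_forall] at hx
      obtain ⟨i, hi⟩ := hx
      rw [Finset.prod_eq_zero (Finset.mem_univ i) (Set.indicator_of_notMem hi _),
        ENNReal.ofReal_zero]
  rw [lintegral_congr h1, volume_pi,
    ← ofReal_integral_eq_lintegral_ofReal (Integrable.fintype_prod hI)
    (ae_of_all _ fun x => Finset.prod_nonneg fun i _ => hI0 i (x i)),
    integral_fintype_prod_eq_prod, ENNReal.ofReal_prod_of_nonneg
    fun i _ => integral_nonneg (hI0 i)]
  refine Finset.prod_congr rfl fun i _ => ?_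
  rw [withDensity_apply _ (hs i), integral_indicator (hs i),
    ofReal_integral_eq_lintegral_ofReal (hf i).integrableOn (ae_of_all _ (hf0 i))]

section Gaussian

variable {p : ℕ}

/-- The density of the standard Gaussian distribution on Euclidean space. -/
def gaussDensity (x : EuclideanSpace ℝ (Fin p)) : ℝ :=
  (√(2 * Real.pi))⁻¹ ^ p * Real.exp (-(1 / 2) * ‖x‖ ^ 2)

theorem gaussDensity_nonneg (x : EuclideanSpace ℝ (Fin p)) : 0 ≤ gaussDensity x := by
  unfold gaussDensity
  positivity

theorem continuous_gaussDensity : Continuous (gaussDensity (p := p)) := by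
  unfold gaussDensity; fun_prop

theorem stdGaussian_eq_withDensity :
    stdGaussian (EuclideanSpace ℝ (Fin p)) =
      volume.withDensity fun x => ENNReal.ofReal (gaussDensity x) := by
  have h1 : gaussianReal 0 1 = volume.withDensity fun t => ENNReal.ofReal (stdNormalPdf t) := by
    rw [gaussianReal_of_var_ne_zero 0 one_ne_zero]; rfl
  have hm : Measurable fun x : EuclideanSpace ℝ (Fin p) => ENNReal.ofReal (gaussDensity x) :=
    continuous_gaussDensity.measurable.ennreal_ofReal
  have hp := PiLp.volume_preserving_toLp (Fin p)
  rw [← map_pi_eq_stdGaussian, h1, pi_withDensity_ofReal (fun _ => integrable_stdNormalPdf)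
    fun _ t => (stdNormalPdf_pos t).le]
  ext s hs
  rw [Measure.map_apply hp.measurable hs, withDensity_apply _ hs,
    withDensity_apply _ (hp.measurable hs), ← hp.setLIntegral_comp_preimage hs hm]
  refine lintegral_congr fun x => ?_
  congr 1
  simp only [stdNormalPdf_eq, gaussDensity, Finset.prod_mul_distrib, Finset.prod_const,
    Finset.card_univ, Fintype.card_fin, ← Real.exp_sum]
  congr 2
  rw [EuclideanSpace.norm_sq_eq, Finset.mul_sum]
  refine Finset.sum_congr rfl fun i _ => ?_
  simp
  ring

theorem integrable_exp_neg_mul_norm_sq {b : ℝ} (hb : 0 < b) :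
    Integrable fun x : EuclideanSpace ℝ (Fin p) => Real.exp (-b * ‖x‖ ^ 2) := by
  have h := GaussianFourier.integrable_cexp_neg_mul_sq_norm_add (V := EuclideanSpace ℝ (Fin p))
    (b := b)
    (by simpa using hb) 0 0
  refine h.norm.congr (ae_of_all _ fun x => ?_)
  beta_reduce
  rw [Complex.norm_exp]
  congr 1
  norm_cast
  simp

/-- Half of the exponent absorbs the factor ‖x‖, since ‖x‖ ≤ 1 + ‖x‖² is at most a constant times
exp(b‖x‖²/2). -/
theorem integrable_norm_mul_exp_neg_mul_norm_sq {b : ℝ} (hb : 0 < b) :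
    Integrable fun x : EuclideanSpace ℝ (Fin p) => ‖x‖ * Real.exp (-b * ‖x‖ ^ 2) := by
  refine ((integrable_exp_neg_mul_norm_sq (p := p) (half_pos hb)).const_mul (1 + 2 / b)).mono
    (by fun_prop) (ae_of_all _ fun x => ?_)
  rw [Real.norm_of_nonneg (by positivity), Real.norm_of_nonneg (by positivity)]
  have h1 : Real.exp (-b * ‖x‖ ^ 2) =
      Real.exp (-(b / 2 * ‖x‖ ^ 2)) * Real.exp (-(b / 2) * ‖x‖ ^ 2) := by
    rw [← Real.exp_add]; congr 1; ring
  rw [h1, ← mul_assoc]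
  refine mul_le_mul_of_nonneg_right ?_ (Real.exp_pos _).le
  rw [Real.exp_neg, ← div_eq_mul_inv, div_le_iff₀ (Real.exp_pos _)]
  have h2 := Real.add_one_le_exp (b / 2 * ‖x‖ ^ 2)
  have h3 : ‖x‖ ≤ 1 + ‖x‖ ^ 2 := by nlinarith [sq_nonneg (‖x‖ - 1)]
  have h4 : (1 + 2 / b) * (b / 2 * ‖x‖ ^ 2 + 1) =
      1 + ‖x‖ ^ 2 + (b / 2 * ‖x‖ ^ 2 + 2 / b) := by
    field_simp
    ring
  have h5 : 0 ≤ b / 2 * ‖x‖ ^ 2 + 2 / b := by positivity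
  have h6 : (1 + 2 / b) * (b / 2 * ‖x‖ ^ 2 + 1) ≤ (1 + 2 / b) * Real.exp (b / 2 * ‖x‖ ^ 2) :=
    mul_le_mul_of_nonneg_left h2 (by positivity)
  linarith

theorem integrable_gaussDensity : Integrable (gaussDensity (p := p)) :=
  (integrable_exp_neg_mul_norm_sq one_half_pos).const_mul _

theorem integrable_norm_mul_gaussDensity :
    Integrable fun x : EuclideanSpace ℝ (Fin p) => ‖x‖ * gaussDensity x := by
  refine ((integrable_norm_mul_exp_neg_mul_norm_sq (p := p) one_half_pos).const_mul
    ((√(2 * Real.pi))⁻¹ ^ p)).congr (ae_of_all _ fun x => ?_)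
  simp only [gaussDensity]
  ring

theorem integral_gaussDensity : ∫ x : EuclideanSpace ℝ (Fin p), gaussDensity x = 1 := by
  have h : (stdGaussian (EuclideanSpace ℝ (Fin p))) Set.univ = 1 := measure_univ
  rw [stdGaussian_eq_withDensity, withDensity_apply _ .univ, Measure.restrict_univ,
    ← ofReal_integral_eq_lintegral_ofReal integrable_gaussDensity
      (ae_of_all _ gaussDensity_nonneg)] at h
  exact ENNReal.ofReal_eq_one.1 h

theorem stdGaussian_real_apply {s : Set (EuclideanSpace ℝ (Fin p))} (hs : MeasurableSet s) :
    (stdGaussian (EuclideanSpace ℝ (Fin p))).real s = ∫ x in s, gaussDensity x := by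
  rw [measureReal_def, stdGaussian_eq_withDensity, withDensity_apply _ hs,
    ← ofReal_integral_eq_lintegral_ofReal integrable_gaussDensity.integrableOn
      (ae_of_all _ gaussDensity_nonneg), ENNReal.toReal_ofReal
      (integral_nonneg gaussDensity_nonneg)]

/-! ### Total variation between translates of a Gaussian measure -/

theorem abs_exp_neg_sub_exp_neg_le (a b : ℝ) :
    |Real.exp (-a) - Real.exp (-b)| ≤ |a - b| * (Real.exp (-a) + Real.exp (-b)) := by
  wlog hab : a ≤ b generalizing a b
  · rw [abs_sub_comm, abs_sub_comm a b, add_comm (Real.exp (-a))]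
    exact this b a (le_of_not_ge hab)
  rw [abs_of_nonneg (sub_nonneg.2 (Real.exp_le_exp.2 (neg_le_neg hab))),
    abs_of_nonpos (sub_nonpos.2 hab)]
  have h1 : Real.exp (-b) = Real.exp (-a) * Real.exp (a - b) := by
    rw [← Real.exp_add]; congr 1; ring
  have h2 := Real.add_one_le_exp (a - b)
  have h3 := Real.exp_pos (-a)
  have h4 := Real.exp_pos (-b)
  nlinarith [mul_nonneg (sub_nonneg.2 hab) h4.le]

/-- The two exponents differ by (‖x‖ - ‖x - h‖)(‖x‖ + ‖x - h‖)/2, whose first factor is at most ‖h‖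
in size. -/
theorem abs_gaussDensity_sub_le (x h : EuclideanSpace ℝ (Fin p)) :
    |gaussDensity x - gaussDensity (x - h)| ≤
      ‖h‖ * (‖x‖ + ‖x - h‖) * (gaussDensity x + gaussDensity (x - h)) := by
  have hc : 0 ≤ (√(2 * Real.pi))⁻¹ ^ p := by positivity
  have h1 := abs_exp_neg_sub_exp_neg_le (1 / 2 * ‖x‖ ^ 2) (1 / 2 * ‖x - h‖ ^ 2)
  have h2 : |1 / 2 * ‖x‖ ^ 2 - 1 / 2 * ‖x - h‖ ^ 2| ≤ ‖h‖ * (‖x‖ + ‖x - h‖) := by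
    have h3 : |‖x‖ - ‖x - h‖| ≤ ‖h‖ := by simpa using abs_norm_sub_norm_le x (x - h)
    have h4 : 1 / 2 * ‖x‖ ^ 2 - 1 / 2 * ‖x - h‖ ^ 2 =
        (‖x‖ - ‖x - h‖) * ((‖x‖ + ‖x - h‖) / 2) := by ring
    rw [h4, abs_mul, abs_of_nonneg (by positivity : 0 ≤ (‖x‖ + ‖x - h‖) / 2)]
    refine mul_le_mul h3 ?_ (by positivity) (norm_nonneg _)
    linarith [norm_nonneg x, norm_nonneg (x - h)]
  simp only [gaussDensity, ← mul_sub, ← mul_add, abs_mul, abs_of_nonneg hc]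
  rw [mul_left_comm]
  refine mul_le_mul_of_nonneg_left ?_ hc
  simp only [neg_mul] at h1 ⊢
  exact h1.trans (mul_le_mul_of_nonneg_right h2 (by positivity))

/-- Translating a standard Gaussian measure is Lipschitz in total variation. -/
theorem exists_stdGaussian_translate_le (p : ℕ) :
    ∃ C : ℝ, 0 ≤ C ∧ ∀ (h : EuclideanSpace ℝ (Fin p)) (s : Set (EuclideanSpace ℝ (Fin p))),
      MeasurableSet s → |(stdGaussian (EuclideanSpace ℝ (Fin p))).real s -
        (stdGaussian (EuclideanSpace ℝ (Fin p))).real ((fun e => e + h) ⁻¹' s)| ≤ C * ‖h‖ := by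
  set m : ℝ := ∫ x : EuclideanSpace ℝ (Fin p), ‖x‖ * gaussDensity x with hm
  have hm0 : 0 ≤ m := integral_nonneg fun x => mul_nonneg (norm_nonneg _) (gaussDensity_nonneg x)
  -- For ‖h‖ ≤ 1 the integrated density bound gives the constant 4m + 2, with m the mean Gaussian
  -- norm; for ‖h‖ > 1 the trivial bound 1 is enough.
  refine ⟨4 * m + 3, by linarith, fun h s hs => ?_⟩
  rcases le_or_gt ‖h‖ 1 with hh | hh
  · have hi1 := integrable_gaussDensity (p := p)
    have hi2 := hi1.comp_sub_right h
    have hi3 := integrable_norm_mul_gaussDensity (p := p)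
    have hi4 : Integrable fun x : EuclideanSpace ℝ (Fin p) => ‖x - h‖ * gaussDensity (x - h) :=
      hi3.comp_sub_right h
    have e1 : (stdGaussian (EuclideanSpace ℝ (Fin p))).real ((fun e => e + h) ⁻¹' s) =
        ∫ x in s, gaussDensity (x - h) := by
      rw [stdGaussian_real_apply (measurable_add_const h hs)]
      have hp : MeasurePreserving (fun e : EuclideanSpace ℝ (Fin p) => e + h) volume volume :=
        measurePreserving_add_right volume h
      have e := hp.setIntegral_preimage_emb (measurableEmbedding_addRight h)
        (fun x => gaussDensity (x - h)) s
      simpa only [add_sub_cancel_right] using e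
    rw [stdGaussian_real_apply hs, e1, ← integral_sub hi1.integrableOn hi2.integrableOn]
    have hb : ∀ x : EuclideanSpace ℝ (Fin p), |gaussDensity x - gaussDensity (x - h)| ≤
        ‖h‖ * (2 * (‖x‖ * gaussDensity x) + 2 * (‖x - h‖ * gaussDensity (x - h)) +
          gaussDensity x + gaussDensity (x - h)) := by
      intro x
      refine (abs_gaussDensity_sub_le x h).trans ?_
      rw [mul_assoc]
      refine mul_le_mul_of_nonneg_left ?_ (norm_nonneg _)
      have n1 : ‖x‖ ≤ ‖x - h‖ + 1 := by
        have := norm_le_norm_sub_add x h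
        linarith
      have n2 : ‖x - h‖ ≤ ‖x‖ + 1 := by
        have := norm_sub_le x h
        linarith
      nlinarith [mul_le_mul_of_nonneg_right n2 (gaussDensity_nonneg x),
        mul_le_mul_of_nonneg_right n1 (gaussDensity_nonneg (x - h))]
    have ha1 : Integrable fun x : EuclideanSpace ℝ (Fin p) =>
        2 * (‖x‖ * gaussDensity x) + 2 * (‖x - h‖ * gaussDensity (x - h)) :=
      (hi3.const_mul 2).add (hi4.const_mul 2)
    have ha2 : Integrable fun x : EuclideanSpace ℝ (Fin p) =>
        2 * (‖x‖ * gaussDensity x) + 2 * (‖x - h‖ * gaussDensity (x - h)) + gaussDensity x :=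
      ha1.add hi1
    have hi5 : Integrable fun x : EuclideanSpace ℝ (Fin p) =>
        ‖h‖ * (2 * (‖x‖ * gaussDensity x) + 2 * (‖x - h‖ * gaussDensity (x - h)) +
          gaussDensity x + gaussDensity (x - h)) :=
      (ha2.add hi2).const_mul _
    have e2 : ∫ x : EuclideanSpace ℝ (Fin p),
        ‖h‖ * (2 * (‖x‖ * gaussDensity x) + 2 * (‖x - h‖ * gaussDensity (x - h)) +
          gaussDensity x + gaussDensity (x - h)) = ‖h‖ * (4 * m + 2) := by
      have t1 : ∫ x : EuclideanSpace ℝ (Fin p), gaussDensity (x - h) = 1 := by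
        rw [integral_sub_right_eq_self (fun x => gaussDensity x) h, integral_gaussDensity]
      have t2 : ∫ x : EuclideanSpace ℝ (Fin p), ‖x - h‖ * gaussDensity (x - h) = m :=
        integral_sub_right_eq_self (fun x : EuclideanSpace ℝ (Fin p) => ‖x‖ * gaussDensity x) h
      rw [integral_const_mul, integral_add ha2 hi2, integral_add ha1 hi1,
        integral_add (hi3.const_mul 2) (hi4.const_mul 2), integral_const_mul, integral_const_mul,
        t1, t2, integral_gaussDensity]
      ring
    calc |∫ x in s, (gaussDensity x - gaussDensity (x - h))|
        ≤ ∫ x in s, |gaussDensity x - gaussDensity (x - h)| := abs_integral_le_integral_abs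
      _ ≤ ∫ x, |gaussDensity x - gaussDensity (x - h)| :=
          setIntegral_le_integral (hi1.sub hi2).abs (ae_of_all _ fun x => abs_nonneg _)
      _ ≤ _ := integral_mono (hi1.sub hi2).abs hi5 hb
      _ = ‖h‖ * (4 * m + 2) := e2
      _ ≤ (4 * m + 3) * ‖h‖ := by nlinarith [norm_nonneg h]
  · have a1 : (stdGaussian (EuclideanSpace ℝ (Fin p))).real s ≤ 1 := measureReal_le_one
    have a2 : (stdGaussian (EuclideanSpace ℝ (Fin p))).real ((fun e => e + h) ⁻¹' s) ≤ 1 :=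
      measureReal_le_one
    have a3 : 0 ≤ (stdGaussian (EuclideanSpace ℝ (Fin p))).real s := measureReal_nonneg
    have a4 : 0 ≤ (stdGaussian (EuclideanSpace ℝ (Fin p))).real ((fun e => e + h) ⁻¹' s) :=
      measureReal_nonneg
    rw [abs_le]
    constructor <;> nlinarith

end Gaussian

/-! ### Gaussian density and total variation continuity of the second step. -/

section SecondStep

variable {n p : ℕ}

open scoped MatrixOrder in
/-- The inverse of `covSqrt S`. -/
def covSqrtInv (S : Matrix (Fin p) (Fin p) ℝ) :
    EuclideanSpace ℝ (Fin p) →L[ℝ] EuclideanSpace ℝ (Fin p) :=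
  Matrix.toEuclideanCLM (𝕜 := ℝ) (CFC.sqrt S⁻¹ * S)

section

open scoped MatrixOrder

theorem sqrt_inv_mul_sqrt_inv {S : Matrix (Fin p) (Fin p) ℝ} (hS : S.PosDef) :
    CFC.sqrt S⁻¹ * (CFC.sqrt S⁻¹ * S) = 1 := by
  rw [← mul_assoc, CFC.sqrt_mul_sqrt_self _ hS.inv.posSemidef.nonneg, Matrix.nonsing_inv_mul _
    ((Matrix.isUnit_iff_isUnit_det _).1 hS.isUnit)]

theorem transpose_sqrt (A : Matrix (Fin p) (Fin p) ℝ) : (CFC.sqrt A)ᵀ = CFC.sqrt A := by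
  have h : star (CFC.sqrt A) = CFC.sqrt A := (CFC.sqrt_nonneg A).isSelfAdjoint
  simpa [Matrix.star_eq_conjTranspose] using h

theorem covSqrt_covSqrtInv {S : Matrix (Fin p) (Fin p) ℝ} (hS : S.PosDef)
    (x : EuclideanSpace ℝ (Fin p)) : covSqrt S (covSqrtInv S x) = x := by
  have h : covSqrt S * covSqrtInv S = 1 := by
    rw [covSqrt, covSqrtInv, ← map_mul, sqrt_inv_mul_sqrt_inv hS, map_one]
  exact DFunLike.congr_fun h x

/-- The map S^{-1/2} is an isometry from the Euclidean norm to the S-norm, because S^{-1/2} S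
S^{-1/2} = 1. Noise shifts thus have Euclidean length equal to the Σ-distance they produce. -/
theorem dotProduct_covSqrt {S : Matrix (Fin p) (Fin p) ℝ} (hS : S.PosDef)
    (e : EuclideanSpace ℝ (Fin p)) :
    WithLp.ofLp (covSqrt S e) ⬝ᵥ S *ᵥ WithLp.ofLp (covSqrt S e) = ‖e‖ ^ 2 := by
  have h2 : CFC.sqrt S⁻¹ * S * CFC.sqrt S⁻¹ = 1 :=
    mul_eq_one_comm.1 (sqrt_inv_mul_sqrt_inv hS)
  have h1 : WithLp.ofLp (covSqrt S e) = CFC.sqrt S⁻¹ *ᵥ WithLp.ofLp e := rfl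
  rw [h1, Matrix.mulVec_mulVec, dotProduct_comm, Matrix.dotProduct_mulVec,
    ← Matrix.mulVec_transpose,
    transpose_sqrt, Matrix.mulVec_mulVec, ← mul_assoc, h2, Matrix.one_mulVec,
    EuclideanSpace.norm_sq_eq]
  simp [dotProduct, sq]

end

theorem sigmaDist_add_covSqrt {S : Matrix (Fin p) (Fin p) ℝ} (hS : S.PosDef)
    (b e : EuclideanSpace ℝ (Fin p)) : sigmaDist S (b + covSqrt S e) b = ‖e‖ := by
  rw [sigmaDist, add_sub_cancel_left, dotProduct_covSqrt hS, Real.sqrt_sq (norm_nonneg e)]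

theorem sigmaDist_comm (S : Matrix (Fin p) (Fin p) ℝ) (b b' : EuclideanSpace ℝ (Fin p)) :
    sigmaDist S b b' = sigmaDist S b' b := by
  rw [sigmaDist, sigmaDist, ← neg_sub b' b, WithLp.ofLp_neg, Matrix.mulVec_neg, neg_dotProduct_neg]

theorem det_covSqrt_ne_zero {S : Matrix (Fin p) (Fin p) ℝ} (hS : S.PosDef) :
    LinearMap.det (covSqrt S : EuclideanSpace ℝ (Fin p) →ₗ[ℝ] EuclideanSpace ℝ (Fin p)) ≠ 0 := by
  have h : (covSqrt S : EuclideanSpace ℝ (Fin p) →ₗ[ℝ] EuclideanSpace ℝ (Fin p)) *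
      (covSqrtInv S : EuclideanSpace ℝ (Fin p) →ₗ[ℝ] EuclideanSpace ℝ (Fin p)) = 1 :=
    LinearMap.ext fun x => covSqrt_covSqrtInv hS x
  have h2 := congrArg LinearMap.det h
  rw [map_mul, map_one] at h2
  exact left_ne_zero_of_mul_eq_one h2

variable {X : Matrix (Fin n) (Fin p) ℝ} {Q : Matrix (Fin p) (Fin p) ℝ}
  {v : EuclideanSpace ℝ (Fin p)}

/-- The second step of the chain has a Gaussian density. -/
theorem exists_coefficientKernel_eq_withDensity (hS : (precision X Q).PosDef) :
    ∃ κ : ℝ, 0 < κ ∧ ∀ z, coefficientKernel X Q v z = volume.withDensity fun b =>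
      ENNReal.ofReal (κ * Real.exp (-(1 / 2) * (WithLp.ofLp (b - coefficientMean X Q v z) ⬝ᵥ
        precision X Q *ᵥ WithLp.ofLp (b - coefficientMean X Q v z)))) := by
  set S := precision X Q with hSdef
  set d := |(LinearMap.det
    (covSqrt S : EuclideanSpace ℝ (Fin p) →ₗ[ℝ] EuclideanSpace ℝ (Fin p)))⁻¹| with hd
  have hd0 : 0 < d := abs_pos.2 (inv_ne_zero (det_covSqrt_ne_zero hS))
  refine ⟨d * (√(2 * Real.pi))⁻¹ ^ p, by positivity, fun z => ?_⟩
  set m := coefficientMean X Q v z with hm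
  set q : EuclideanSpace ℝ (Fin p) → ℝ := fun b => WithLp.ofLp (b - m) ⬝ᵥ S *ᵥ WithLp.ofLp (b - m)
    with hq
  have hqc : Continuous q := by
    simp only [hq, Matrix.mulVec, dotProduct]
    fun_prop
  -- Affine change of variables: Lebesgue measure is scaled by the inverse determinant, which does
  -- not depend on z and so can be part of the common constant.
  have hvol : (volume : Measure (EuclideanSpace ℝ (Fin p))).map (fun e => m + covSqrt S e) =
      ENNReal.ofReal d • volume := by
    have h1 := Measure.map_linearMap_addHaar_eq_smul_addHaar
      (volume : Measure (EuclideanSpace ℝ (Fin p))) (det_covSqrt_ne_zero hS)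
    have h2 : (fun e => m + covSqrt S e) = (fun e => m + e) ∘ covSqrt S := rfl
    rw [h2, ← Measure.map_map (measurable_const_add m) (by fun_prop)]
    change (Measure.map (covSqrt S : EuclideanSpace ℝ (Fin p) →ₗ[ℝ] EuclideanSpace ℝ (Fin p))
      volume).map _ = _
    rw [h1, Measure.map_smul, map_add_left_eq_self]
  ext s hs
  have hfm : Measurable fun e => m + covSqrt S e := by fun_prop
  have hGm : Measurable fun b => ENNReal.ofReal ((√(2 * Real.pi))⁻¹ ^ p *
      Real.exp (-(1 / 2) * q b)) := by
    have := hqc.measurable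
    fun_prop
  rw [coefficientKernel_apply, ← hSdef, ← hm, Measure.map_apply hfm hs, stdGaussian_eq_withDensity,
    withDensity_apply _ (hfm hs), withDensity_apply _ hs]
  have h3 : ∀ e : EuclideanSpace ℝ (Fin p), ENNReal.ofReal (gaussDensity e) =
      ENNReal.ofReal ((√(2 * Real.pi))⁻¹ ^ p * Real.exp (-(1 / 2) * q (m + covSqrt S e))) := by
    intro e
    simp only [hq, add_sub_cancel_left, dotProduct_covSqrt hS, gaussDensity]
  rw [lintegral_congr h3, ← setLIntegral_map hs hGm hfm, hvol, Measure.restrict_smul,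
    lintegral_smul_measure, smul_eq_mul, ← lintegral_const_mul _ hGm]
  refine lintegral_congr fun b => ?_
  rw [← ENNReal.ofReal_mul hd0.le, mul_assoc]

/-- The second step of the chain is Lipschitz in total variation. -/
theorem exists_coefficientKernel_le (hS : (precision X Q).PosDef) :
    ∃ C : ℝ≥0, ∀ z z' (s : Set (EuclideanSpace ℝ (Fin p))), MeasurableSet s →
      coefficientKernel X Q v z s ≤ coefficientKernel X Q v z' s + C *
        ENNReal.ofReal (sigmaDist (precision X Q) (coefficientMean X Q v z)
          (coefficientMean X Q v z')) := by
  obtain ⟨C, hC0, hC⟩ := exists_stdGaussian_translate_le p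
  refine ⟨C.toNNReal, fun z z' s hs => ?_⟩
  set S := precision X Q with hSdef
  -- The difference of the two means is read as a translation of the standard Gaussian noise; ‖h‖ is
  -- the Σ-distance of the means.
  set h := covSqrtInv S (coefficientMean X Q v z - coefficientMean X Q v z') with hh
  have hm : coefficientMean X Q v z = coefficientMean X Q v z' + covSqrt S h := by
    rw [hh, covSqrt_covSqrtInv hS]; abel
  have hfm : Measurable fun e => coefficientMean X Q v z' + covSqrt S e := by fun_prop
  have hfm' : Measurable fun e => coefficientMean X Q v z + covSqrt S e := by fun_prop
  have h1 := hC h _ (hfm hs)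
  have h2 : (fun e => e + h) ⁻¹' ((fun e => coefficientMean X Q v z' + covSqrt S e) ⁻¹' s) =
      (fun e => coefficientMean X Q v z + covSqrt S e) ⁻¹' s := by
    ext e
    simp only [Set.mem_preimage, map_add, hm]
    rw [add_assoc, add_comm (covSqrt S h)]
  rw [h2] at h1
  have h3 : sigmaDist S (coefficientMean X Q v z) (coefficientMean X Q v z') = ‖h‖ := by
    rw [hm, sigmaDist_add_covSqrt hS]
  rw [h3, coefficientKernel_apply, coefficientKernel_apply, ← hSdef, Measure.map_apply hfm hs,
    Measure.map_apply hfm' hs, ← ofReal_measureReal, ← ofReal_measureReal,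
    show (C.toNNReal : ℝ≥0∞) = ENNReal.ofReal C from rfl, ← ENNReal.ofReal_mul hC0,
    ← ENNReal.ofReal_add measureReal_nonneg (by positivity)]
  refine ENNReal.ofReal_le_ofReal ?_
  linarith [(abs_le.1 h1).1]

/-! ### Convergence in total variation -/

/-- The Lipschitz bound of the second step is averaged over the quantile coupling of the latent
vectors. The Gaussian noise cancels in the coupled step, so the averaged distance of conditional
means is the one-step cost already bounded, and the contraction factor is discarded as at most 1. -/
theorem exists_acKernel_le {y : Fin n → Bool} {c : ℝ} (h : WrongSideBound X y c) (hc0 : 0 ≤ c)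
    (hc : c ≤ 4) (hS : (precision X Q).PosDef) (hQ : Q.PosSemidef) :
    ∃ C : ℝ≥0, ∀ b b' (s : Set (EuclideanSpace ℝ (Fin p))), MeasurableSet s →
      acKernel X y Q v b s ≤ acKernel X y Q v b' s +
        C * ENNReal.ofReal (sigmaDist (precision X Q) b b') := by
  obtain ⟨C, hC⟩ := exists_coefficientKernel_le (v := v) hS
  refine ⟨C, fun b b' s hs => ?_⟩
  have hl : ∀ b, Measurable (latentVector X y b) := fun b =>
    (measurable_latentVector X y).comp measurable_prodMk_left
  have hK : ∀ b, acKernel X y Q v b s =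
      ∫⁻ u, coefficientKernel X Q v (latentVector X y b u) s ∂unifVec n := fun b => by
    rw [acKernel, Kernel.comp_apply' _ _ _ hs, ← map_latentVector, lintegral_map
      (Kernel.measurable_coe _ hs) (hl b)]
  have hcm := (continuous_coefficientMean X Q v).measurable
  have hψ : Measurable fun u => ENNReal.ofReal (sigmaDist (precision X Q)
      (coefficientMean X Q v (latentVector X y b u))
      (coefficientMean X Q v (latentVector X y b' u))) :=
    ((continuous_sigmaDist _).measurable.comp
      ((hcm.comp (hl b)).prodMk (hcm.comp (hl b')))).ennreal_ofReal
  have hstep := lintegral_sigmaDist_randomMap_le (v := v) h hc hS hQ b b'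
  have e1 : ∫⁻ w, ENNReal.ofReal (sigmaDist (precision X Q) (randomMap X y Q v b w)
      (randomMap X y Q v b' w)) ∂noiseLaw n p =
      ∫⁻ u, ENNReal.ofReal (sigmaDist (precision X Q)
      (coefficientMean X Q v (latentVector X y b u))
      (coefficientMean X Q v (latentVector X y b' u))) ∂unifVec n := by
    have hmp : (noiseLaw n p).map Prod.fst = unifVec n := by
      rw [noiseLaw, Measure.map_fst_prod]; simp
    rw [← hmp, lintegral_map hψ measurable_fst]
    refine lintegral_congr fun w => ?_
    simp only [sigmaDist, randomMap, add_sub_add_right_eq_sub]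
  rw [e1] at hstep
  rw [hK, hK]
  calc _ ≤ ∫⁻ u, (coefficientKernel X Q v (latentVector X y b' u) s + C *
        ENNReal.ofReal (sigmaDist (precision X Q) (coefficientMean X Q v (latentVector X y b u))
          (coefficientMean X Q v (latentVector X y b' u)))) ∂unifVec n :=
        lintegral_mono fun u => hC _ _ s hs
    _ = _ + C * _ := by
        rw [lintegral_add_right _ (hψ.const_mul _), lintegral_const_mul _ hψ]
    _ ≤ _ := by
        gcongr
        refine hstep.trans (mul_le_of_le_one_left zero_le ?_)
        rw [ENNReal.ofReal_le_one, Real.sqrt_le_one]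
        linarith

theorem tvDistance_le_of_forall_le {S : Type*} [MeasurableSpace S] {μ ν : Measure S}
    [IsProbabilityMeasure μ] [IsProbabilityMeasure ν] {D : ℝ≥0∞}
    (h1 : ∀ s, MeasurableSet s → μ s ≤ ν s + D) (h2 : ∀ s, MeasurableSet s → ν s ≤ μ s + D) :
    tvDistance μ ν ≤ D := by
  refine iSup₂_le fun s hs => ?_
  rcases eq_or_ne D ∞ with rfl | hD
  · exact le_top
  refine ENNReal.ofReal_le_of_le_toReal ?_
  have a1 := ENNReal.toReal_mono (ENNReal.add_ne_top.2 ⟨measure_ne_top ν s, hD⟩) (h1 s hs)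
  have a2 := ENNReal.toReal_mono (ENNReal.add_ne_top.2 ⟨measure_ne_top μ s, hD⟩) (h2 s hs)
  rw [ENNReal.toReal_add (measure_ne_top _ _) hD] at a1 a2
  rw [abs_le]
  simp only [measureReal_def]
  constructor <;> linarith

theorem tvDistance_le_one {S : Type*} [MeasurableSpace S] (μ ν : Measure S)
    [IsProbabilityMeasure μ] [IsProbabilityMeasure ν] : tvDistance μ ν ≤ 1 :=
  tvDistance_le_of_forall_le (fun _ _ => prob_le_one.trans le_add_self)
    fun _ _ => prob_le_one.trans le_add_self

theorem lintegral_coupling_fst {S : Type*} [MeasurableSpace S] {μ ν : Measure S}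
    {γ : Measure (S × S)} (h : IsCoupling μ ν γ) {f : S → ℝ≥0∞} (hf : Measurable f) :
    ∫⁻ z, f z.1 ∂γ = ∫⁻ x, f x ∂μ := by
  rw [← h.1, lintegral_map hf measurable_fst]

theorem lintegral_coupling_snd {S : Type*} [MeasurableSpace S] {μ ν : Measure S}
    {γ : Measure (S × S)} (h : IsCoupling μ ν γ) {f : S → ℝ≥0∞} (hf : Measurable f) :
    ∫⁻ z, f z.2 ∂γ = ∫⁻ x, f x ∂ν := by
  rw [← h.2, lintegral_map hf measurable_snd]

/-- One more step of the chain turns the cost of a coupling into a total variation bound. -/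
theorem exists_tvDistance_bind_acKernel_le {y : Fin n → Bool} {c : ℝ} (h : WrongSideBound X y c)
    (hc0 : 0 ≤ c) (hc : c ≤ 4) (hS : (precision X Q).PosDef) (hQ : Q.PosSemidef) :
    ∃ C : ℝ≥0, ∀ (μ ν : Measure (EuclideanSpace ℝ (Fin p))) [IsProbabilityMeasure μ]
      [IsProbabilityMeasure ν] (γ), IsCoupling μ ν γ →
      tvDistance (μ.bind (acKernel X y Q v)) (ν.bind (acKernel X y Q v)) ≤
        C * ∫⁻ z, ENNReal.ofReal (sigmaDist (precision X Q) z.1 z.2) ∂γ := by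
  obtain ⟨C, hC⟩ := exists_acKernel_le (v := v) h hc0 hc hS hQ
  refine ⟨C, fun μ ν _ _ γ hγ => ?_⟩
  have hψ : Measurable fun w : EuclideanSpace ℝ (Fin p) × EuclideanSpace ℝ (Fin p) =>
      ENNReal.ofReal (sigmaDist (precision X Q) w.1 w.2) :=
    (continuous_sigmaDist _).measurable.ennreal_ofReal
  refine tvDistance_le_of_forall_le (fun s hs => ?_) fun s hs => ?_
  · rw [Measure.bind_apply hs (Kernel.aemeasurable _), Measure.bind_apply hs
      (Kernel.aemeasurable _), ← lintegral_coupling_fst hγ (Kernel.measurable_coe _ hs),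
      ← lintegral_coupling_snd hγ (Kernel.measurable_coe _ hs), ← lintegral_const_mul _ hψ,
      ← lintegral_add_right _ (hψ.const_mul _)]
    exact lintegral_mono fun z => hC _ _ s hs
  · rw [Measure.bind_apply hs (Kernel.aemeasurable _), Measure.bind_apply hs
      (Kernel.aemeasurable _), ← lintegral_coupling_fst hγ (Kernel.measurable_coe _ hs),
      ← lintegral_coupling_snd hγ (Kernel.measurable_coe _ hs), ← lintegral_const_mul _ hψ,
      ← lintegral_add_right _ (hψ.const_mul _)]
    refine lintegral_mono fun z => ?_
    simp only
    rw [sigmaDist_comm]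
    exact hC _ _ s hs

end SecondStep

section Posterior

variable {n p : ℕ}

/-! ### Invariance of the posterior distribution -/

/-- The joint density of the coefficients and the latent variables, up to a constant. -/
def jointDensity (X : Matrix (Fin n) (Fin p) ℝ) (y : Fin n → Bool) (Q : Matrix (Fin p) (Fin p) ℝ)
    (v β : EuclideanSpace ℝ (Fin p)) (z : Fin n → ℝ) : ℝ :=
  (∏ i, (halfLine (y i)).indicator (gaussianPDFReal ((X *ᵥ WithLp.ofLp β) i) 1) (z i)) *
    Real.exp (-(1 / 2) * (WithLp.ofLp (β - v) ⬝ᵥ Q *ᵥ WithLp.ofLp (β - v)))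

theorem gaussianReal_real_halfLine (μ : ℝ) (a : Bool) :
    (gaussianReal μ 1).real (halfLine a) =
      if a then stdNormalCdf μ else 1 - stdNormalCdf μ := by
  cases a
  · have h : gaussianReal μ 1 = (gaussianReal (-μ) 1).map (fun x => -x) := by
      rw [gaussianReal_map_neg, neg_neg]
    rw [h, map_measureReal_apply measurable_neg (measurableSet_halfLine _)]
    simp [halfLine, gaussianReal_real_Ioi, stdNormalCdf_neg]
  · simp [halfLine, gaussianReal_real_Ioi]

theorem smul_truncatedNormal (μ : ℝ) (a : Bool) :
    ENNReal.ofReal (if a then stdNormalCdf μ else 1 - stdNormalCdf μ) • truncatedNormal μ a =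
      volume.withDensity fun t =>
        ENNReal.ofReal ((halfLine a).indicator (gaussianPDFReal μ 1) t) := by
  rw [← gaussianReal_real_halfLine, ofReal_measureReal, truncatedNormal, ProbabilityTheory.cond,
    smul_smul, ENNReal.mul_inv_cancel (gaussianReal_halfLine_ne_zero μ a) (measure_ne_top _ _),
    one_smul, gaussianReal_of_var_ne_zero μ one_ne_zero,
    restrict_withDensity (measurableSet_halfLine a), ← withDensity_indicator
    (measurableSet_halfLine a)]
  congr 1
  ext t
  by_cases ht : t ∈ halfLine a
  · simp [ht, gaussianPDF]
  · simp [ht]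

variable (X : Matrix (Fin n) (Fin p) ℝ) (y : Fin n → Bool) (Q : Matrix (Fin p) (Fin p) ℝ)
  (v : EuclideanSpace ℝ (Fin p))

/-- The normalizing constants of the truncated normals are exactly the Bernoulli factors of the
posterior weight, so they cancel. This identifies the first step as sampling from a conditional law
of the joint density. -/
theorem smul_latentKernel (β : EuclideanSpace ℝ (Fin p)) :
    ENNReal.ofReal (posteriorWeight X y Q v β) • latentKernel X y β =
      volume.withDensity fun z => ENNReal.ofReal (jointDensity X y Q v β z) := by
  have hw : ∀ i, 0 ≤ if y i then stdNormalCdf ((X *ᵥ WithLp.ofLp β) i)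
      else 1 - stdNormalCdf ((X *ᵥ WithLp.ofLp β) i) := fun i => by
    rw [← gaussianReal_real_halfLine]; exact measureReal_nonneg
  have hI0 : ∀ i t, 0 ≤ (halfLine (y i)).indicator
      (gaussianPDFReal ((X *ᵥ WithLp.ofLp β) i) 1) t := fun i t =>
    Set.indicator_nonneg (fun x _ => gaussianPDFReal_nonneg _ _ _) t
  have hI : ∀ i, Integrable ((halfLine (y i)).indicator
      (gaussianPDFReal ((X *ᵥ WithLp.ofLp β) i) 1)) := fun i =>
    (integrable_gaussianPDFReal _ _).indicator (measurableSet_halfLine _)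
  have h1 := pi_withDensity_ofReal hI hI0
  simp only [← smul_truncatedNormal] at h1
  have h2 : Measure.pi (fun i => ENNReal.ofReal (if y i then stdNormalCdf ((X *ᵥ WithLp.ofLp β) i)
      else 1 - stdNormalCdf ((X *ᵥ WithLp.ofLp β) i)) •
        truncatedNormal ((X *ᵥ WithLp.ofLp β) i) (y i)) =
      ENNReal.ofReal (∏ i, if y i then stdNormalCdf ((X *ᵥ WithLp.ofLp β) i)
      else 1 - stdNormalCdf ((X *ᵥ WithLp.ofLp β) i)) • latentKernel X y β := by
    have hfin : ∀ i, IsFiniteMeasure (ENNReal.ofReal (if y i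
        then stdNormalCdf ((X *ᵥ WithLp.ofLp β) i)
        else 1 - stdNormalCdf ((X *ᵥ WithLp.ofLp β) i)) •
        truncatedNormal ((X *ᵥ WithLp.ofLp β) i) (y i)) := fun i =>
      Measure.smul_finite _ ENNReal.ofReal_ne_top
    refine Measure.pi_eq fun s hs => ?_
    simp only [Measure.smul_apply, smul_eq_mul, Finset.prod_mul_distrib]
    rw [ENNReal.ofReal_prod_of_nonneg fun i _ => hw i]
    congr 1
    exact Measure.pi_pi _ _
  have he := (Real.exp_pos (-(1 / 2) * (WithLp.ofLp (β - v) ⬝ᵥ Q *ᵥ WithLp.ofLp (β - v)))).le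
  rw [posteriorWeight, ENNReal.ofReal_mul (Finset.prod_nonneg fun i _ => hw i), mul_comm,
    ← smul_smul, ← h2, h1, ← withDensity_smul' _ _ ENNReal.ofReal_ne_top]
  congr 1
  ext z
  rw [Pi.smul_apply, smul_eq_mul, ← ENNReal.ofReal_mul he, mul_comm]
  rfl

variable {X y Q v}

/-- Completing the square in β: the conditional mean m solves Σm = Xᵀz + Qv, and the remainder
depends on z only. -/
theorem quadratic_identity (hS : (precision X Q).PosDef) (hQ : Q.PosSemidef)
    (β : EuclideanSpace ℝ (Fin p)) (z : Fin n → ℝ) :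
    WithLp.ofLp (β - v) ⬝ᵥ Q *ᵥ WithLp.ofLp (β - v) +
        ∑ i, (z i - (X *ᵥ WithLp.ofLp β) i) ^ 2 =
      WithLp.ofLp (β - coefficientMean X Q v z) ⬝ᵥ precision X Q *ᵥ
        WithLp.ofLp (β - coefficientMean X Q v z) +
      (WithLp.ofLp v ⬝ᵥ Q *ᵥ WithLp.ofLp v + ∑ i, z i ^ 2 -
        WithLp.ofLp (coefficientMean X Q v z) ⬝ᵥ precision X Q *ᵥ
          WithLp.ofLp (coefficientMean X Q v z)) := by
  have hsymm : ∀ {A : Matrix (Fin p) (Fin p) ℝ}, A.IsHermitian → ∀ a b : Fin p → ℝ,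
      a ⬝ᵥ A *ᵥ b = b ⬝ᵥ A *ᵥ a := by
    intro A hA a b
    have hA' : Aᵀ = A := by simpa [Matrix.IsHermitian] using hA
    rw [Matrix.dotProduct_mulVec, ← Matrix.mulVec_transpose, hA', dotProduct_comm]
  set b := WithLp.ofLp β
  set m := WithLp.ofLp (coefficientMean X Q v z) with hm
  set w := WithLp.ofLp v
  have hSm : precision X Q *ᵥ m = Xᵀ *ᵥ z + Q *ᵥ w := by
    rw [hm, coefficientMean, Matrix.mulVec_mulVec, Matrix.mul_nonsing_inv _
        ((Matrix.isUnit_iff_isUnit_det _).1 hS.isUnit), Matrix.one_mulVec]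
  have hbX : b ⬝ᵥ Xᵀ *ᵥ z = ∑ i, (X *ᵥ b) i * z i := by
    rw [Matrix.dotProduct_mulVec, Matrix.vecMul_transpose]; rfl
  have e1 : ∑ i, (z i - (X *ᵥ b) i) ^ 2 =
      ∑ i, z i ^ 2 - 2 * ∑ i, (X *ᵥ b) i * z i + ∑ i, (X *ᵥ b) i ^ 2 := by
    rw [Finset.mul_sum, ← Finset.sum_sub_distrib, ← Finset.sum_add_distrib]
    exact Finset.sum_congr rfl fun i _ => by ring
  have e2 : b ⬝ᵥ precision X Q *ᵥ m = ∑ i, (X *ᵥ b) i * z i + b ⬝ᵥ Q *ᵥ w := by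
    rw [hSm, dotProduct_add, hbX]
  have e3 := dotProduct_precision_mulVec (X := X) (Q := Q) b
  have s1 := hsymm hS.isHermitian m b
  have s2 := hsymm hQ.isHermitian w b
  simp only [WithLp.ofLp_sub, Matrix.mulVec_sub, dotProduct_sub, sub_dotProduct]
  linarith

/-- Completing the square exhibits the second step as sampling from the conditional law of β given
z; the truncation indicators and the z-only remainder are collected in J. -/
theorem exists_jointDensity_eq (hS : (precision X Q).PosDef) (hQ : Q.PosSemidef) :
    ∃ J : (Fin n → ℝ) → ℝ, Measurable J ∧ (∀ z, 0 ≤ J z) ∧ ∀ β z, jointDensity X y Q v β z =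
      J z * Real.exp (-(1 / 2) * (WithLp.ofLp (β - coefficientMean X Q v z) ⬝ᵥ
        precision X Q *ᵥ WithLp.ofLp (β - coefficientMean X Q v z))) := by
  set R : (Fin n → ℝ) → ℝ := fun z => WithLp.ofLp v ⬝ᵥ Q *ᵥ WithLp.ofLp v + ∑ i, z i ^ 2 -
    WithLp.ofLp (coefficientMean X Q v z) ⬝ᵥ precision X Q *ᵥ
      WithLp.ofLp (coefficientMean X Q v z) with hR
  have hRm : Measurable R := by
    have h1 := continuous_coefficientMean X Q v
    have h2 : Continuous R := by
      simp only [hR, Matrix.mulVec, dotProduct]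
      fun_prop
    exact h2.measurable
  refine ⟨fun z => (∏ i, (halfLine (y i)).indicator (fun _ => (√(2 * Real.pi))⁻¹) (z i)) *
    Real.exp (-(1 / 2) * R z), ?_, ?_, ?_⟩
  · refine Measurable.mul (Finset.measurable_prod _ fun i _ => ?_) (by fun_prop)
    exact (measurable_const.indicator (measurableSet_halfLine _)).comp (measurable_pi_apply i)
  · intro z
    refine mul_nonneg (Finset.prod_nonneg fun i _ => ?_) (Real.exp_pos _).le
    exact Set.indicator_nonneg (fun _ _ => by positivity) _
  · intro β z
    have h1 : ∀ i, (halfLine (y i)).indicator (gaussianPDFReal ((X *ᵥ WithLp.ofLp β) i) 1) (z i) =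
        (halfLine (y i)).indicator (fun _ => (√(2 * Real.pi))⁻¹) (z i) *
          Real.exp (-(1 / 2) * (z i - (X *ᵥ WithLp.ofLp β) i) ^ 2) := by
      intro i
      by_cases hz : z i ∈ halfLine (y i)
      · rw [Set.indicator_of_mem hz, Set.indicator_of_mem hz, gaussianPDFReal_eq_stdNormalPdf,
          stdNormalPdf_eq]
        congr 2
        ring
      · rw [Set.indicator_of_notMem hz, Set.indicator_of_notMem hz, zero_mul]
    have hid := quadratic_identity (v := v) hS hQ β z
    rw [jointDensity, Finset.prod_congr rfl fun i _ => h1 i, Finset.prod_mul_distrib,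
      ← Real.exp_sum, ← Finset.mul_sum, mul_assoc, mul_assoc, ← Real.exp_add, ← Real.exp_add]
    congr 2
    linarith

theorem measurable_posteriorWeight : Measurable (posteriorWeight X y Q v) := by
  have h : Continuous (posteriorWeight X y Q v) := by
    have h1 := continuous_stdNormalCdf
    have h2 := continuous_mulVec_apply X
    refine Continuous.mul (continuous_finsetProd _ fun i _ => ?_) ?_
    · split_ifs
      · exact h1.comp (h2 i)
      · exact continuous_const.sub (h1.comp (h2 i))
    · simp only [Matrix.mulVec, dotProduct]
      fun_prop
  exact h.measurable

/-- Invariance for data augmentation: if `j` is a joint density of `(a, b)` with first marginal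
density `w`, if `L` is the conditional law of `b` given `a`, and `N` that of `a` given `b`, then the
first marginal is invariant under `N ∘ₖ L`. -/
theorem bind_comp_eq_of_jointDensity {A B : Type*} [MeasurableSpace A] [MeasurableSpace B]
    {μ : Measure A} {ν : Measure B} [SFinite μ] [SFinite ν] {w : A → ℝ≥0∞} (hw : Measurable w)
    {j : A → B → ℝ≥0∞} (hj : Measurable (Function.uncurry j)) {d : B → ℝ≥0∞}
    (L : Kernel A B) [IsMarkovKernel L] (N : Kernel B A) [IsMarkovKernel N]
    (hL : ∀ a, w a • L a = ν.withDensity (j a))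
    (hN : ∀ b s, MeasurableSet s → ∫⁻ a in s, j a b ∂μ = d b * N b s) :
    (μ.withDensity w).bind (N ∘ₖ L) = μ.withDensity w := by
  have hja : ∀ a, Measurable (j a) := fun a => hj.comp measurable_prodMk_left
  have hjb : ∀ b, Measurable fun a => j a b := fun b => hj.comp measurable_prodMk_right
  have hlat : ∀ a (f : B → ℝ≥0∞), Measurable f →
      w a * ∫⁻ b, f b ∂L a = ∫⁻ b, j a b * f b ∂ν := by
    intro a f hf
    rw [← smul_eq_mul, ← lintegral_smul_measure, hL,
      lintegral_withDensity_eq_lintegral_mul _ (hja a) hf]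
    rfl
  ext s hs
  have hNs : Measurable fun b => N b s := Kernel.measurable_coe _ hs
  have hK : Measurable fun a => (N ∘ₖ L) a s := Kernel.measurable_coe _ hs
  rw [Measure.bind_apply hs (Kernel.aemeasurable _),
    lintegral_withDensity_eq_lintegral_mul _ hw hK]
  have e1 : ∀ a, (w * fun a => (N ∘ₖ L) a s) a = ∫⁻ b, j a b * N b s ∂ν := by
    intro a
    rw [← hlat a _ hNs, Pi.mul_apply, Kernel.comp_apply' _ _ _ hs]
  have e2 : ∀ b, ∫⁻ a, j a b * N b s ∂μ = ∫⁻ a in s, j a b ∂μ := by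
    intro b
    -- Taking the whole space shows that d is the marginal density of b.
    have h1 := hN b Set.univ .univ
    rw [Measure.restrict_univ, measure_univ, mul_one] at h1
    rw [lintegral_mul_const _ (hjb b), h1, hN b s hs]
  have hm : Measurable (Function.uncurry fun a b => j a b * N b s) :=
    hj.mul (hNs.comp measurable_snd)
  rw [lintegral_congr e1, lintegral_lintegral_swap hm.aemeasurable, lintegral_congr e2,
    ← lintegral_lintegral_swap hj.aemeasurable, withDensity_apply _ hs]
  refine lintegral_congr fun a => ?_
  simpa using (hlat a (fun _ => 1) measurable_const).symm

/-- The unnormalized posterior is invariant under the Albert–Chib chain. -/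
theorem bind_unnormalizedPosterior (hS : (precision X Q).PosDef) (hQ : Q.PosSemidef) :
    (unnormalizedPosterior X y Q v).bind (acKernel X y Q v) = unnormalizedPosterior X y Q v := by
  obtain ⟨κ, hκ, hN⟩ := exists_coefficientKernel_eq_withDensity (v := v) hS
  obtain ⟨J, hJm, hJ0, hJ⟩ := exists_jointDensity_eq (y := y) (v := v) hS hQ
  have hgm : Measurable fun w : EuclideanSpace ℝ (Fin p) × (Fin n → ℝ) =>
      Real.exp (-(1 / 2) * (WithLp.ofLp (w.1 - coefficientMean X Q v w.2) ⬝ᵥ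
        precision X Q *ᵥ WithLp.ofLp (w.1 - coefficientMean X Q v w.2))) := by
    have h1 := continuous_coefficientMean X Q v
    refine Continuous.measurable ?_
    simp only [Matrix.mulVec, dotProduct]
    fun_prop
  have hjm : Measurable (Function.uncurry fun β z =>
      ENNReal.ofReal (jointDensity X y Q v β z)) := by
    have h2 : (Function.uncurry fun β z => ENNReal.ofReal (jointDensity X y Q v β z)) =
        fun w : EuclideanSpace ℝ (Fin p) × (Fin n → ℝ) => ENNReal.ofReal (J w.2 *
          Real.exp (-(1 / 2) * (WithLp.ofLp (w.1 - coefficientMean X Q v w.2) ⬝ᵥ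
            precision X Q *ᵥ WithLp.ofLp (w.1 - coefficientMean X Q v w.2)))) :=
      funext fun w => congrArg ENNReal.ofReal (hJ w.1 w.2)
    rw [h2]
    exact ((hJm.comp measurable_snd).mul hgm).ennreal_ofReal
  -- The marginal density of z is J/κ, as κ normalizes the Gaussian factor.
  refine bind_comp_eq_of_jointDensity measurable_posteriorWeight.ennreal_ofReal hjm
    (d := fun z => ENNReal.ofReal (J z / κ)) (latentKernel X y) (coefficientKernel X Q v)
    (smul_latentKernel X y Q v) fun z s hs => ?_
  have hgz : Measurable fun b => ENNReal.ofReal (κ * Real.exp (-(1 / 2) *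
      (WithLp.ofLp (b - coefficientMean X Q v z) ⬝ᵥ
        precision X Q *ᵥ WithLp.ofLp (b - coefficientMean X Q v z)))) := by
    refine (Continuous.measurable ?_).ennreal_ofReal
    simp only [Matrix.mulVec, dotProduct]
    fun_prop
  rw [hN z, withDensity_apply _ hs, ← lintegral_const_mul _ hgz]
  refine lintegral_congr fun β => ?_
  rw [hJ, ← ENNReal.ofReal_mul (div_nonneg (hJ0 z) hκ.le)]
  congr 1
  field_simp

/-! ### Propriety of the posterior distribution -/

theorem posteriorWeight_pos (β : EuclideanSpace ℝ (Fin p)) : 0 < posteriorWeight X y Q v β := by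
  refine mul_pos (Finset.prod_pos fun i _ => ?_) (Real.exp_pos _)
  split_ifs
  · exact stdNormalCdf_pos _
  · exact sub_pos.2 (stdNormalCdf_lt_one _)

/-- A wrong-side factor is a Gaussian tail; any other factor is bounded by 1. -/
theorem bernoulliFactor_le (a : Bool) (t : ℝ) :
    (if a then stdNormalCdf t else 1 - stdNormalCdf t) ≤
      Real.exp (-(1 / 2) * (t ^ 2 * wrongSide a t)) := by
  cases a
  · simp only [wrongSide, Bool.false_eq_true, if_false]
    split_ifs with h
    · have := stdNormalCdf_le_exp (neg_nonpos.2 h)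
      rw [stdNormalCdf_neg] at this
      refine this.trans_eq ?_
      congr 1; ring
    · simpa using (stdNormalCdf_pos t).le
  · simp only [wrongSide, if_true]
    split_ifs with h
    · refine (stdNormalCdf_le_exp h).trans_eq ?_
      congr 1; ring
    · simpa using (stdNormalCdf_lt_one t).le

/-- The tail bounds of the wrong-side observations multiply to a Gaussian in their share of |Xβ|²,
so the decay needs no help from the prior and holds also for Q = 0. -/
theorem posteriorWeight_le {c l : ℝ} (h : WrongSideBound X y c) (hc : 0 ≤ c) (hQ : Q.PosSemidef)
    (hl : ∀ a : EuclideanSpace ℝ (Fin p), l * ‖a‖ ^ 2 ≤ ∑ i, (X *ᵥ WithLp.ofLp a) i ^ 2)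
    (β : EuclideanSpace ℝ (Fin p)) :
    posteriorWeight X y Q v β ≤ Real.exp (-(c * l / 2) * ‖β‖ ^ 2) := by
  have h1 : ∏ i, (if y i then stdNormalCdf ((X *ᵥ WithLp.ofLp β) i)
      else 1 - stdNormalCdf ((X *ᵥ WithLp.ofLp β) i)) ≤
      ∏ i, Real.exp (-(1 / 2) * ((X *ᵥ WithLp.ofLp β) i ^ 2 *
        wrongSide (y i) ((X *ᵥ WithLp.ofLp β) i))) := by
    refine Finset.prod_le_prod (fun i _ => ?_) fun i _ => bernoulliFactor_le _ _
    split_ifs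
    · exact (stdNormalCdf_pos _).le
    · exact (sub_pos.2 (stdNormalCdf_lt_one _)).le
  have h2 : Real.exp (-(1 / 2) * (WithLp.ofLp (β - v) ⬝ᵥ Q *ᵥ WithLp.ofLp (β - v))) ≤ 1 := by
    rw [Real.exp_le_one_iff]
    linarith [dotProduct_mulVec_nonneg' hQ (WithLp.ofLp (β - v))]
  rw [← Real.exp_sum, ← Finset.mul_sum] at h1
  calc posteriorWeight X y Q v β ≤ _ * 1 :=
        mul_le_mul h1 h2 (Real.exp_pos _).le (Real.exp_pos _).le
    _ ≤ _ := by
        rw [mul_one, Real.exp_le_exp]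
        -- State and direction coincide here: the wrong-side observations at β carry a fraction c of
        -- |Xβ|² itself.
        have h3 := h (WithLp.ofLp β) (WithLp.ofLp β)
        have h4 := mul_le_mul_of_nonneg_left (hl β) hc
        linarith

theorem sigmaDist_le (S : Matrix (Fin p) (Fin p) ℝ) (b b' : EuclideanSpace ℝ (Fin p)) :
    sigmaDist S b b' ≤ √‖Matrix.toEuclideanCLM (𝕜 := ℝ) S‖ * (‖b‖ + ‖b'‖) := by
  set T := Matrix.toEuclideanCLM (𝕜 := ℝ) S with hT
  have h1 : WithLp.ofLp (b - b') ⬝ᵥ S *ᵥ WithLp.ofLp (b - b') ≤ ‖T‖ * ‖b - b'‖ ^ 2 := by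
    rw [← Matrix.inner_toEuclideanCLM]
    refine (real_inner_le_norm _ _).trans ?_
    have := T.le_opNorm (b - b')
    nlinarith [norm_nonneg (b - b')]
  refine (Real.sqrt_le_sqrt h1).trans ?_
  rw [Real.sqrt_mul (norm_nonneg _), Real.sqrt_sq (norm_nonneg _)]
  exact mul_le_mul_of_nonneg_left (norm_sub_le _ _) (Real.sqrt_nonneg _)

/-- The affine integrand covers two uses: A = 1 dominates the total mass and gives propriety, and a
larger A dominates the Σ-distance from a fixed state. -/
theorem lintegral_unnormalizedPosterior_lt_top {c l : ℝ} (h : WrongSideBound X y c) (hc : 0 < c)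
    (hQ : Q.PosSemidef) (hl0 : 0 < l)
    (hl : ∀ a : EuclideanSpace ℝ (Fin p), l * ‖a‖ ^ 2 ≤ ∑ i, (X *ᵥ WithLp.ofLp a) i ^ 2)
    {A : ℝ} (hA : 0 ≤ A) :
    ∫⁻ b, ENNReal.ofReal (A + A * ‖b‖) ∂unnormalizedPosterior X y Q v < ∞ := by
  have hb : 0 < c * l / 2 := by positivity
  have hint : Integrable fun x : EuclideanSpace ℝ (Fin p) =>
      A * Real.exp (-(c * l / 2) * ‖x‖ ^ 2) + A * (‖x‖ * Real.exp (-(c * l / 2) * ‖x‖ ^ 2)) :=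
    ((integrable_exp_neg_mul_norm_sq hb).const_mul A).add
      ((integrable_norm_mul_exp_neg_mul_norm_sq hb).const_mul A)
  rw [unnormalizedPosterior, lintegral_withDensity_eq_lintegral_mul _
    measurable_posteriorWeight.ennreal_ofReal (by fun_prop)]
  refine lt_of_le_of_lt (lintegral_mono fun b => ?_) hint.lintegral_lt_top
  rw [Pi.mul_apply, ← ENNReal.ofReal_mul (posteriorWeight_pos b).le]
  refine ENNReal.ofReal_le_ofReal ?_
  have h1 := posteriorWeight_le (v := v) h hc.le hQ hl b
  have h2 : 0 ≤ A + A * ‖b‖ := by positivity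
  have h3 := mul_le_mul_of_nonneg_right h1 h2
  linarith

/-! ### Convergence rates -/

/-- The convergence rates of the Albert–Chib chain under a wrong-side bound. -/
theorem rates_le_of_wrongSideBound {c l : ℝ} (h : WrongSideBound X y c) (hc : 0 < c) (hc1 : c ≤ 1)
    (hQ : Q.PosSemidef) (hl0 : 0 < l)
    (hl : ∀ a : EuclideanSpace ℝ (Fin p), l * ‖a‖ ^ 2 ≤ ∑ i, (X *ᵥ WithLp.ofLp a) i ^ 2) :
    (precision X Q).PosDef ∧ PosteriorProper X y Q v ∧
      rateWasserstein X y Q v ≤ √(1 - c / 4) ∧ rateTV X y Q v ≤ √(1 - c / 4) := by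
  have hS : (precision X Q).PosDef := by
    refine Matrix.PosDef.of_dotProduct_mulVec_pos ?_ fun a ha => ?_
    · have h1 : (Xᵀ * X).IsHermitian := by
        simpa using Matrix.isHermitian_conjTranspose_mul_self X
      exact h1.add hQ.isHermitian
    · have h2 := hl (WithLp.toLp 2 a)
      have h3 : 0 < ‖WithLp.toLp 2 a‖ := norm_pos_iff.2 (by simpa using ha)
      have h4 := sum_sq_mulVec_le (X := X) hQ a
      have h5 : 0 < l * ‖WithLp.toLp 2 a‖ ^ 2 := by positivity
      simp only [star_trivial]
      linarith
  have hproper : PosteriorProper X y Q v := by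
    have h1 := lintegral_unnormalizedPosterior_lt_top (v := v) h hc hQ hl0 hl zero_le_one
    refine lt_of_le_of_lt ?_ h1
    rw [← lintegral_one]
    refine lintegral_mono fun b => ?_
    rw [ENNReal.one_le_ofReal]
    linarith [norm_nonneg b]
  have hne : unnormalizedPosterior X y Q v Set.univ ≠ 0 := by
    intro h0
    rw [Measure.measure_univ_eq_zero, unnormalizedPosterior, withDensity_eq_zero_iff
      measurable_posteriorWeight.ennreal_ofReal.aemeasurable] at h0
    obtain ⟨b, hb⟩ := h0.exists
    exact (ENNReal.ofReal_pos.2 (posteriorWeight_pos b)).ne' hb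
  have hprob : IsProbabilityMeasure (posterior X y Q v) := by
    constructor
    rw [posterior, Measure.smul_apply, smul_eq_mul, ENNReal.inv_mul_cancel hne hproper.ne]
  have hinv : (posterior X y Q v).bind (acKernel X y Q v) = posterior X y Q v := by
    rw [posterior, Measure.bind_smul, bind_unnormalizedPosterior hS hQ]
  set S := precision X Q with hSdef
  have hcost : ∀ β, ∫⁻ b, ENNReal.ofReal (sigmaDist S β b) ∂posterior X y Q v < ∞ := by
    intro β
    -- Chosen so that ‖β‖ + ‖b‖ ≤ (1 + ‖β‖)(1 + ‖b‖) puts the distance below A + A‖b‖.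
    set A := √‖Matrix.toEuclideanCLM (𝕜 := ℝ) S‖ * (1 + ‖β‖) with hA
    have hA0 : 0 ≤ A := by positivity
    rw [posterior, lintegral_smul_measure]
    refine ENNReal.mul_lt_top (ENNReal.inv_lt_top.2 (pos_iff_ne_zero.2 hne)) ?_
    refine lt_of_le_of_lt (lintegral_mono fun b => ENNReal.ofReal_le_ofReal ?_)
      (lintegral_unnormalizedPosterior_lt_top (v := v) h hc hQ hl0 hl hA0)
    refine (sigmaDist_le S β b).trans ?_
    have := Real.sqrt_nonneg ‖Matrix.toEuclideanCLM (𝕜 := ℝ) S‖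
    have e : A + A * ‖b‖ = √‖Matrix.toEuclideanCLM (𝕜 := ℝ) S‖ * ((1 + ‖β‖) * (1 + ‖b‖)) := by
      rw [hA]; ring
    rw [e]
    refine mul_le_mul_of_nonneg_left ?_ this
    nlinarith [norm_nonneg b, norm_nonneg β, mul_nonneg (norm_nonneg β) (norm_nonneg b)]
  set r := √(1 - c / 4) with hr
  have hr0 : 0 < r := Real.sqrt_pos.2 (by linarith)
  have hr1 : r < 1 := by rw [hr, Real.sqrt_lt' one_pos]; linarith
  have hbdd : ∀ (D : Measure (EuclideanSpace ℝ (Fin p)) → Measure (EuclideanSpace ℝ (Fin p)) → ℝ≥0∞)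
      (K : Kernel (EuclideanSpace ℝ (Fin p)) (EuclideanSpace ℝ (Fin p)))
      (π : Measure (EuclideanSpace ℝ (Fin p))), GeometricBound D K π r →
      convergenceRate D K π ≤ r := by
    intro D K π hgb
    refine csInf_le ⟨0, ?_⟩ (Set.mem_insert_of_mem _ ⟨hr0.le, hr1, hgb⟩)
    rintro ρ (rfl | hρ)
    · exact zero_le_one
    · exact hρ.1
  have hcoup := fun m β => exists_coupling_pow_acKernel h (by linarith) hS hQ hinv m β
  refine ⟨hS, hproper, hbdd _ _ _ ?_, hbdd _ _ _ ?_⟩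
  · refine ⟨fun β => (∫⁻ b, ENNReal.ofReal (sigmaDist S β b) ∂posterior X y Q v).toNNReal,
      fun m β => ?_⟩
    rw [ENNReal.coe_toNNReal (hcost β).ne]
    obtain ⟨γ, hγ, hle⟩ := hcoup m β
    exact (iInf₂_le γ hγ).trans hle
  · obtain ⟨C, hC⟩ := exists_tvDistance_bind_acKernel_le (v := v) h hc.le (by linarith) hS hQ
    have hpow : ∀ m β, IsProbabilityMeasure ((acKernel X y Q v ^ m) β) := by
      intro m β
      obtain ⟨γ, ⟨h1, h2⟩, -⟩ := hcoup m β
      have hγ : IsProbabilityMeasure γ := by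
        constructor
        rw [← Set.preimage_univ (f := Prod.snd), ← Measure.map_apply measurable_snd .univ, h2]
        exact measure_univ
      rw [← h1]
      exact Measure.isProbabilityMeasure_map measurable_fst.aemeasurable
    -- The summand 1 covers m = 0, where no smoothing step is available; for m + 1 the coupling
    -- bound has only the power m, and the factor 1/r restores the missing one.
    refine ⟨fun β => 1 + C *
      (∫⁻ b, ENNReal.ofReal (sigmaDist S β b) ∂posterior X y Q v).toNNReal * (r.toNNReal)⁻¹,
      fun m β => ?_⟩
    have hrn : r.toNNReal ≠ 0 := by simpa using hr0
    push_cast [ENNReal.coe_inv hrn]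
    rw [ENNReal.coe_toNNReal (hcost β).ne]
    cases m with
    | zero =>
      have := hpow 0 β
      rw [pow_zero (ENNReal.ofReal r), mul_one]
      exact (tvDistance_le_one _ _).trans le_self_add
    | succ m =>
      obtain ⟨γ, hγ, hle⟩ := hcoup m β
      have := hpow m β
      have h1 := hC _ _ γ hγ
      have h2 : ((acKernel X y Q v ^ m) β).bind (acKernel X y Q v) =
          (acKernel X y Q v ^ (m + 1)) β := by
        ext s hs
        rw [Measure.bind_apply hs (Kernel.aemeasurable _),
          Kernel.pow_succ_apply_eq_lintegral _ _ _ hs]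
      rw [hinv, h2] at h1
      refine (h1.trans (mul_le_mul_right hle _)).trans ?_
      set M := ∫⁻ b, ENNReal.ofReal (sigmaDist S β b) ∂posterior X y Q v
      have h3 : (ENNReal.ofReal r)⁻¹ * ENNReal.ofReal r = 1 :=
        ENNReal.inv_mul_cancel (ENNReal.ofReal_pos.2 hr0).ne' ENNReal.ofReal_ne_top
      calc (C : ℝ≥0∞) * (M * ENNReal.ofReal r ^ m)
          = (C * M * (ENNReal.ofReal r)⁻¹) * ENNReal.ofReal r ^ (m + 1) := by
            rw [pow_succ, mul_assoc (C * M : ℝ≥0∞), mul_comm (ENNReal.ofReal r ^ m),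
              ← mul_assoc (ENNReal.ofReal r)⁻¹, h3, one_mul, mul_assoc]
        _ ≤ _ := mul_le_mul_left le_add_self _

end Posterior

section Moments

variable {p : ℕ} {Ω : Type*} [MeasurableSpace Ω]

/-! ### Smallest eigenvalues and moment matrices -/

section

open scoped MatrixOrder

theorem lambdaMin_mul_le {A : Matrix (Fin p) (Fin p) ℝ} (hA : A.IsHermitian) (a : Fin p → ℝ) :
    lambdaMin A * (a ⬝ᵥ a) ≤ a ⬝ᵥ A *ᵥ a := by
  have hsa : IsSelfAdjoint A := hA
  have h : algebraMap ℝ (Matrix (Fin p) (Fin p) ℝ) (lambdaMin A) ≤ A := by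
    rw [algebraMap_le_iff_le_spectrum hsa]
    exact fun t ht => csInf_le (Matrix.finite_real_spectrum).bddBelow ht
  have h2 := (Matrix.le_iff.1 h).dotProduct_mulVec_nonneg a
  rw [Matrix.sub_mulVec, dotProduct_sub, Algebra.algebraMap_eq_smul_one, Matrix.smul_mulVec,
    Matrix.one_mulVec, dotProduct_smul] at h2
  simpa using h2

theorem posDef_of_lambdaMin_pos {A : Matrix (Fin p) (Fin p) ℝ} (hA : A.IsHermitian)
    (h : 0 < lambdaMin A) : A.PosDef := by
  refine Matrix.PosDef.of_dotProduct_mulVec_pos hA fun a ha => ?_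
  have h1 := lambdaMin_mul_le hA a
  have h2 : 0 < a ⬝ᵥ a := by simpa using Matrix.dotProduct_star_self_pos_iff.2 ha
  simp only [star_trivial]
  nlinarith [mul_pos h h2]

/-- Testing the eigenvalue bound on A^{1/2}a undoes the normalization by A^{-1/2} on both sides. -/
theorem mul_dotProduct_le_of_lt_lambdaMin {A B : Matrix (Fin p) (Fin p) ℝ} (hA : A.PosDef)
    (hB : B.IsHermitian) {l : ℝ} (h : l < lambdaMin (invSqrt A * B * invSqrt A)) (a : Fin p → ℝ) :
    l * (a ⬝ᵥ A *ᵥ a) ≤ a ⬝ᵥ B *ᵥ a := by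
  set S := CFC.sqrt A with hS
  have hSS : S * S = A := CFC.sqrt_mul_sqrt_self _ hA.posSemidef.nonneg
  have hSt : Sᵀ = S := transpose_sqrt A
  have hdet : IsUnit S.det := by
    have h1 : IsUnit (S * S).det := by
      rw [hSS]; exact (Matrix.isUnit_iff_isUnit_det _).1 hA.isUnit
    rw [Matrix.det_mul] at h1
    exact isUnit_of_mul_isUnit_left h1
  have hit : (S⁻¹)ᵀ = S⁻¹ := by rw [Matrix.transpose_nonsing_inv, hSt]
  have hBt : Bᵀ = B := by simpa [Matrix.IsHermitian] using hB
  have hN : (S⁻¹ * B * S⁻¹).IsHermitian := by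
    rw [Matrix.IsHermitian, Matrix.conjTranspose_eq_transpose_of_trivial, Matrix.transpose_mul,
      Matrix.transpose_mul, hit, hBt, mul_assoc]
  have h1 := lambdaMin_mul_le hN (S *ᵥ a)
  have e1 : (S *ᵥ a) ⬝ᵥ (S *ᵥ a) = a ⬝ᵥ A *ᵥ a := by
    rw [Matrix.dotProduct_mulVec, ← Matrix.mulVec_transpose, hSt, Matrix.mulVec_mulVec, hSS,
      dotProduct_comm]
  have e2 : (S *ᵥ a) ⬝ᵥ (S⁻¹ * B * S⁻¹) *ᵥ (S *ᵥ a) = a ⬝ᵥ B *ᵥ a := by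
    rw [Matrix.mulVec_mulVec, mul_assoc, mul_assoc, Matrix.nonsing_inv_mul _ hdet, mul_one,
      dotProduct_comm, Matrix.dotProduct_mulVec, ← Matrix.mulVec_transpose, hSt,
      Matrix.mulVec_mulVec, ← mul_assoc, Matrix.mul_nonsing_inv _ hdet, one_mul, dotProduct_comm]
  have e3 : 0 ≤ a ⬝ᵥ A *ᵥ a := dotProduct_mulVec_nonneg' hA.posSemidef a
  rw [e1, e2] at h1
  exact (mul_le_mul_of_nonneg_right h.le e3).trans h1

end

theorem inner_eq_sum (x a : EuclideanSpace ℝ (Fin p)) : inner ℝ x a = ∑ j, x j * a j := by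
  simp [PiLp.inner_apply, mul_comm]

theorem sq_inner_eq_sum (x a : EuclideanSpace ℝ (Fin p)) :
    inner ℝ x a ^ 2 = ∑ j, ∑ k, a j * a k * (x j * x k) := by
  rw [inner_eq_sum, sq, Finset.sum_mul_sum]
  exact Finset.sum_congr rfl fun j _ => Finset.sum_congr rfl fun k _ => by ring

theorem abs_apply_le_norm (x : EuclideanSpace ℝ (Fin p)) (j : Fin p) : |x j| ≤ ‖x‖ := by
  simpa using PiLp.norm_apply_le x j

theorem sq_inner_le (x a : EuclideanSpace ℝ (Fin p)) : inner ℝ x a ^ 2 ≤ ‖x‖ ^ 2 * ‖a‖ ^ 2 := by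
  rw [← mul_pow, ← sq_abs]
  exact pow_le_pow_left₀ (abs_nonneg _) (abs_real_inner_le_norm x a) 2

variable {P : Measure Ω} {ξ : Ω → EuclideanSpace ℝ (Fin p)}

theorem integrable_mul_mul_of_abs_le_one (hξ : Measurable ξ)
    (hint : Integrable (fun ω => ‖ξ ω‖ ^ 2) P) {g : Ω → ℝ} (hg : Measurable g)
    (hg1 : ∀ ω, |g ω| ≤ 1) (j k : Fin p) : Integrable (fun ω => ξ ω j * ξ ω k * g ω) P := by
  have hm : ∀ j, Measurable fun ω => ξ ω j := fun j =>
    (EuclideanSpace.proj (𝕜 := ℝ) j).continuous.measurable.comp hξ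
  refine hint.mono (((hm j).mul (hm k)).mul hg).aestronglyMeasurable (ae_of_all _ fun ω => ?_)
  rw [Real.norm_of_nonneg (sq_nonneg ‖ξ ω‖), Real.norm_eq_abs, abs_mul, abs_mul, sq]
  have h1 : |ξ ω j| * |ξ ω k| ≤ ‖ξ ω‖ * ‖ξ ω‖ :=
    mul_le_mul (abs_apply_le_norm _ _) (abs_apply_le_norm _ _) (abs_nonneg _) (norm_nonneg _)
  calc |ξ ω j| * |ξ ω k| * |g ω| ≤ ‖ξ ω‖ * ‖ξ ω‖ * 1 :=
        mul_le_mul h1 (hg1 ω) (abs_nonneg _) (by positivity)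
    _ = _ := mul_one _

theorem integrable_sq_inner_mul (hξ : Measurable ξ)
    (hint : Integrable (fun ω => ‖ξ ω‖ ^ 2) P) {g : Ω → ℝ} (hg : Measurable g)
    (hg1 : ∀ ω, |g ω| ≤ 1) (a : EuclideanSpace ℝ (Fin p)) :
    Integrable (fun ω => inner ℝ (ξ ω) a ^ 2 * g ω) P := by
  have h := fun j k => (integrable_mul_mul_of_abs_le_one hξ hint hg hg1 j k).const_mul (a j * a k)
  refine (integrable_finsetSum Finset.univ fun j _ => integrable_finsetSum Finset.univ
    fun k _ => h j k).congr (ae_of_all _ fun ω => ?_)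
  simp only [sq_inner_eq_sum, Finset.sum_mul, mul_assoc]

theorem sum_sum_mul_integral (hξ : Measurable ξ)
    (hint : Integrable (fun ω => ‖ξ ω‖ ^ 2) P) {g : Ω → ℝ} (hg : Measurable g)
    (hg1 : ∀ ω, |g ω| ≤ 1) (a : EuclideanSpace ℝ (Fin p)) :
    ∑ j, ∑ k, a j * a k * ∫ ω, ξ ω j * ξ ω k * g ω ∂P = ∫ ω, inner ℝ (ξ ω) a ^ 2 * g ω ∂P := by
  have h := fun j k => (integrable_mul_mul_of_abs_le_one hξ hint hg hg1 j k).const_mul (a j * a k)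
  simp only [sq_inner_eq_sum, Finset.sum_mul, mul_assoc]
  simp only [mul_assoc] at h
  rw [integral_finsetSum _ fun j _ => integrable_finsetSum _ fun k _ => h j k]
  refine Finset.sum_congr rfl fun j _ => ?_
  rw [integral_finsetSum _ fun k _ => h j k]
  refine Finset.sum_congr rfl fun k _ => ?_
  rw [integral_const_mul, integral_const_mul]

theorem dotProduct_momentMatrix (hξ : Measurable ξ) (hint : Integrable (fun ω => ‖ξ ω‖ ^ 2) P)
    {w : EuclideanSpace ℝ (Fin p) → ℝ} (hw : Measurable w) (hw1 : ∀ u, |w u| ≤ 1)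
    (a : EuclideanSpace ℝ (Fin p)) :
    WithLp.ofLp a ⬝ᵥ momentMatrix P ξ w *ᵥ WithLp.ofLp a =
      ∫ ω, inner ℝ (ξ ω) a ^ 2 * w (ξ ω) ∂P := by
  rw [← sum_sum_mul_integral (g := fun ω => w (ξ ω)) hξ hint (hw.comp hξ) (fun ω => hw1 (ξ ω)) a]
  simp only [dotProduct, Matrix.mulVec, Finset.mul_sum, momentMatrix, Matrix.of_apply]
  exact Finset.sum_congr rfl fun j _ => Finset.sum_congr rfl fun k _ => by ring

theorem isHermitian_momentMatrix (w : EuclideanSpace ℝ (Fin p) → ℝ) :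
    (momentMatrix P ξ w).IsHermitian := by
  ext j k
  simp [momentMatrix, mul_comm (ξ _ j)]

variable {G : ℝ → ℝ} {βstar : EuclideanSpace ℝ (Fin p)}

theorem abs_barG_le_one (hG : ∀ t, 0 < G t ∧ G t < 1) (t : ℝ) : |barG G t| ≤ 1 := by
  have h := hG t
  rw [abs_le, barG]
  constructor
  · exact le_min (by linarith) (by linarith)
  · exact (min_le_left _ _).trans h.2.le

theorem measurable_barG (hG : Measurable G) : Measurable (barG G) := hG.min (hG.const_sub 1)

/-- The quadratic form of the second moments is bounded below. -/
theorem lambdaMin_mul_norm_sq_le (hξ : Measurable ξ) (h1 : CondB1 P ξ)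
    (a : EuclideanSpace ℝ (Fin p)) :
    lambdaMin (momentMatrix P ξ fun _ => 1) * ‖a‖ ^ 2 ≤ ∫ ω, inner ℝ (ξ ω) a ^ 2 ∂P := by
  have h := lambdaMin_mul_le (isHermitian_momentMatrix (P := P) (ξ := ξ) fun _ => 1)
    (WithLp.ofLp a)
  rw [dotProduct_momentMatrix hξ h1.1 measurable_const (by simp)] at h
  rw [EuclideanSpace.norm_sq_eq]
  simpa [dotProduct, sq] using h

theorem mul_integral_sq_inner_le (hξ : Measurable ξ) (hGm : Measurable G)
    (hG : ∀ t, 0 < G t ∧ G t < 1) (h1 : CondB1 P ξ) {l : ℝ} (h4 : CondB4 P G βstar ξ l)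
    (a : EuclideanSpace ℝ (Fin p)) :
    l * ∫ ω, inner ℝ (ξ ω) a ^ 2 ∂P ≤
      ∫ ω, inner ℝ (ξ ω) a ^ 2 * barG G (inner ℝ (ξ ω) βstar) ∂P := by
  have hM := posDef_of_lambdaMin_pos (isHermitian_momentMatrix (P := P) (ξ := ξ) fun _ => 1) h1.2
  have h := mul_dotProduct_le_of_lt_lambdaMin hM (isHermitian_momentMatrix _) h4 (WithLp.ofLp a)
  rw [dotProduct_momentMatrix hξ h1.1 measurable_const (by simp),
    dotProduct_momentMatrix (w := fun u => barG G (inner ℝ u βstar)) hξ h1.1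
      ((measurable_barG hGm).comp (by fun_prop)) fun u => abs_barG_le_one hG _] at h
  simpa using h

/-- Uniformly over directions, little of the second moment is carried by nearly orthogonal
vectors. -/
theorem exists_integral_norm_sq_indicator_le [IsProbabilityMeasure P] (hξ : Measurable ξ)
    (h2 : CondB2 P ξ) (h3 : CondB3 P ξ) {η : ℝ} (hη : 0 < η) :
    ∃ ε : ℝ, 0 < ε ∧ ∀ γ : EuclideanSpace ℝ (Fin p), γ ≠ 0 →
      ∫ ω, {ω | |inner ℝ (ξ ω) γ| ≤ ε * ‖ξ ω‖ * ‖γ‖}.indicator (fun ω => ‖ξ ω‖ ^ 2) ω ∂P ≤ η := by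
  set m := ∫ ω, ‖ξ ω‖ ^ 4 ∂P with hm
  have hm0 : 0 ≤ m := integral_nonneg fun ω => by positivity
  -- A weighted arithmetic-geometric inequality with weight t replaces Cauchy-Schwarz: on A, ‖ξ‖² ≤
  -- (t/2)‖ξ‖⁴ + 1/(2t). With tm ≤ η and P(A) ≤ ηt each term contributes at most η/2.
  set t := η / (m + 1) with ht
  have ht0 : 0 < t := by positivity
  have hev := h3.eventually (gt_mem_nhds (ENNReal.ofReal_pos.2 (mul_pos hη ht0)))
  obtain ⟨ε, hε, hε0⟩ := (hev.and self_mem_nhdsWithin).exists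
  refine ⟨ε, hε0, fun γ hγ => ?_⟩
  set A := {ω | |inner ℝ (ξ ω) γ| ≤ ε * ‖ξ ω‖ * ‖γ‖} with hA
  have hAm : MeasurableSet A := measurableSet_le (by fun_prop) (by fun_prop)
  have hPA : P.real A ≤ η * t := by
    have h5 : P A ≤ ENNReal.ofReal (η * t) :=
      (le_iSup₂ (f := fun (α : EuclideanSpace ℝ (Fin p)) (_ : α ≠ 0) =>
        P {ω | |inner ℝ (ξ ω) α| ≤ ε * ‖ξ ω‖ * ‖α‖}) γ hγ).trans hε.le
    exact ENNReal.toReal_le_of_le_ofReal (by positivity) h5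
  have hi : Integrable (A.indicator fun _ => (1 : ℝ)) P :=
    (integrable_const (1 : ℝ)).indicator hAm
  have hle : ∀ ω, A.indicator (fun ω => ‖ξ ω‖ ^ 2) ω ≤
      t / 2 * ‖ξ ω‖ ^ 4 + (2 * t)⁻¹ * A.indicator (fun _ => (1 : ℝ)) ω := by
    intro ω
    by_cases hω : ω ∈ A
    · rw [Set.indicator_of_mem hω, Set.indicator_of_mem hω, mul_one]
      have h6 : t / 2 * ‖ξ ω‖ ^ 4 + (2 * t)⁻¹ - ‖ξ ω‖ ^ 2 =
          (2 * t)⁻¹ * (t * ‖ξ ω‖ ^ 2 - 1) ^ 2 := by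
        field_simp
        ring
      have h7 : 0 ≤ (2 * t)⁻¹ * (t * ‖ξ ω‖ ^ 2 - 1) ^ 2 := by positivity
      linarith
    · rw [Set.indicator_of_notMem hω, Set.indicator_of_notMem hω]
      positivity
  have hi2 : Integrable (fun ω => t / 2 * ‖ξ ω‖ ^ 4 + (2 * t)⁻¹ * A.indicator (fun _ => (1 : ℝ)) ω)
      P := (Integrable.const_mul h2 _).add (hi.const_mul _)
  calc _ ≤ ∫ ω, (t / 2 * ‖ξ ω‖ ^ 4 + (2 * t)⁻¹ * A.indicator (fun _ => (1 : ℝ)) ω) ∂P :=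
        integral_mono_of_nonneg (ae_of_all _ fun ω => Set.indicator_nonneg
          (fun _ _ => sq_nonneg _) ω) hi2 (ae_of_all _ hle)
    _ = t / 2 * m + (2 * t)⁻¹ * P.real A := by
        rw [integral_add (Integrable.const_mul h2 _) (hi.const_mul _), integral_const_mul,
          integral_const_mul, integral_indicator_const _ hAm, smul_eq_mul, mul_one]
    _ ≤ t / 2 * m + (2 * t)⁻¹ * (η * t) := by gcongr
    _ ≤ η := by
        have h8 : t * m ≤ η := by
          rw [ht, div_mul_eq_mul_div, div_le_iff₀ (by positivity)]
          nlinarith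
        have h9 : (2 * t)⁻¹ * (η * t) = η / 2 := by field_simp
        rw [h9]
        linarith

end Moments

section Data

variable {p : ℕ} {Ω : Type*} [MeasurableSpace Ω] {P : Measure Ω}
  {G : ℝ → ℝ} {βstar : EuclideanSpace ℝ (Fin p)} {x : ℕ → Ω → EuclideanSpace ℝ (Fin p)}
  {y : ℕ → Ω → Bool}

/-! ### Independence of the observations -/

theorem IsDataMechanism.measurable_x_comap (_hd : IsDataMechanism P G βstar x y) (i : ℕ) :
    Measurable[MeasurableSpace.comap (fun ω i => x i ω) MeasurableSpace.pi] (x i) :=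
  (measurable_pi_apply i).comp (comap_measurable (fun ω i => x i ω))

theorem IsDataMechanism.measurable_pair (hd : IsDataMechanism P G βstar x y) (i : ℕ) :
    Measurable fun ω => (x i ω, y i ω) := (hd.measurable_x i).prodMk (hd.measurable_y i)

variable [IsProbabilityMeasure P]

/-- Integrating out the responses given the design. -/
theorem IsDataMechanism.integral_mul_indicator (hd : IsDataMechanism P G βstar x y) {φ : Ω → ℝ}
    (hφ : StronglyMeasurable[MeasurableSpace.comap (fun ω i => x i ω) MeasurableSpace.pi] φ)
    (hint : Integrable φ P) (s : Finset ℕ) (a : ℕ → Bool) :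
    ∫ ω, φ ω * {ω | ∀ i ∈ s, y i ω = a i}.indicator (fun _ => (1 : ℝ)) ω ∂P =
      ∫ ω, φ ω * ∏ i ∈ s, bernoulliWeight (G (inner ℝ (x i ω) βstar)) (a i) ∂P := by
  have hm : MeasurableSpace.comap (fun ω i => x i ω) MeasurableSpace.pi ≤ ‹MeasurableSpace Ω› :=
    (measurable_pi_lambda _ hd.measurable_x).comap_le
  have hE : MeasurableSet {ω | ∀ i ∈ s, y i ω = a i} := by
    have : {ω | ∀ i ∈ s, y i ω = a i} = ⋂ i ∈ s, y i ⁻¹' {a i} := by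
      ext ω; simp
    rw [this]
    exact Finset.measurableSet_biInter s fun i _ => hd.measurable_y i (measurableSet_singleton _)
  have hi1 : Integrable ({ω | ∀ i ∈ s, y i ω = a i}.indicator fun _ => (1 : ℝ)) P :=
    (integrable_const 1).indicator hE
  have hi2 : Integrable (φ * {ω | ∀ i ∈ s, y i ω = a i}.indicator fun _ => (1 : ℝ)) P := by
    refine hint.mono (hint.aestronglyMeasurable.mul hi1.aestronglyMeasurable)
      (ae_of_all _ fun ω => ?_)
    rw [Pi.mul_apply, norm_mul]
    refine mul_le_of_le_one_right (norm_nonneg _) ?_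
    by_cases hω : ω ∈ {ω | ∀ i ∈ s, y i ω = a i}
    · rw [Set.indicator_of_mem hω, norm_one]
    · rw [Set.indicator_of_notMem hω, norm_zero]; exact zero_le_one
  have h1 := condExp_mul_of_stronglyMeasurable_left hφ hi2 hi1
  have h2 := integral_condExp hm (μ := P)
    (f := φ * {ω | ∀ i ∈ s, y i ω = a i}.indicator fun _ => (1 : ℝ))
  rw [integral_congr_ae h1] at h2
  refine h2.symm.trans (integral_congr_ae ?_)
  filter_upwards [hd.cond_y s a] with ω hω
  rw [Pi.mul_apply, hω]

/-- The conditional mean of `f (x, y)` given `x = u`. -/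
def condMean (G : ℝ → ℝ) (βstar : EuclideanSpace ℝ (Fin p))
    (f : EuclideanSpace ℝ (Fin p) × Bool → ℝ) (u : EuclideanSpace ℝ (Fin p)) : ℝ :=
  ∑ a, f (u, a) * bernoulliWeight (G (inner ℝ u βstar)) a

theorem measurable_bernoulliWeight (hG : Measurable G) (a : Bool) :
    Measurable fun u : EuclideanSpace ℝ (Fin p) =>
      bernoulliWeight (G (inner ℝ u βstar)) a := by
  have h : Measurable fun u : EuclideanSpace ℝ (Fin p) => G (inner ℝ u βstar) :=
    hG.comp (by fun_prop)
  cases a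
  · simpa [bernoulliWeight] using h.const_sub 1
  · simpa [bernoulliWeight] using h

theorem abs_bernoulliWeight_le (hG : ∀ t, 0 < G t ∧ G t < 1) (t : ℝ) (a : Bool) :
    |bernoulliWeight (G t) a| ≤ 1 := by
  have := hG t
  rw [abs_le]
  cases a <;> simp only [bernoulliWeight, if_true, Bool.false_eq_true, if_false] <;>
    constructor <;> linarith

theorem measurable_condMean (hG : Measurable G) {f : EuclideanSpace ℝ (Fin p) × Bool → ℝ}
    (hf : Measurable f) : Measurable (condMean G βstar f) :=
  Finset.measurable_sum _ fun a _ =>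
    (hf.comp (measurable_id.prodMk measurable_const)).mul (measurable_bernoulliWeight hG a)

/-- The integrand is split over the two values of the response, and each indicator is replaced by
its conditional probability given the design. -/
theorem IsDataMechanism.integral_comp_eq (hd : IsDataMechanism P G βstar x y)
    (hGm : Measurable G) (hG : ∀ t, 0 < G t ∧ G t < 1)
    {f : EuclideanSpace ℝ (Fin p) × Bool → ℝ} (hf : Measurable f) (i : ℕ)
    (hint : ∀ a, Integrable (fun ω => f (x i ω, a)) P) :
    ∫ ω, f (x i ω, y i ω) ∂P = ∫ ω, condMean G βstar f (x i ω) ∂P := by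
  have hsm : ∀ a, StronglyMeasurable[MeasurableSpace.comap (fun ω i => x i ω) MeasurableSpace.pi]
      fun ω => f (x i ω, a) := fun a =>
    ((hf.comp (measurable_id.prodMk measurable_const)).comp
      (hd.measurable_x_comap i)).stronglyMeasurable
  have h := fun a => hd.integral_mul_indicator (hsm a) (hint a) {i} fun _ => a
  simp only [Finset.mem_singleton, forall_eq, Finset.prod_singleton] at h
  have hE : ∀ a, MeasurableSet {ω | y i ω = a} := fun a =>
    hd.measurable_y i (measurableSet_singleton a)
  have hi : ∀ a, Integrable (fun ω => f (x i ω, a) *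
      {ω | y i ω = a}.indicator (fun _ => (1 : ℝ)) ω) P := fun a => by
    refine ((hint a).indicator (hE a)).congr (ae_of_all _ fun ω => ?_)
    by_cases hω : ω ∈ {ω | y i ω = a}
    · simp only [Set.indicator_of_mem hω, mul_one]
    · simp only [Set.indicator_of_notMem hω, mul_zero]
  have hi2 : ∀ a, Integrable (fun ω => f (x i ω, a) *
      bernoulliWeight (G (inner ℝ (x i ω) βstar)) a) P := fun a =>
    (hint a).mul_bdd (c := 1) ((measurable_bernoulliWeight hGm a).comp
      (hd.measurable_x i)).aestronglyMeasurable
      (ae_of_all _ fun ω => abs_bernoulliWeight_le hG _ a)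
  have e1 : ∀ ω, f (x i ω, y i ω) = ∑ a, f (x i ω, a) *
      {ω | y i ω = a}.indicator (fun _ => (1 : ℝ)) ω := by
    intro ω
    rw [Finset.sum_eq_single (y i ω)]
    · simp
    · intro a _ ha
      rw [Set.indicator_of_notMem (fun h => ha h.symm), mul_zero]
    · simp
  simp only [e1, condMean]
  rw [integral_finsetSum _ fun a _ => hi a, integral_finsetSum _ fun a _ => hi2 a]
  exact Finset.sum_congr rfl fun a _ => h a

theorem IsDataMechanism.integral_comp_mul_comp_eq (hd : IsDataMechanism P G βstar x y)
    (hGm : Measurable G) (hG : ∀ t, 0 < G t ∧ G t < 1)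
    {f g : EuclideanSpace ℝ (Fin p) × Bool → ℝ} (hf : Measurable f) (hg : Measurable g)
    (hf1 : ∀ w, |f w| ≤ 1) (hg1 : ∀ w, |g w| ≤ 1) {i j : ℕ} (hij : i ≠ j) :
    ∫ ω, f (x i ω, y i ω) * g (x j ω, y j ω) ∂P =
      ∫ ω, condMean G βstar f (x i ω) * condMean G βstar g (x j ω) ∂P := by
  have hsm : ∀ a b, Measurable[MeasurableSpace.comap (fun ω i => x i ω) MeasurableSpace.pi]
      fun ω => f (x i ω, a) * g (x j ω, b) := fun a b =>
    ((hf.comp (measurable_id.prodMk measurable_const)).comp (hd.measurable_x_comap i)).mul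
      ((hg.comp (measurable_id.prodMk measurable_const)).comp (hd.measurable_x_comap j))
  have hm : MeasurableSpace.comap (fun ω i => x i ω) MeasurableSpace.pi ≤ ‹MeasurableSpace Ω› :=
    (measurable_pi_lambda _ hd.measurable_x).comap_le
  have hb : ∀ a b ω, ‖f (x i ω, a) * g (x j ω, b)‖ ≤ 1 := fun a b ω => by
    rw [norm_mul]
    exact mul_le_one₀ (hf1 _) (norm_nonneg _) (hg1 _)
  have hint : ∀ a b, Integrable (fun ω => f (x i ω, a) * g (x j ω, b)) P := fun a b =>
    Integrable.of_bound ((hsm a b).mono hm le_rfl).aestronglyMeasurable 1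
      (ae_of_all _ (hb a b))
  have h := fun a b => hd.integral_mul_indicator (hsm a b).stronglyMeasurable (hint a b) {i, j}
    fun k => if k = i then a else b
  simp only [Finset.mem_insert, Finset.mem_singleton, forall_eq_or_imp, forall_eq,
    Finset.prod_pair hij, if_true, if_neg hij.symm] at h
  have hE : ∀ a b, MeasurableSet {ω | y i ω = a ∧ y j ω = b} := fun a b =>
    (hd.measurable_y i (measurableSet_singleton a)).inter
      (hd.measurable_y j (measurableSet_singleton b))
  have hi : ∀ a b, Integrable (fun ω => f (x i ω, a) * g (x j ω, b) *
      {ω | y i ω = a ∧ y j ω = b}.indicator (fun _ => (1 : ℝ)) ω) P := fun a b => by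
    refine ((hint a b).indicator (hE a b)).congr (ae_of_all _ fun ω => ?_)
    by_cases hω : ω ∈ {ω | y i ω = a ∧ y j ω = b}
    · simp only [Set.indicator_of_mem hω, mul_one]
    · simp only [Set.indicator_of_notMem hω, mul_zero]
  have hi2 : ∀ a b, Integrable (fun ω => f (x i ω, a) * g (x j ω, b) *
      (bernoulliWeight (G (inner ℝ (x i ω) βstar)) a *
        bernoulliWeight (G (inner ℝ (x j ω) βstar)) b)) P := fun a b =>
    (hint a b).mul_bdd (c := 1) (((measurable_bernoulliWeight hGm a).comp
      (hd.measurable_x i)).mul ((measurable_bernoulliWeight hGm b).comp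
      (hd.measurable_x j))).aestronglyMeasurable
      (ae_of_all _ fun ω => by
        rw [norm_mul]
        exact mul_le_one₀ (abs_bernoulliWeight_le hG _ a) (norm_nonneg _)
          (abs_bernoulliWeight_le hG _ b))
  have e1 : ∀ ω, f (x i ω, y i ω) * g (x j ω, y j ω) = ∑ a, ∑ b, f (x i ω, a) * g (x j ω, b) *
      {ω | y i ω = a ∧ y j ω = b}.indicator (fun _ => (1 : ℝ)) ω := by
    intro ω
    rw [Finset.sum_eq_single (y i ω), Finset.sum_eq_single (y j ω)]
    · simp
    · intro b _ hb
      rw [Set.indicator_of_notMem (fun h => hb h.2.symm), mul_zero]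
    · simp
    · intro a _ ha
      refine Finset.sum_eq_zero fun b _ => ?_
      rw [Set.indicator_of_notMem (fun h => ha h.1.symm), mul_zero]
    · simp
  have e2 : ∀ ω, condMean G βstar f (x i ω) * condMean G βstar g (x j ω) =
      ∑ a, ∑ b, f (x i ω, a) * g (x j ω, b) *
        (bernoulliWeight (G (inner ℝ (x i ω) βstar)) a *
          bernoulliWeight (G (inner ℝ (x j ω) βstar)) b) := by
    intro ω
    rw [condMean, condMean, Finset.sum_mul_sum]
    exact Finset.sum_congr rfl fun a _ => Finset.sum_congr rfl fun b _ => by ring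
  simp only [e1, e2]
  rw [integral_finsetSum _ fun a _ => integrable_finsetSum _ fun b _ => hi a b,
    integral_finsetSum _ fun a _ => integrable_finsetSum _ fun b _ => hi2 a b]
  refine Finset.sum_congr rfl fun a _ => ?_
  rw [integral_finsetSum _ fun b _ => hi a b, integral_finsetSum _ fun b _ => hi2 a b]
  exact Finset.sum_congr rfl fun b _ => h a b

theorem abs_indicator_one_le {α : Type*} (S : Set α) (w : α) :
    |S.indicator (fun _ => (1 : ℝ)) w| ≤ 1 := by
  by_cases hw : w ∈ S <;> simp [hw]

theorem IsDataMechanism.measureReal_preimage_eq (hd : IsDataMechanism P G βstar x y)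
    (hGm : Measurable G) (hG : ∀ t, 0 < G t ∧ G t < 1)
    {S : Set (EuclideanSpace ℝ (Fin p) × Bool)} (hS : MeasurableSet S) (i : ℕ) :
    P.real ((fun ω => (x i ω, y i ω)) ⁻¹' S) =
      ∫ ω, condMean G βstar (S.indicator fun _ => 1) (x i ω) ∂P := by
  have hf : Measurable (S.indicator fun _ => (1 : ℝ)) := measurable_const.indicator hS
  rw [← hd.integral_comp_eq hGm hG hf i fun a => Integrable.of_bound
    ((hf.comp (measurable_id.prodMk measurable_const)).comp
      (hd.measurable_x i)).aestronglyMeasurable 1 (ae_of_all _ fun ω => abs_indicator_one_le _ _)]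
  rw [← integral_indicator_one (hd.measurable_pair i hS)]
  rfl

theorem IsDataMechanism.identDistrib_pair (hd : IsDataMechanism P G βstar x y)
    (hGm : Measurable G) (hG : ∀ t, 0 < G t ∧ G t < 1) (i : ℕ) :
    IdentDistrib (fun ω => (x i ω, y i ω)) (fun ω => (x 0 ω, y 0 ω)) P P := by
  refine ⟨(hd.measurable_pair i).aemeasurable, (hd.measurable_pair 0).aemeasurable, ?_⟩
  ext S hS
  rw [Measure.map_apply (hd.measurable_pair i) hS, Measure.map_apply (hd.measurable_pair 0) hS,
    ← ofReal_measureReal, ← ofReal_measureReal, hd.measureReal_preimage_eq hGm hG hS i,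
    hd.measureReal_preimage_eq hGm hG hS 0]
  congr 1
  exact ((hd.identDistrib_x i).comp
    (measurable_condMean hGm (measurable_const.indicator hS))).integral_eq

/-- After integrating out both responses, the joint probability is the expectation of a product of
functions of x_i and x_j, which factors. Pairwise independence is all that the strong law requires.
-/
theorem IsDataMechanism.indepFun_pair (hd : IsDataMechanism P G βstar x y)
    (hGm : Measurable G) (hG : ∀ t, 0 < G t ∧ G t < 1) {i j : ℕ} (hij : i ≠ j) :
    IndepFun (fun ω => (x i ω, y i ω)) (fun ω => (x j ω, y j ω)) P := by
  rw [indepFun_iff_measure_inter_preimage_eq_mul]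
  intro S T hS hT
  have hf : Measurable (S.indicator fun _ => (1 : ℝ)) := measurable_const.indicator hS
  have hg : Measurable (T.indicator fun _ => (1 : ℝ)) := measurable_const.indicator hT
  have h1 : P.real ((fun ω => (x i ω, y i ω)) ⁻¹' S ∩ (fun ω => (x j ω, y j ω)) ⁻¹' T) =
      ∫ ω, (S.indicator fun _ => (1 : ℝ)) (x i ω, y i ω) *
        (T.indicator fun _ => (1 : ℝ)) (x j ω, y j ω) ∂P := by
    rw [← integral_indicator_one ((hd.measurable_pair i hS).inter (hd.measurable_pair j hT)),
      Set.inter_indicator_one]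
    rfl
  have h2 := ((hd.indep_x.indepFun hij).comp (measurable_condMean (βstar := βstar) hGm hf)
    (measurable_condMean (βstar := βstar) hGm hg)).integral_fun_mul_eq_mul_integral
    ((measurable_condMean hGm hf).comp (hd.measurable_x i)).aestronglyMeasurable
    ((measurable_condMean hGm hg).comp (hd.measurable_x j)).aestronglyMeasurable
  simp only [Function.comp_apply] at h2
  rw [hd.integral_comp_mul_comp_eq hGm hG hf hg (abs_indicator_one_le S) (abs_indicator_one_le T)
    hij, h2, ← hd.measureReal_preimage_eq hGm hG hS, ← hd.measureReal_preimage_eq hGm hG hT] at h1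
  rw [← ofReal_measureReal, h1, ENNReal.ofReal_mul measureReal_nonneg, ofReal_measureReal,
    ofReal_measureReal]

/-- The strong law of large numbers for functions of the observations. -/
theorem IsDataMechanism.ae_tendsto_average (hd : IsDataMechanism P G βstar x y)
    (hGm : Measurable G) (hG : ∀ t, 0 < G t ∧ G t < 1)
    {f : EuclideanSpace ℝ (Fin p) × Bool → ℝ} (hf : Measurable f)
    (hint : Integrable (fun ω => f (x 0 ω, y 0 ω)) P) :
    ∀ᵐ ω ∂P, Tendsto (fun n : ℕ => (∑ i ∈ Finset.range n, f (x i ω, y i ω)) / n) atTop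
      (𝓝 (∫ ω, f (x 0 ω, y 0 ω) ∂P)) :=
  strong_law_ae_real (fun i ω => f (x i ω, y i ω)) hint
    (fun _ _ hij => (hd.indepFun_pair hGm hG hij).comp hf hf)
    fun i => (hd.identDistrib_pair hGm hG i).comp hf

/-! ### A margin version of the wrong-side indicator -/

/-- The indicator that the latent mean in the direction `γ` is on the wrong side of the truncation
point by the relative margin `ε`. -/
def marginWrongSide (ε : ℝ) (γ : EuclideanSpace ℝ (Fin p)) (w : EuclideanSpace ℝ (Fin p) × Bool) :
    ℝ :=
  if w.2 then {u : EuclideanSpace ℝ (Fin p) | inner ℝ u γ ≤ -(ε * ‖u‖)}.indicator (fun _ => 1) w.1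
  else {u : EuclideanSpace ℝ (Fin p) | ε * ‖u‖ ≤ inner ℝ u γ}.indicator (fun _ => 1) w.1

theorem measurable_marginWrongSide (ε : ℝ) (γ : EuclideanSpace ℝ (Fin p)) :
    Measurable (marginWrongSide ε γ) := by
  refine Measurable.ite (measurable_snd (measurableSet_singleton true)) ?_ ?_
  · exact (measurable_const.indicator
      (measurableSet_le (by fun_prop) (by fun_prop))).comp measurable_fst
  · exact (measurable_const.indicator
      (measurableSet_le (by fun_prop) (by fun_prop))).comp measurable_fst

theorem marginWrongSide_nonneg (ε : ℝ) (γ : EuclideanSpace ℝ (Fin p))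
    (w : EuclideanSpace ℝ (Fin p) × Bool) : 0 ≤ marginWrongSide ε γ w := by
  unfold marginWrongSide
  split_ifs
  · exact Set.indicator_nonneg (fun _ _ => zero_le_one) _
  · exact Set.indicator_nonneg (fun _ _ => zero_le_one) _

theorem abs_marginWrongSide_le (ε : ℝ) (γ : EuclideanSpace ℝ (Fin p))
    (w : EuclideanSpace ℝ (Fin p) × Bool) : |marginWrongSide ε γ w| ≤ 1 := by
  unfold marginWrongSide
  split_ifs
  · exact abs_indicator_one_le _ _
  · exact abs_indicator_one_le _ _

theorem wrongSide_nonneg (a : Bool) (t : ℝ) : 0 ≤ wrongSide a t := by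
  unfold wrongSide; split_ifs <;> norm_num

theorem wrongSide_zero (a : Bool) : wrongSide a 0 = 1 := by
  cases a <;> simp [wrongSide]

/-- Only the sign of the location matters, so states may be normalized to the unit sphere. -/
theorem wrongSide_mul {s : ℝ} (hs : 0 < s) (a : Bool) (t : ℝ) :
    wrongSide a (s * t) = wrongSide a t := by
  cases a
  · simp [wrongSide, mul_nonneg_iff_of_pos_left hs]
  · have : s * t ≤ 0 ↔ t ≤ 0 := by
      constructor
      · intro h
        by_contra ht
        exact absurd h (not_le.2 (mul_pos hs (not_le.1 ht)))
      · exact fun h => mul_nonpos_of_nonneg_of_nonpos hs.le h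
    simp [wrongSide, this]

/-- Moving the direction by ε changes the inner product with u by at most ε‖u‖, which is exactly the
margin. One net point γ thus bounds the indicator from below for all nearby states at once. -/
theorem marginWrongSide_le {ε : ℝ} {γ β : EuclideanSpace ℝ (Fin p)} (h : ‖β - γ‖ ≤ ε)
    (u : EuclideanSpace ℝ (Fin p)) (a : Bool) :
    marginWrongSide ε γ (u, a) ≤ wrongSide a (inner ℝ u β) := by
  have h1 : |inner ℝ u β - inner ℝ u γ| ≤ ε * ‖u‖ := by
    rw [← inner_sub_right]
    refine (abs_real_inner_le_norm _ _).trans ?_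
    rw [mul_comm]
    exact mul_le_mul_of_nonneg_right h (norm_nonneg _)
  rw [abs_le] at h1
  have h0 := wrongSide_nonneg a (inner ℝ u β)
  cases a
  · simp only [marginWrongSide, Bool.false_eq_true, if_false]
    by_cases hu : u ∈ {u : EuclideanSpace ℝ (Fin p) | ε * ‖u‖ ≤ inner ℝ u γ}
    · have hu' : ε * ‖u‖ ≤ inner ℝ u γ := hu
      have : 0 ≤ inner ℝ u β := by linarith
      rw [Set.indicator_of_mem hu]
      simp [wrongSide, this]
    · rwa [Set.indicator_of_notMem hu]
  · simp only [marginWrongSide, if_true]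
    by_cases hu : u ∈ {u : EuclideanSpace ℝ (Fin p) | inner ℝ u γ ≤ -(ε * ‖u‖)}
    · have hu' : inner ℝ u γ ≤ -(ε * ‖u‖) := hu
      have : inner ℝ u β ≤ 0 := by linarith
      rw [Set.indicator_of_mem hu]
      simp [wrongSide, this]
    · rwa [Set.indicator_of_notMem hu]

/-- Outside the slab, one of the two responses is wrong for γ with the required margin, and either
response has conditional probability at least Ḡ. Inside the slab the left side is nonpositive. -/
theorem barG_sub_indicator_le (hG : ∀ t, 0 < G t ∧ G t < 1) {ε : ℝ}
    {γ : EuclideanSpace ℝ (Fin p)} (hγ : ‖γ‖ = 1) (u : EuclideanSpace ℝ (Fin p)) :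
    barG G (inner ℝ u βstar) -
      {u : EuclideanSpace ℝ (Fin p) | |inner ℝ u γ| ≤ ε * ‖u‖ * ‖γ‖}.indicator (fun _ => 1) u ≤
      condMean G βstar (marginWrongSide ε γ) u := by
  have hG' := hG (inner ℝ u βstar)
  have hb1 : barG G (inner ℝ u βstar) ≤ G (inner ℝ u βstar) := min_le_left _ _
  have hb2 : barG G (inner ℝ u βstar) ≤ 1 - G (inner ℝ u βstar) := min_le_right _ _
  have n1 := marginWrongSide_nonneg ε γ (u, true)
  have n2 := marginWrongSide_nonneg ε γ (u, false)
  have e : condMean G βstar (marginWrongSide ε γ) u =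
      marginWrongSide ε γ (u, true) * G (inner ℝ u βstar) +
        marginWrongSide ε γ (u, false) * (1 - G (inner ℝ u βstar)) := by
    simp [condMean, bernoulliWeight]
  rw [e]
  by_cases hu : u ∈ {u : EuclideanSpace ℝ (Fin p) | |inner ℝ u γ| ≤ ε * ‖u‖ * ‖γ‖}
  · rw [Set.indicator_of_mem hu]
    nlinarith [mul_nonneg n1 hG'.1.le, mul_nonneg n2 (sub_nonneg.2 hG'.2.le)]
  · rw [Set.indicator_of_notMem hu, sub_zero]
    simp only [Set.mem_ofPred_eq, hγ, mul_one, not_le, lt_abs] at hu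
    rcases hu with hu | hu
    · have : marginWrongSide ε γ (u, false) = 1 := by
        simp [marginWrongSide, hu.le]
      rw [this]
      nlinarith [mul_nonneg n1 hG'.1.le]
    · have : marginWrongSide ε γ (u, true) = 1 := by
        have hu' : inner ℝ u γ ≤ -(ε * ‖u‖) := by linarith
        simp [marginWrongSide, hu']
      rw [this]
      nlinarith [mul_nonneg n2 (sub_nonneg.2 hG'.2.le)]

/-- The expected quadratic form of the observations on the wrong side with a margin. -/
theorem IsDataMechanism.le_integral_sq_inner_mul_marginWrongSide
    (hd : IsDataMechanism P G βstar x y) (hGm : Measurable G) (hG : ∀ t, 0 < G t ∧ G t < 1)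
    (h1 : CondB1 P (x 0)) {ε : ℝ} {γ : EuclideanSpace ℝ (Fin p)} (hγ : ‖γ‖ = 1)
    (a : EuclideanSpace ℝ (Fin p)) :
    ∫ ω, inner ℝ (x 0 ω) a ^ 2 * barG G (inner ℝ (x 0 ω) βstar) ∂P -
      (∫ ω, {ω | |inner ℝ (x 0 ω) γ| ≤ ε * ‖x 0 ω‖ * ‖γ‖}.indicator
        (fun ω => ‖x 0 ω‖ ^ 2) ω ∂P) * ‖a‖ ^ 2 ≤
    ∫ ω, inner ℝ (x 0 ω) a ^ 2 * marginWrongSide ε γ (x 0 ω, y 0 ω) ∂P := by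
  have hx := hd.measurable_x 0
  have hmw := measurable_marginWrongSide ε γ
  have hA : MeasurableSet {ω | |inner ℝ (x 0 ω) γ| ≤ ε * ‖x 0 ω‖ * ‖γ‖} :=
    measurableSet_le (by fun_prop) (by fun_prop)
  have hf : Measurable fun w : EuclideanSpace ℝ (Fin p) × Bool =>
      inner ℝ w.1 a ^ 2 * marginWrongSide ε γ w := by fun_prop
  have hint : ∀ b, Integrable (fun ω => inner ℝ (x 0 ω) a ^ 2 * marginWrongSide ε γ (x 0 ω, b)) P :=
    fun b => integrable_sq_inner_mul hx h1.1 (hmw.comp (hx.prodMk measurable_const))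
      (fun ω => abs_marginWrongSide_le _ _ _) a
  have e1 := hd.integral_comp_eq hGm hG hf 0 hint
  have e2 : ∀ u, condMean G βstar (fun w : EuclideanSpace ℝ (Fin p) × Bool =>
      inner ℝ w.1 a ^ 2 * marginWrongSide ε γ w) u =
      inner ℝ u a ^ 2 * condMean G βstar (marginWrongSide ε γ) u := by
    intro u
    simp only [condMean, Finset.mul_sum, mul_assoc]
  rw [e1]
  simp only [e2]
  have i1 : Integrable (fun ω => inner ℝ (x 0 ω) a ^ 2 * barG G (inner ℝ (x 0 ω) βstar)) P :=
    integrable_sq_inner_mul hx h1.1 ((measurable_barG hGm).comp (by fun_prop))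
      (fun ω => abs_barG_le_one hG _) a
  have i2 : Integrable (fun ω => {ω | |inner ℝ (x 0 ω) γ| ≤ ε * ‖x 0 ω‖ * ‖γ‖}.indicator
      (fun ω => ‖x 0 ω‖ ^ 2) ω * ‖a‖ ^ 2) P := (h1.1.indicator hA).mul_const _
  have i3 : Integrable (fun ω => inner ℝ (x 0 ω) a ^ 2 *
      condMean G βstar (marginWrongSide ε γ) (x 0 ω)) P := by
    have hcm : ∀ ω, condMean G βstar (marginWrongSide ε γ) (x 0 ω) =
        marginWrongSide ε γ (x 0 ω, true) * G (inner ℝ (x 0 ω) βstar) +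
          marginWrongSide ε γ (x 0 ω, false) * (1 - G (inner ℝ (x 0 ω) βstar)) := fun ω => by
      simp [condMean, bernoulliWeight]
    refine integrable_sq_inner_mul hx h1.1 ((measurable_condMean hGm hmw).comp hx) (fun ω => ?_) a
    rw [Function.comp_apply, hcm]
    have hG' := hG (inner ℝ (x 0 ω) βstar)
    have a1 := abs_le.1 (abs_marginWrongSide_le ε γ (x 0 ω, true))
    have a2 := abs_le.1 (abs_marginWrongSide_le ε γ (x 0 ω, false))
    rw [abs_le]
    constructor <;> nlinarith
  rw [← integral_mul_const, ← integral_sub i1 i2]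
  -- The pointwise bound is multiplied by (xᵀa)², which on the slab is at most ‖x‖²‖a‖².
  refine integral_mono (i1.sub i2) i3 fun ω => ?_
  have h2 := barG_sub_indicator_le (βstar := βstar) hG (ε := ε) hγ (x 0 ω)
  have h3 := mul_le_mul_of_nonneg_left h2 (sq_nonneg (inner ℝ (x 0 ω) a))
  have h4 := sq_inner_le (x 0 ω) a
  simp only
  by_cases hω : |inner ℝ (x 0 ω) γ| ≤ ε * ‖x 0 ω‖ * ‖γ‖
  · rw [Set.indicator_of_mem (show x 0 ω ∈ {u : EuclideanSpace ℝ (Fin p) |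
      |inner ℝ u γ| ≤ ε * ‖u‖ * ‖γ‖} from hω)] at h3
    rw [Set.indicator_of_mem (show ω ∈ {ω | |inner ℝ (x 0 ω) γ| ≤ ε * ‖x 0 ω‖ * ‖γ‖} from hω)]
    linarith
  · rw [Set.indicator_of_notMem (show x 0 ω ∉ {u : EuclideanSpace ℝ (Fin p) |
      |inner ℝ u γ| ≤ ε * ‖u‖ * ‖γ‖} from hω)] at h3
    rw [Set.indicator_of_notMem (show ω ∉ {ω | |inner ℝ (x 0 ω) γ| ≤ ε * ‖x 0 ω‖ * ‖γ‖} from hω)]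
    linarith

end Data

section Asymptotics

variable {p : ℕ}

/-! ### Uniform laws of large numbers -/

/-- A quadratic form is determined by finitely many entries, so entrywise convergence is uniform
over directions. -/
theorem eventually_abs_quadratic_sub_le {f : ℕ → Fin p → Fin p → ℝ} {M : Fin p → Fin p → ℝ}
    (h : ∀ j k, Tendsto (fun n => f n j k) atTop (𝓝 (M j k))) {η : ℝ} (hη : 0 < η) :
    ∀ᶠ n in atTop, ∀ a : EuclideanSpace ℝ (Fin p),
      |∑ j, ∑ k, a j * a k * f n j k - ∑ j, ∑ k, a j * a k * M j k| ≤ η * ‖a‖ ^ 2 := by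
  -- There are p² entries; the added 1 keeps the denominator positive for p = 0.
  have hδ : 0 < η / (p ^ 2 + 1 : ℝ) := by positivity
  have h1 : ∀ᶠ n in atTop, ∀ j k, |f n j k - M j k| < η / (p ^ 2 + 1 : ℝ) := by
    refine eventually_all.2 fun j => eventually_all.2 fun k => ?_
    exact (Metric.tendsto_nhds.1 (h j k)) _ hδ
  filter_upwards [h1] with n hn a
  rw [← Finset.sum_sub_distrib]
  simp only [← Finset.sum_sub_distrib, ← mul_sub]
  have h2 : ∀ j k, |a j * a k * (f n j k - M j k)| ≤ ‖a‖ ^ 2 * (η / (p ^ 2 + 1 : ℝ)) := by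
    intro j k
    rw [abs_mul, abs_mul, sq]
    exact mul_le_mul (mul_le_mul (abs_apply_le_norm a j) (abs_apply_le_norm a k) (abs_nonneg _)
      (norm_nonneg _)) (hn j k).le (abs_nonneg _) (by positivity)
  calc |∑ j, ∑ k, a j * a k * (f n j k - M j k)|
      ≤ ∑ j : Fin p, ∑ k : Fin p, ‖a‖ ^ 2 * (η / (p ^ 2 + 1 : ℝ)) :=
        (Finset.abs_sum_le_sum_abs _ _).trans (Finset.sum_le_sum fun j _ =>
          (Finset.abs_sum_le_sum_abs _ _).trans (Finset.sum_le_sum fun k _ => h2 j k))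
    _ = p ^ 2 / (p ^ 2 + 1 : ℝ) * (η * ‖a‖ ^ 2) := by
        simp only [Finset.sum_const, Finset.card_univ, Fintype.card_fin, nsmul_eq_mul]
        field_simp
    _ ≤ η * ‖a‖ ^ 2 := by
        refine mul_le_of_le_one_left (by positivity) ?_
        rw [div_le_one (by positivity)]
        linarith

variable {Ω : Type*} [MeasurableSpace Ω] {P : Measure Ω} [IsProbabilityMeasure P]
  {G : ℝ → ℝ} {βstar : EuclideanSpace ℝ (Fin p)} {x : ℕ → Ω → EuclideanSpace ℝ (Fin p)}
  {y : ℕ → Ω → Bool}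

/-- The strong law is applied to the p² entries only, so the exceptional null set depends neither on
the direction a nor on the tolerance η. -/
theorem IsDataMechanism.ae_eventually_abs_average_sub_le (hd : IsDataMechanism P G βstar x y)
    (hGm : Measurable G) (hG : ∀ t, 0 < G t ∧ G t < 1) (h1 : CondB1 P (x 0))
    {g : EuclideanSpace ℝ (Fin p) × Bool → ℝ} (hg : Measurable g) (hg1 : ∀ w, |g w| ≤ 1) :
    ∀ᵐ ω ∂P, ∀ η : ℝ, 0 < η → ∀ᶠ n : ℕ in atTop, ∀ a : EuclideanSpace ℝ (Fin p),
      |(∑ i ∈ Finset.range n, inner ℝ (x i ω) a ^ 2 * g (x i ω, y i ω)) / n -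
        ∫ ω, inner ℝ (x 0 ω) a ^ 2 * g (x 0 ω, y 0 ω) ∂P| ≤ η * ‖a‖ ^ 2 := by
  have hx := hd.measurable_x 0
  have hg0 : Measurable fun ω => g (x 0 ω, y 0 ω) := hg.comp (hd.measurable_pair 0)
  have hg01 : ∀ ω, |g (x 0 ω, y 0 ω)| ≤ 1 := fun ω => hg1 _
  have hlln : ∀ᵐ ω ∂P, ∀ j k : Fin p, Tendsto
      (fun n : ℕ => (∑ i ∈ Finset.range n, x i ω j * x i ω k * g (x i ω, y i ω)) / n) atTop
      (𝓝 (∫ ω, x 0 ω j * x 0 ω k * g (x 0 ω, y 0 ω) ∂P)) := by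
    refine ae_all_iff.2 fun j => ae_all_iff.2 fun k => ?_
    have hm : ∀ j, Measurable fun w : EuclideanSpace ℝ (Fin p) × Bool => w.1 j := fun j =>
      (EuclideanSpace.proj (𝕜 := ℝ) j).continuous.measurable.comp measurable_fst
    exact hd.ae_tendsto_average hGm hG (f := fun w => w.1 j * w.1 k * g w)
      (((hm j).mul (hm k)).mul hg)
      (integrable_mul_mul_of_abs_le_one (g := fun ω => g (x 0 ω, y 0 ω)) hx h1.1 hg0 hg01 j k)
  filter_upwards [hlln] with ω hω η hη
  filter_upwards [eventually_abs_quadratic_sub_le hω hη] with n hn a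
  have h2 := hn a
  rw [sum_sum_mul_integral hx h1.1 hg0 hg01 a] at h2
  convert h2 using 3
  simp only [sq_inner_eq_sum, Finset.sum_mul, Finset.mul_sum, Finset.sum_div, mul_div_assoc]
  rw [Finset.sum_comm]
  refine Finset.sum_congr rfl fun j _ => ?_
  rw [Finset.sum_comm]
  exact Finset.sum_congr rfl fun k _ => Finset.sum_congr rfl fun i _ => by ring

theorem designMatrix_mulVec (x : ℕ → EuclideanSpace ℝ (Fin p)) (n : ℕ) (a : Fin p → ℝ)
    (i : Fin n) : (designMatrix x n *ᵥ a) i = inner ℝ (x i) (WithLp.toLp 2 a) := by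
  rw [inner_eq_sum]
  rfl

/-- Almost surely, for large samples, the wrong-side bound holds with a constant that depends only
on the constant in `CondB4`. -/
theorem IsDataMechanism.ae_eventually_wrongSideBound (hd : IsDataMechanism P G βstar x y)
    (hGm : Measurable G) (hG : ∀ t, 0 < G t ∧ G t < 1) (h1 : CondB1 P (x 0))
    (h2 : CondB2 P (x 0)) (h3 : CondB3 P (x 0)) {l : ℝ} (hl0 : 0 < l)
    (h4 : CondB4 P G βstar (x 0) l) :
    ∀ᵐ ω ∂P, ∀ᶠ n : ℕ in atTop,
      WrongSideBound (designMatrix (fun i => x i ω) n) (fun i => y i ω) (min l 1 / 4) ∧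
      ∃ r : ℝ, 0 < r ∧ ∀ a : EuclideanSpace ℝ (Fin p), r * ‖a‖ ^ 2 ≤
        ∑ i, (designMatrix (fun i => x i ω) n *ᵥ WithLp.ofLp a) i ^ 2 := by
  have hx := hd.measurable_x 0
  set κ := lambdaMin (momentMatrix P (x 0) fun _ => 1) with hκ
  have hκ0 : 0 < κ := h1.2
  set c := min l 1 with hc
  have hc0 : 0 < c := lt_min hl0 one_pos
  have hc1 : c ≤ 1 := min_le_right _ _
  -- By the eigenvalue bound κ‖a‖² ≤ m(a), an error η‖a‖² is at most (c/4)m(a). Two such errors,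
  -- from the slab and from sampling, still leave half of c·m(a).
  set η := c * κ / 4 with hη
  have hη0 : 0 < η := by positivity
  have hηκ : η ≤ κ / 4 := by rw [hη]; nlinarith
  obtain ⟨ε, hε, hεη⟩ := exists_integral_norm_sq_indicator_le hx h2 h3 hη0
  -- The net is fixed before the sample, with mesh equal to the margin, so the almost sure
  -- statements below concern finitely many functions. Its size may depend on p without affecting
  -- the final constant.
  obtain ⟨Γ, hΓs, hΓf, hΓ⟩ := (isCompact_sphere (0 : EuclideanSpace ℝ (Fin p)) 1).finite_cover_balls
    hε
  have hae1 := hd.ae_eventually_abs_average_sub_le hGm hG h1 (g := fun _ => 1) measurable_const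
    (by simp)
  have hae2 := (ae_ball_iff (μ := P) hΓf.countable).2 fun γ _ =>
    hd.ae_eventually_abs_average_sub_le hGm hG h1 (measurable_marginWrongSide ε γ)
      (abs_marginWrongSide_le ε γ)
  filter_upwards [hae1, hae2] with ω hω1 hω2
  have hev2 := (eventually_all_finite hΓf).2 fun γ hγ => hω2 γ hγ η hη0
  filter_upwards [hω1 η hη0, hev2, eventually_gt_atTop 0] with n hn1 hn2 hn0
  have hn : (0 : ℝ) < n := Nat.cast_pos.2 hn0
  set S : EuclideanSpace ℝ (Fin p) → ℝ := fun a => ∑ i ∈ Finset.range n, inner ℝ (x i ω) a ^ 2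
    with hS
  set m : EuclideanSpace ℝ (Fin p) → ℝ := fun a => ∫ ω, inner ℝ (x 0 ω) a ^ 2 ∂P with hm
  have hSm : ∀ a, |S a / n - m a| ≤ η * ‖a‖ ^ 2 := fun a => by simpa [hS, hm] using hn1 a
  have hmκ : ∀ a, κ * ‖a‖ ^ 2 ≤ m a := lambdaMin_mul_norm_sq_le hx h1
  have hSsum : ∀ a : Fin p → ℝ, ∑ i, (designMatrix (fun i => x i ω) n *ᵥ a) i ^ 2 =
      S (WithLp.toLp 2 a) := fun a => by
    simp only [designMatrix_mulVec, hS]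
    exact Fin.sum_univ_eq_sum_range (fun i => inner ℝ (x i ω) (WithLp.toLp 2 a) ^ 2) n
  refine ⟨fun b a => ?_, n * (κ / 2), by positivity, fun a => ?_⟩
  · rw [hSsum]
    simp only [designMatrix_mulVec]
    rw [Fin.sum_univ_eq_sum_range (fun i => inner ℝ (x i ω) (WithLp.toLp 2 a) ^ 2 *
      wrongSide (y i ω) (inner ℝ (x i ω) (WithLp.toLp 2 b))) n]
    set a' := WithLp.toLp 2 a
    set b' := WithLp.toLp 2 b with hb'
    have hS0 : 0 ≤ S a' := Finset.sum_nonneg fun i _ => sq_nonneg _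
    -- At the zero state every observation counts as wrong-side, since both inequalities in
    -- `wrongSide` are weak.
    rcases eq_or_ne b' 0 with hb | hb
    · simp only [hb, inner_zero_right, wrongSide_zero, mul_one]
      change c / 4 * S a' ≤ S a'
      nlinarith
    · have hbn : 0 < ‖b'‖ := norm_pos_iff.2 hb
      have hmem : ‖b'‖⁻¹ • b' ∈ Metric.sphere (0 : EuclideanSpace ℝ (Fin p)) 1 := by
        rw [mem_sphere_zero_iff_norm, norm_smul, norm_inv, norm_norm, inv_mul_cancel₀ hbn.ne']
      obtain ⟨γ, hγ, hbγ⟩ := Set.mem_iUnion₂.1 (hΓ hmem)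
      have hγ1 : ‖γ‖ = 1 := mem_sphere_zero_iff_norm.1 (hΓs hγ)
      have hγ0 : γ ≠ 0 := by rw [← norm_pos_iff, hγ1]; exact one_pos
      have hle : ∑ i ∈ Finset.range n, inner ℝ (x i ω) a' ^ 2 * marginWrongSide ε γ (x i ω, y i ω) ≤
          ∑ i ∈ Finset.range n, inner ℝ (x i ω) a' ^ 2 *
            wrongSide (y i ω) (inner ℝ (x i ω) b') := by
        refine Finset.sum_le_sum fun i _ => mul_le_mul_of_nonneg_left ?_ (sq_nonneg _)
        have h5 : ‖‖b'‖⁻¹ • b' - γ‖ ≤ ε := by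
          rw [← dist_eq_norm]; exact (Metric.mem_ball.1 hbγ).le
        have h6 := marginWrongSide_le h5 (x i ω) (y i ω)
        rwa [inner_smul_right, wrongSide_mul (inv_pos.2 hbn)] at h6
      refine le_trans ?_ hle
      set T := ∑ i ∈ Finset.range n, inner ℝ (x i ω) a' ^ 2 * marginWrongSide ε γ (x i ω, y i ω)
      have e1 := (abs_le.1 (hn2 γ hγ a')).1
      have e2 := hd.le_integral_sq_inner_mul_marginWrongSide hGm hG h1 (ε := ε) hγ1 a'
      have e3 := mul_integral_sq_inner_le hx hGm hG h1 h4 a'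
      have e4 := mul_le_mul_of_nonneg_right (hεη γ hγ0) (sq_nonneg ‖a'‖)
      have e5 := (abs_le.1 (hSm a')).2
      have e6 := hmκ a'
      have hm0 : 0 ≤ m a' := integral_nonneg fun ω => sq_nonneg _
      have e7 : c * m a' ≤ l * m a' := mul_le_mul_of_nonneg_right (min_le_left _ _) hm0
      -- T/n ≥ (c/2)m(a') after both errors, while S(a')/n ≤ 2m(a'); the quotient gives the constant
      -- c/4.
      have hT : c / 4 * (S a' / n) ≤ T / n := by
        have q1 : c * m a' - 2 * (η * ‖a'‖ ^ 2) ≤ T / n := by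
          change l * m a' ≤ _ at e3
          linarith
        have q2 : η * ‖a'‖ ^ 2 ≤ c / 4 * m a' := by
          rw [hη]
          have := mul_le_mul_of_nonneg_left e6 (by positivity : 0 ≤ c / 4)
          linarith
        have q3 : S a' / n ≤ 2 * m a' := by
          have : c / 4 * m a' ≤ m a' := by nlinarith
          linarith
        have q4 := mul_le_mul_of_nonneg_left q3 (by positivity : 0 ≤ c / 4)
        linarith
      rw [← mul_div_assoc, div_le_div_iff_of_pos_right hn] at hT
      exact hT
  · rw [hSsum]
    change n * (κ / 2) * ‖a‖ ^ 2 ≤ S a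
    have e5 := (abs_le.1 (hSm a)).1
    have e6 := hmκ a
    have e7 : η * ‖a‖ ^ 2 ≤ κ / 4 * ‖a‖ ^ 2 := mul_le_mul_of_nonneg_right hηκ (sq_nonneg _)
    have e8 : κ / 2 * ‖a‖ ^ 2 ≤ S a / n := by nlinarith [sq_nonneg ‖a‖]
    rw [le_div_iff₀ hn] at e8
    linarith

end Asymptotics

end ProbitChain

end

/-! ### The asymptotic bound on both rates. -/

theorem proposition5
    -- the inverse link function, the same for all `p`
    (G : ℝ → ℝ) (hG_meas : Measurable G) (hG : ∀ t, 0 < G t ∧ G t < 1)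
    -- for each `p`: a probability space, the true coefficient, the random data
    {Ω : ℕ → Type*} [∀ p, MeasurableSpace (Ω p)] (P : ∀ p, Measure (Ω p))
    [∀ p, IsProbabilityMeasure (P p)]
    (βstar : ∀ p, EuclideanSpace ℝ (Fin p))
    (x : ∀ p, ℕ → Ω p → EuclideanSpace ℝ (Fin p)) (y : ∀ p, ℕ → Ω p → Bool)
    (hdata : ∀ p, 1 ≤ p → ProbitChain.IsDataMechanism (P p) G (βstar p) (x p) (y p))
    -- for each `p`: the prior parameters
    (Q : ∀ p, Matrix (Fin p) (Fin p) ℝ) (v : ∀ p, EuclideanSpace ℝ (Fin p))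
    (hQ : ∀ p, 1 ≤ p → (Q p).PosDef ∨ Q p = 0)
    (hB1 : ∀ p, 1 ≤ p → ProbitChain.CondB1 (P p) (x p 0))
    (hB2 : ∀ p, 1 ≤ p → ProbitChain.CondB2 (P p) (x p 0))
    (hB3 : ∀ p, 1 ≤ p → ProbitChain.CondB3 (P p) (x p 0))
    (hB4 : ∃ ℓ : ℝ, 0 < ℓ ∧ ∀ p, 1 ≤ p → ProbitChain.CondB4 (P p) G (βstar p) (x p 0) ℓ) :
    ∃ ρ : ℝ, ρ < 1 ∧ ∀ p, 1 ≤ p → ∀ᵐ ω ∂(P p),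
      (∀ᶠ n in atTop,
        (ProbitChain.precision (ProbitChain.designMatrix (fun i => x p i ω) n) (Q p)).PosDef ∧
        ProbitChain.PosteriorProper (ProbitChain.designMatrix (fun i => x p i ω) n)
          (fun i => y p i ω) (Q p) (v p)) ∧
      limsup (fun n : ℕ => ProbitChain.rateWasserstein
        (ProbitChain.designMatrix (fun i => x p i ω) n) (fun i => y p i ω) (Q p) (v p)) atTop ≤ ρ ∧
      limsup (fun n : ℕ => ProbitChain.rateTV
        (ProbitChain.designMatrix (fun i => x p i ω) n) (fun i => y p i ω) (Q p) (v p)) atTop ≤ ρ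
      := by
  obtain ⟨l, hl0, hB4⟩ := hB4
  have hc0 : 0 < min l 1 := lt_min hl0 one_pos
  -- One factor 1/4 is the sampling loss in the wrong-side fraction min(l, 1)/4, the other is the
  -- slope gain 1/4. Nothing here depends on p.
  refine ⟨√(1 - min l 1 / 4 / 4), ?_, fun p hp => ?_⟩
  · rw [Real.sqrt_lt' one_pos]
    linarith
  have hQ' : (Q p).PosSemidef := by
    rcases hQ p hp with h | h
    · exact h.posSemidef
    · rw [h]; exact Matrix.PosSemidef.zero
  filter_upwards [(hdata p hp).ae_eventually_wrongSideBound hG_meas hG (hB1 p hp) (hB2 p hp)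
    (hB3 p hp) hl0 (hB4 p hp)] with ω hω
  have key := hω.mono fun n hn => by
    obtain ⟨hw, r, hr0, hr⟩ := hn
    exact ProbitChain.rates_le_of_wrongSideBound (v := v p) hw (by positivity)
      (by linarith [min_le_right l 1]) hQ' hr0 hr
  refine ⟨key.mono fun n hn => ⟨hn.1, hn.2.1⟩, ?_, ?_⟩
  · refine limsup_le_of_le ?_ (key.mono fun n hn => hn.2.2.1)
    -- The real `limsup` is meaningful only with a lower bound on the sequence; rates are
    -- nonnegative by definition, for every n.
    exact isCoboundedUnder_le_of_le atTop (x := 0) fun n =>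
      (ProbitChain.convergenceRate_mem_Icc _ _ _).1
  · refine limsup_le_of_le ?_ (key.mono fun n hn => hn.2.2.2)
    exact isCoboundedUnder_le_of_le atTop (x := 0) fun n =>
      (ProbitChain.convergenceRate_mem_Icc _ _ _).1
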